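/- **Setting.** Let $\xi$ be a random variable with values in a measurable space $\Xi$, and let $\mathbf F:\mathbb R^p\times\Xi\to\mathbb R^q$ be measurable in $\xi$ and differentiable in $x$, with Jacobian $\mathbf F'(x,\xi)$. Let $K\in\mathbb R^{q\times n}$ with $K\neq0$, and let $\psi:\mathbb R^n\to\mathbb R\cup\{+\infty\}$ and $\mathcal R:\mathbb R^p\to\mathbb R\cup\{+\infty\}$ be proper, closed and convex. Put $F(x)=\mathbb E_\xi\mathbf F(x,\xi)$, $F'(x)=\mathbb E_\xi\mathbf F'(x,\xi)$, $\phi_0(u)=\max_y\{\langle u,Ky\rangle-\psi(y)\}$ with maximizer $y_0^*(u)$, $\Phi_0(x)=\phi_0(F(x))$, $\Psi_0=\Phi_0+\mathcal R$ and $\Psi_0^\star=\inf\Psi_0$, and assume $\Psi_0^\star>-\infty$. Let $\|K\|$ be the operator norm and, for Jacobians, $\|\cdot\|$ the Frobenius norm. Assume that, with positive constants $L_F,M_F,\sigma_F,\sigma_J,M_\psi$, for all $x,y\in\operatorname{dom}\Psi_0$, $$\mathbb E\|\mathbf F'(x,\xi)-\mathbf F'(y,\xi)\|^2\le L_F^2\|x-y\|^2,\quad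 \mathbb E\|\mathbf F(x,\xi)-F(x)\|^2\le\sigma_F^2,\quad \mathbb E\|\mathbf F'(x,\xi)-F'(x)\|^2\le\sigma_J^2,\quad \mathbb E\|\mathbf F'(x,\xi)\|^2\le M_F^2,$$ that $\|y\|\le M_\psi$ on $\operatorname{dom}\psi$, and that $\psi$ is $1$-strongly convex. Write $\nabla\Phi_0(x)=F'(x)^\top Ky_0^*(F(x))$ and $\mathcal G_\eta(x)=\frac1\eta\big(x-\mathrm{prox}_{\eta\mathcal R}(x-\eta\nabla\Phi_0(x))\big)$. **Algorithm** (no smoothing, $\gamma_t=0$). Start from $x_0\in\operatorname{dom}\Psi_0$ and let $\tilde F_0,\tilde J_0$ be the averages of $\mathbf F(x_0,\cdot)$ and $\mathbf F'(x_0,\cdot)$ over mini-batches $\mathcal B^0,\hat{\mathcal B}^0$ of sizes $b_0,\hat b_0$. For $t\ge0$ put $v_t=\tilde J_t^\top Ky_0^*(\tilde F_t)$ and $x_{t+1}=(1-\theta)x_t+\theta\,\mathrm{prox}_{\eta\mathcal R}(x_t-\eta v_t)$. For $t=1,\dots,T$, $$\tilde F_t=\beta\tilde F_{t-1}+\frac{\beta}{b_1}\sum_{\xi_i\in\mathcal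 B_t^1}\big[\mathbf F(x_t,\xi_i)-\mathbf F(x_{t-1},\xi_i)\big]+\frac{1-\beta}{b_2}\sum_{\zeta_i\in\mathcal B_t^2}\mathbf F(x_t,\zeta_i),$$ and $\tilde J_t$ is defined in the same way from $\mathbf F'$, with the same $\beta$ and with mini-batches $\hat{\mathcal B}_t^1,\hat{\mathcal B}_t^2$ of sizes $\hat b_1,\hat b_2$. Each mini-batch consists of i.i.d. copies of $\xi$. The four mini-batches of iteration $t$ are jointly independent of all the earlier ones, but may depend on each other. Let $\kappa=1$ if $\mathcal B_t^1$ is independent of $\mathcal B_t^2$ for all $1\le t\le T$, and $\kappa=2$ otherwise; define $\hat\kappa$ in the same way from $\hat{\mathcal B}_t^1,\hat{\mathcal B}_t^2$. The output $\bar x_T$ is $x_t$, $0\le t\le T$, with probability $\frac{\theta_t/L_{\Phi_0}}{\sum_{s=0}^T\theta_s/L_{\Phi_0}}$, where $\theta_t=\theta$ (so it is uniform), chosen independently of the mini-batches. **Constants.** For $c_0>0$ let $$P=\tfrac{\sqrt{26}\|K\|}{3\sqrt{c_0}}\sqrt{\kappa M_F^4\|K\|^2+c_0\hat\kappa L_F^2M_\psi^2},\qquad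 Q=\tfrac{26}{9c_0}\|K\|^2\big(\kappa M_F^2\|K\|^2\sigma_F^2+c_0\hat\kappa M_\psi^2\sigma_J^2\big),\qquad L_{\Phi_0}=L_FM_\psi\|K\|+M_F^2\|K\|^2 .$$ **Theorem.** Let $T\ge0$ and $0<b\le\hat b_0(T+1)$, and let the (integer) mini-batch sizes be $\hat b_1=\hat b_2=b$, $b_1=b_2=c_0b$, $b_0=c_0\hat b_0$ and $\hat b_0=c_1^2[b(T+1)]^{1/3}$ for some $c_1>0$. Suppose that $\frac{\hat b_0(T+1)}{b^3}>\frac{L_{\Phi_0}^4}{P^4}$, and use $$\beta=1-\frac{b^{1/2}}{[\hat b_0(T+1)]^{1/2}},\qquad \theta=\frac{L_{\Phi_0}b^{3/4}}{P[\hat b_0(T+1)]^{1/4}},\qquad \eta=\frac{2}{L_{\Phi_0}(3+\theta)}.$$ Then, relative to $\operatorname{dom}\Psi_0$, $F$ has derivative $F'(x)$ and $\Phi_0$ has gradient $\nabla\Phi_0(x)$ at every $x\in\operatorname{dom}\Psi_0$, and $$\mathbb E\|\mathcal G_\eta(\bar x_T)\|^2\le\frac{\Delta_0}{[b(T+1)]^{2/3}},\qquad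 \Delta_0=16P\sqrt{c_1}\,[\Psi_0(x_0)-\Psi_0^\star]+\frac{24Q}{c_1}.$$ Let $\varepsilon>0$. If $T=\big\lfloor\frac{\Delta_0^{3/2}}{b\varepsilon^3}\big\rfloor$, then $\mathbb E\|\mathcal G_\eta(\bar x_T)\|^2\le\varepsilon^2$, and the numbers of evaluations of $\mathbf F$ and of its Jacobian $\mathbf F'$ are at most $$\Big\lfloor c_0c_1^2\Big(\frac{\Delta_0^{3/2}}{\varepsilon^3}+b\Big)^{1/3}+\frac{3c_0\Delta_0^{3/2}}{\varepsilon^3}\Big\rfloor\quad\text{and}\quad\Big\lfloor c_1^2\Big(\frac{\Delta_0^{3/2}}{\varepsilon^3}+b\Big)^{1/3}+\frac{3\Delta_0^{3/2}}{\varepsilon^3}\Big\rfloor .$$ If $T+1=\frac{\Delta_0^{3/2}}{b\varepsilon^3}$ exactly, then also $\mathbb E\|\mathcal G_\eta(\bar x_T)\|^2\le\varepsilon^2$, and these numbers are at most $\big\lfloor\frac{c_0c_1^2\Delta_0^{1/2}}{\varepsilon}+\frac{3c_0\Delta_0^{3/2}}{\varepsilon^3}\big\rfloor$ and $\big\lfloor\frac{c_1^2\Delta_0^{1/2}}{\varepsilon}+\frac{3\Delta_0^{3/2}}{\varepsilon^3}\big\rfloor$.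 -/

import Mathlib

open MeasureTheory ProbabilityTheory
open scoped RealInnerProductSpace

noncomputable section

namespace MinimaxSGD

/-- `ℝ^d` with its Euclidean norm and inner product. -/
abbrev Vec (d : ℕ) := EuclideanSpace ℝ (Fin d)

/-! ### Extended-real-valued convex functions -/

/-- The effective domain. -/
def dom {d : ℕ} (f : Vec d → EReal) : Set (Vec d) := {x | f x ≠ ⊤}

/-- Convexity of an extended-real-valued function: its epigraph is convex. -/
def ExtConvex {d : ℕ} (f : Vec d → EReal) : Prop :=
  Convex ℝ {z : Vec d × ℝ | f z.1 ≤ (z.2 : EReal)}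

/-- `f` is `m`-strongly convex: `f - (m/2)‖·‖²` is convex. -/
def ExtStronglyConvex {d : ℕ} (m : ℝ) (f : Vec d → EReal) : Prop :=
  ExtConvex fun y => f y - ((m / 2 * ‖y‖ ^ 2 : ℝ) : EReal)

/-- Proper, closed (lower semicontinuous) and convex, with values in `ℝ ∪ {+∞}`. -/
structure ProperClosedConvex {d : ℕ} (f : Vec d → EReal) : Prop where
  ne_bot : ∀ x, f x ≠ ⊥
  dom_nonempty : (dom f).Nonempty
  closed : LowerSemicontinuous f
  convex : ExtConvex f

/-- A global minimizer of `f` (some point, if there is none). -/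
def argmin {d : ℕ} (f : Vec d → EReal) : Vec d :=
  Classical.epsilon fun x => ∀ z, f x ≤ f z

/-- A global maximizer of `f` (some point, if there is none). -/
def argmax {d : ℕ} (f : Vec d → EReal) : Vec d :=
  Classical.epsilon fun x => ∀ z, f z ≤ f x

/-- The proximal operator `prox_f(z) = argmin_x { f(x) + ½‖x - z‖² }`. -/
def prox {d : ℕ} (f : Vec d → EReal) (z : Vec d) : Vec d :=
  argmin fun x => f x + ((1 / 2 * ‖x - z‖ ^ 2 : ℝ) : EReal)

/-! ### The minimax problem -/

/-- The data of `min_x max_y { R(x) + E_ξ ⟨K y, 𝐅(x, ξ)⟩ - ψ(y) }`. The matrix `K ∈ ℝ^{q×n}` is given as a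
linear map; `‖K‖` is its operator norm. -/
structure Problem (p n q : ℕ) (Ξ : Type*) [MeasurableSpace Ξ] where
  /-- the law of the random variable `ξ` -/
  law : Measure Ξ
  /-- the stochastic vector function `𝐅(x, ξ)` -/
  F : Vec p → Ξ → Vec q
  K : Vec n →L[ℝ] Vec q
  ψ : Vec n → EReal
  R : Vec p → EReal

namespace Problem

variable {p n q : ℕ} {Ξ : Type*} [MeasurableSpace Ξ] (M : Problem p n q Ξ)

/-- The Jacobian `𝐅'(x, ξ)` with respect to `x`. -/
def jac (x : Vec p) (ξ : Ξ) : Vec p →L[ℝ] Vec q := fderiv ℝ (fun z => M.F z ξ) x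

/-- The mean `F(x) = E_ξ 𝐅(x, ξ)`. -/
def meanF (x : Vec p) : Vec q := ∫ ξ, M.F x ξ ∂M.law

/-- The mean Jacobian `F'(x) = E_ξ 𝐅'(x, ξ)`. (The theorem also asserts that this is the derivative of `F`
along the domain of the problem.) -/
def meanJac (x : Vec p) : Vec p →L[ℝ] Vec q := ∫ ξ, M.jac x ξ ∂M.law

/-- `φ₀(u) = max_y { ⟨u, K y⟩ - ψ(y) }`. -/
def φ₀ (u : Vec q) : EReal := ⨆ y : Vec n, ((⟪u, M.K y⟫ : ℝ) : EReal) - M.ψ y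

/-- `y*₀(u)`, the maximizer of `⟨u, K y⟩ - ψ(y)`. -/
def yStar (u : Vec q) : Vec n := argmax fun y => ((⟪u, M.K y⟫ : ℝ) : EReal) - M.ψ y

/-- `Φ₀(x) = φ₀(F(x))`. -/
def Φ₀ (x : Vec p) : EReal := M.φ₀ (M.meanF x)

/-- The objective `Ψ₀(x) = φ₀(F(x)) + R(x)`. -/
def Ψ₀ (x : Vec p) : EReal := M.Φ₀ x + M.R x

/-- `Ψ₀* = inf_x Ψ₀(x)`. -/
def Ψ₀star : EReal := ⨅ x : Vec p, M.Ψ₀ x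

/-- `∇Φ₀(x) = F'(x)ᵀ K y*₀(F(x))`. (The theorem also asserts that this is the gradient of `Φ₀` along the
domain of the problem.) -/
def gradΦ₀ (x : Vec p) : Vec p :=
  ContinuousLinearMap.adjoint (M.meanJac x) (M.K (M.yStar (M.meanF x)))

/-- The proximal operator of `η R`. -/
def proxR (η : ℝ) (z : Vec p) : Vec p := prox (fun x => (η : EReal) * M.R x) z

/-- The gradient mapping `G_η(x) = (1/η)(x - prox_{ηR}(x - η ∇Φ₀(x)))`. -/
def gradMap (η : ℝ) (x : Vec p) : Vec p := (1 / η) • (x - M.proxR η (x - η • M.gradΦ₀ x))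

end Problem

/-- The squared Frobenius norm of (the matrix of) a linear map. -/
def frobSq {p q : ℕ} (A : Vec p →L[ℝ] Vec q) : ℝ :=
  ∑ j : Fin p, ‖A (EuclideanSpace.single j 1)‖ ^ 2

/-- The assumptions on `𝐅`: measurable in `ξ`, differentiable in `x`, average smooth, of bounded variance, and
average Lipschitz on `dom Ψ₀`. The expectations are Lebesgue integrals with values in `[0, ∞]`; so their
finiteness, hence also the integrability of `𝐅(x, ·)` and `𝐅'(x, ·)` for `x ∈ dom Ψ₀`, is included. -/
structure Problem.SmoothStochastic {p n q : ℕ} {Ξ : Type*} [MeasurableSpace Ξ] (M : Problem p n q Ξ)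
    (LF MF σF σJ : ℝ) : Prop where
  measurable : ∀ x, Measurable (M.F x)
  differentiable : ∀ ξ, Differentiable ℝ fun x => M.F x ξ
  smooth : ∀ x ∈ dom M.Ψ₀, ∀ y ∈ dom M.Ψ₀,
    ∫⁻ ξ, ENNReal.ofReal (frobSq (M.jac x ξ - M.jac y ξ)) ∂M.law ≤ ENNReal.ofReal (LF ^ 2 * ‖x - y‖ ^ 2)
  variance_F : ∀ x ∈ dom M.Ψ₀,
    ∫⁻ ξ, ENNReal.ofReal (‖M.F x ξ - M.meanF x‖ ^ 2) ∂M.law ≤ ENNReal.ofReal (σF ^ 2)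
  variance_jac : ∀ x ∈ dom M.Ψ₀,
    ∫⁻ ξ, ENNReal.ofReal (frobSq (M.jac x ξ - M.meanJac x)) ∂M.law ≤ ENNReal.ofReal (σJ ^ 2)
  lipschitz : ∀ x ∈ dom M.Ψ₀,
    ∫⁻ ξ, ENNReal.ofReal (frobSq (M.jac x ξ)) ∂M.law ≤ ENNReal.ofReal (MF ^ 2)

/-! ### The mini-batches -/

/-- Mini-batch sizes `b₀, b₁, b₂` for `𝐅` and `b̂₀, b̂₁, b̂₂` for the Jacobian. -/
structure Sizes where
  (b₀ b₁ b₂ bh₀ bh₁ bh₂ : ℕ)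

/-- The random mini-batches: `B⁰, B̂⁰`, and `B¹_t, B²_t, B̂¹_t, B̂²_t` for iteration `t ≥ 1`. -/
structure Samples (sz : Sizes) (Ω Ξ : Type*) where
  B₀ : Fin sz.b₀ → Ω → Ξ
  Bh₀ : Fin sz.bh₀ → Ω → Ξ
  B₁ : ℕ → Fin sz.b₁ → Ω → Ξ
  B₂ : ℕ → Fin sz.b₂ → Ω → Ξ
  Bh₁ : ℕ → Fin sz.bh₁ → Ω → Ξ
  Bh₂ : ℕ → Fin sz.bh₂ → Ω → Ξ

section Sampling

variable {Ω Ξ : Type*} [mΞ : MeasurableSpace Ξ]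

/-- The σ-field generated by a mini-batch. -/
@[reducible] def batchSigma {m : ℕ} (B : Fin m → Ω → Ξ) : MeasurableSpace Ω :=
  ⨆ i, MeasurableSpace.comap (B i) mΞ

/-- A mini-batch of independent samples with the given law. -/
structure IsBatch [MeasurableSpace Ω] (μ : Measure Ω) (law : Measure Ξ) {m : ℕ} (B : Fin m → Ω → Ξ) :
    Prop where
  measurable : ∀ i, Measurable (B i)
  map_eq : ∀ i, μ.map (B i) = law
  indep : iIndepFun B μ

variable {sz : Sizes}

/-- The σ-field generated by the four mini-batches of iteration `t`. -/
@[reducible] def Samples.newSigma (S : Samples sz Ω Ξ) (t : ℕ) : MeasurableSpace Ω :=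
  batchSigma (S.B₁ t) ⊔ batchSigma (S.Bh₁ t) ⊔ batchSigma (S.B₂ t) ⊔ batchSigma (S.Bh₂ t)

/-- The σ-field `ℱ_t` generated by all mini-batches up to iteration `t`. -/
@[reducible] def Samples.sigma (S : Samples sz Ω Ξ) (t : ℕ) : MeasurableSpace Ω :=
  batchSigma S.B₀ ⊔ batchSigma S.Bh₀ ⊔ ⨆ s ∈ Finset.Icc 1 t, S.newSigma s

/-- Each mini-batch is i.i.d., and the mini-batches of iteration `t` are drawn independently of the past
`ℱ_{t-1}`. The mini-batches of one and the same iteration may depend on each other in any way. -/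
structure Samples.Valid [mΩ : MeasurableSpace Ω] (S : Samples sz Ω Ξ) (μ : Measure Ω) (law : Measure Ξ)
    (T : ℕ) : Prop where
  B₀ : IsBatch μ law S.B₀
  Bh₀ : IsBatch μ law S.Bh₀
  B₁ : ∀ t ∈ Finset.Icc 1 T, IsBatch μ law (S.B₁ t)
  B₂ : ∀ t ∈ Finset.Icc 1 T, IsBatch μ law (S.B₂ t)
  Bh₁ : ∀ t ∈ Finset.Icc 1 T, IsBatch μ law (S.Bh₁ t)
  Bh₂ : ∀ t ∈ Finset.Icc 1 T, IsBatch μ law (S.Bh₂ t)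
  indep_past : ∀ t ∈ Finset.Icc 1 T, Indep (S.newSigma t) (S.sigma (t - 1)) μ

open Classical in
/-- `κ = 1` if `B¹_t` is independent of `B²_t` (for all iterations `t`), and `κ = 2` otherwise. -/
def Samples.kappa [MeasurableSpace Ω] (S : Samples sz Ω Ξ) (μ : Measure Ω) (T : ℕ) : ℝ :=
  if ∀ t ∈ Finset.Icc 1 T, Indep (batchSigma (S.B₁ t)) (batchSigma (S.B₂ t)) μ then 1 else 2

open Classical in
/-- `κ̂ = 1` if `B̂¹_t` is independent of `B̂²_t` (for all iterations `t`), and `κ̂ = 2` otherwise. -/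
def Samples.kappaHat [MeasurableSpace Ω] (S : Samples sz Ω Ξ) (μ : Measure Ω) (T : ℕ) : ℝ :=
  if ∀ t ∈ Finset.Icc 1 T, Indep (batchSigma (S.Bh₁ t)) (batchSigma (S.Bh₂ t)) μ then 1 else 2

end Sampling

/-! ### The algorithm -/

/-- The weights `β_t, β̂_t` and the step-sizes `θ_t, η_t`. -/
structure Params where
  (β βh θ η : ℕ → ℝ)

/-- The state of the algorithm at iteration `t`: the iterate `x_t`, the estimators `F̃_t` and `J̃_t`, and the
numbers of evaluations of `𝐅(·, ξ)` and of `𝐅'(·, ξ)` made so far. -/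
structure State (p q : ℕ) where
  x : Vec p
  Ft : Vec q
  Jt : Vec p →L[ℝ] Vec q
  evalF : ℕ
  evalJ : ℕ

/-- The gradient estimator `v = J̃ᵀ K y*₀(F̃)`. -/
def Problem.dir {p n q : ℕ} {Ξ : Type*} [MeasurableSpace Ξ] (M : Problem p n q Ξ) (s : State p q) : Vec p :=
  ContinuousLinearMap.adjoint s.Jt (M.K (M.yStar s.Ft))

/-- The next iterate `(1 - θ) x + θ prox_{ηR}(x - η v)`. -/
def Problem.next {p n q : ℕ} {Ξ : Type*} [MeasurableSpace Ξ] (M : Problem p n q Ξ) (θ η : ℝ)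
    (s : State p q) : Vec p :=
  (1 - θ) • s.x + θ • M.proxR η (s.x - η • M.dir s)

/-- The algorithm without smoothing (`γ_t = 0`), run on the samples at the outcome `ω`. -/
def Problem.run {p n q : ℕ} {Ω Ξ : Type*} [MeasurableSpace Ξ] (M : Problem p n q Ξ) (par : Params)
    {sz : Sizes} (S : Samples sz Ω Ξ) (x₀ : Vec p) (ω : Ω) : ℕ → State p q
  | 0 =>
    { x := x₀
      Ft := (1 / (sz.b₀ : ℝ)) • ∑ i, M.F x₀ (S.B₀ i ω)
      Jt := (1 / (sz.bh₀ : ℝ)) • ∑ i, M.jac x₀ (S.Bh₀ i ω)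
      evalF := sz.b₀
      evalJ := sz.bh₀ }
  | t + 1 =>
    let s := M.run par S x₀ ω t
    let x' := M.next (par.θ t) (par.η t) s
    { x := x'
      Ft := par.β t • s.Ft
        + (par.β t / (sz.b₁ : ℝ)) • ∑ i, (M.F x' (S.B₁ (t + 1) i ω) - M.F s.x (S.B₁ (t + 1) i ω))
        + ((1 - par.β t) / (sz.b₂ : ℝ)) • ∑ i, M.F x' (S.B₂ (t + 1) i ω)
      Jt := par.βh t • s.Jt
        + (par.βh t / (sz.bh₁ : ℝ)) • ∑ i, (M.jac x' (S.Bh₁ (t + 1) i ω) - M.jac s.x (S.Bh₁ (t + 1) i ω))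
        + ((1 - par.βh t) / (sz.bh₂ : ℝ)) • ∑ i, M.jac x' (S.Bh₂ (t + 1) i ω)
      evalF := s.evalF + (2 * sz.b₁ + sz.b₂)
      evalJ := s.evalJ + (2 * sz.bh₁ + sz.bh₂) }

/-- The random output index: independent of all the samples, with
`Prob{index = t} = (θ_t / L) / ∑_{s ≤ T} θ_s / L`. -/
structure IsOutputIndex {Ω Ξ : Type*} [MeasurableSpace Ω] [MeasurableSpace Ξ] {sz : Sizes}
    (S : Samples sz Ω Ξ) (μ : Measure Ω) (par : Params) (L : ℝ) (T : ℕ) (idx : Ω → Fin (T + 1)) : Prop where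
  measurable : Measurable idx
  prob : ∀ t : Fin (T + 1), μ.real (idx ⁻¹' {t}) = par.θ t / L / ∑ s : Fin (T + 1), par.θ s / L
  indep : Indep (MeasurableSpace.comap idx inferInstance) (S.sigma T) μ

/-! ### The constants -/

/-- `L_{Φ₀} = L_F M_ψ ‖K‖ + M_F² ‖K‖²` (here `k = ‖K‖`). -/
def constL (k LF MF Mψ : ℝ) : ℝ := LF * Mψ * k + MF ^ 2 * k ^ 2

/-- `P = (√26 ‖K‖ / (3 √c₀)) √(κ M_F⁴ ‖K‖² + c₀ κ̂ L_F² M_ψ²)`. -/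
def constP (k LF MF Mψ c₀ κ κh : ℝ) : ℝ :=
  √26 * k / (3 * √c₀) * √(κ * MF ^ 4 * k ^ 2 + c₀ * κh * LF ^ 2 * Mψ ^ 2)

/-- `Q = (26 / (9 c₀)) ‖K‖² (κ M_F² ‖K‖² σ_F² + c₀ κ̂ M_ψ² σ_J²)`. -/
def constQ (k MF Mψ σF σJ c₀ κ κh : ℝ) : ℝ :=
  26 / (9 * c₀) * k ^ 2 * (κ * MF ^ 2 * k ^ 2 * σF ^ 2 + c₀ * κh * Mψ ^ 2 * σJ ^ 2)

end MinimaxSGD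

end

set_option linter.unusedSectionVars false

/-! The proof plays a pathwise descent inequality against a contraction in mean square of the
estimation errors.

Since `ψ` is 1-strongly convex, `y*₀(u)` is the proximal point of `ψ - ½‖·‖²` at `Kᵀu`. Hence `y*₀`
is `‖K‖`-Lipschitz, and the quadratic growth of the inner problem at its maximizer gives `φ₀` the
gradient `K y*₀(u)` and a quadratic upper bound of modulus `‖K‖²`. Composition with the mean `F`,
whose linearization error is at most `(LF/2)‖y - x‖²`, yields a descent lemma for `Φ₀` with constant
`L` (`Φ₀_descent`). The moment bounds hold only on the domain; it is that of `R`, hence convex, and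
contains every iterate.

A step along the inexact gradient then satisfies (`next_descent`) `Ψ₀(x_{t+1}) + θ/(16L)‖G_η(x_t)‖²
+ L/(2θ)‖x_{t+1} - x_t‖² ≤ Ψ₀(x_t) + (θ/L) E_t`, where `E_t` (`errorSq`) weighs the squared errors
of `F̃_t` and `J̃_t`.

The error of a hybrid estimator at time `t+1` is `β` times its error at time `t` plus centred noise
from samples independent of the past, which already determines `x_{t+1}`. So the cross terms vanish
(`integral_recursion_le`), and with `w_t = 𝔼 E_t`, `a_t = 𝔼‖x_{t+1} - x_t‖²`, `w_{t+1} ≤ β² w_t +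
(β²P²/(2b)) a_t + (1-β)²Q/(2b)` and `w_0 ≤ Q/(2b̂₀)`.

Summation bounds `∑ w_t` at the price of a factor `1/(1-β²)`. The terms in `a_t` are absorbed by the
step terms `L/(2θ) a_t` of the descent as soon as `θ²P² ≤ L²b(1-β)`, which the prescribed `θ` turns
into an equality (`sum_le_of_recursion`, `sum_integral_gradMap_le`). The prescribed `β` balances the
initial noise against the accumulated noise, and a uniform output index turns the sum into an
expectation. Inserting `b̂₀` gives the rate (`rate_of_sum_le`). -/

namespace MinimaxSGD

/-! ### Proximal operators of proper closed convex functions -/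

namespace ProperClosedConvex

variable {d : ℕ} {f : Vec d → EReal}

lemma coe_toReal (hf : ProperClosedConvex f) {x : Vec d} (hx : x ∈ dom f) :
    (((f x).toReal : ℝ) : EReal) = f x :=
  EReal.coe_toReal hx (hf.ne_bot x)

lemma convexOn_toReal (hf : ProperClosedConvex f) :
    ConvexOn ℝ (dom f) fun x => (f x).toReal := by
  have key : ∀ x ∈ dom f, ∀ y ∈ dom f, ∀ a b : ℝ, 0 ≤ a → 0 ≤ b → a + b = 1 →
      f (a • x + b • y) ≤ ((a * (f x).toReal + b * (f y).toReal : ℝ) : EReal) := by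
    intro x hx y hy a b ha hb hab
    have := hf.convex (x := (x, (f x).toReal)) (y := (y, (f y).toReal))
      (hf.coe_toReal hx).ge (hf.coe_toReal hy).ge ha hb hab
    simpa using this
  have hdom : ∀ x ∈ dom f, ∀ y ∈ dom f, ∀ a b : ℝ, 0 ≤ a → 0 ≤ b → a + b = 1 →
      a • x + b • y ∈ dom f := fun x hx y hy a b ha hb hab =>
    ne_top_of_le_ne_top (EReal.coe_ne_top _) (key x hx y hy a b ha hb hab)
  refine ⟨fun x hx y hy a b ha hb hab => hdom x hx y hy a b ha hb hab, ?_⟩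
  intro x hx y hy a b ha hb hab
  have h1 := key x hx y hy a b ha hb hab
  rw [← hf.coe_toReal (hdom x hx y hy a b ha hb hab), EReal.coe_le_coe_iff] at h1
  simpa using h1

lemma convex_dom (hf : ProperClosedConvex f) : Convex ℝ (dom f) := hf.convexOn_toReal.1

/-- A proper closed convex function decreases at most linearly. -/
lemma exists_linear_lower_bound (hf : ProperClosedConvex f) {x₀ : Vec d} (hx₀ : x₀ ∈ dom f) :
    ∃ c : ℝ, 0 ≤ c ∧ ∀ x ∈ dom f, (f x₀).toReal - c * (1 + ‖x - x₀‖) ≤ (f x).toReal := by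
  obtain ⟨a, ha, hmin⟩ := LowerSemicontinuousOn.exists_isMinOn (s := Metric.closedBall x₀ 1)
    ⟨x₀, by simp⟩ (isCompact_closedBall x₀ 1) (hf.closed.lowerSemicontinuousOn _)
  have hle : ∀ x ∈ Metric.closedBall x₀ 1, f a ≤ f x := fun x hx => hmin hx
  have hax₀ : f a ≤ f x₀ := hle x₀ (by simp)
  have had : a ∈ dom f := ne_top_of_le_ne_top hx₀ hax₀
  have hreal : ∀ x ∈ Metric.closedBall x₀ 1, x ∈ dom f → (f a).toReal ≤ (f x).toReal :=
    fun x hx hxd => EReal.toReal_le_toReal (hle x hx) (hf.ne_bot a) hxd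
  have h0 := hreal x₀ (by simp) hx₀
  -- The constant is the drop of `f` from `x₀` to its minimum `f a` over the unit ball.
  refine ⟨(f x₀).toReal - (f a).toReal, by linarith, fun x hx => ?_⟩
  by_cases hr : ‖x - x₀‖ ≤ 1
  · have h1 := hreal x (by simpa [dist_eq_norm] using hr) hx
    nlinarith [norm_nonneg (x - x₀)]
  -- Far from `x₀`, convexity is used at the point of the segment at distance 1 from `x₀`, where `f`
  -- is at least `f a`.
  · push Not at hr
    set r := ‖x - x₀‖
    have hr0 : 0 < r := by linarith
    have hc := (And.right hf.convexOn_toReal :) hx₀ hx (a := 1 - 1 / r) (b := 1 / r)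
      (by rw [sub_nonneg, div_le_one hr0]; exact hr.le) (by positivity) (by ring)
    have hd := hf.convex_dom hx₀ hx (a := 1 - 1 / r) (b := 1 / r)
      (by rw [sub_nonneg, div_le_one hr0]; exact hr.le) (by positivity) (by ring)
    have hball : (1 - 1 / r) • x₀ + (1 / r) • x ∈ Metric.closedBall x₀ 1 := by
      rw [Metric.mem_closedBall, dist_eq_norm]
      have : (1 - 1 / r) • x₀ + (1 / r) • x - x₀ = (1 / r) • (x - x₀) := by module
      rw [this, norm_smul, Real.norm_of_nonneg (by positivity)]
      rw [one_div, inv_mul_cancel₀ hr0.ne']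
    have h1 := (hreal _ hball hd).trans hc
    simp only [smul_eq_mul] at h1
    have h2 := mul_le_mul_of_nonneg_left h1 hr0.le
    have h3 : r * ((1 - 1 / r) * (f x₀).toReal + 1 / r * (f x).toReal)
        = (r - 1) * (f x₀).toReal + (f x).toReal := by field_simp
    rw [h3] at h2
    nlinarith

/-- A lower semicontinuous function attains its minimum on a ball, and outside a large ball the
quadratic beats the linear lower bound. Existence is what makes the `epsilon` term `prox`
meaningful. -/
lemma exists_prox (hf : ProperClosedConvex f) (z : Vec d) :
    ∃ x, ∀ y, f x + ((1 / 2 * ‖x - z‖ ^ 2 : ℝ) : EReal) ≤ f y + ((1 / 2 * ‖y - z‖ ^ 2 : ℝ) : EReal) := by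
  obtain ⟨x₀, hx₀⟩ := hf.dom_nonempty
  obtain ⟨c, hc, hlow⟩ := hf.exists_linear_lower_bound hx₀
  set h : Vec d → EReal := fun x => f x + ((1 / 2 * ‖x - z‖ ^ 2 : ℝ) : EReal) with hh
  have hlsc : LowerSemicontinuous h := by
    refine LowerSemicontinuous.add' hf.closed ?_ ?_
    · refine Continuous.lowerSemicontinuous ?_
      exact continuous_coe_real_ereal.comp (by fun_prop)
    · intro x
      refine EReal.continuousAt_add ?_ ?_
      · right; exact EReal.coe_ne_bot _
      · right; exact EReal.coe_ne_top _
  -- With `m = ‖x₀ - z‖`, a radius `s ≥ 2c + 2m + 2` already forces `½(s - m)² ≥ c(1 + s) + ½m²`, so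
  -- no point outside the ball does better than `x₀`.
  set ρ : ℝ := 2 * c + 2 * ‖x₀ - z‖ + 2 + c + ‖x₀ - z‖ ^ 2 with hρ
  have hρ0 : 0 ≤ ρ := by positivity
  obtain ⟨a, ha, hmin⟩ := LowerSemicontinuousOn.exists_isMinOn (s := Metric.closedBall x₀ ρ)
    ⟨x₀, by simp [hρ0]⟩ (isCompact_closedBall x₀ ρ) (hlsc.lowerSemicontinuousOn _)
  have hle : ∀ x ∈ Metric.closedBall x₀ ρ, h a ≤ h x := fun x hx => hmin hx
  refine ⟨a, fun y => ?_⟩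
  change h a ≤ h y
  by_cases hy : y ∈ Metric.closedBall x₀ ρ
  · exact hle y hy
  refine (hle x₀ (by simp [hρ0])).trans ?_
  by_cases hyd : y ∈ dom f
  · simp only [hh]
    rw [← hf.coe_toReal hx₀, ← hf.coe_toReal hyd, ← EReal.coe_add, ← EReal.coe_add,
      EReal.coe_le_coe_iff]
    have h1 := hlow y hyd
    rw [Metric.mem_closedBall, dist_eq_norm, not_le] at hy
    have h2 : ‖y - x₀‖ ≤ ‖y - z‖ + ‖x₀ - z‖ := by
      have := norm_sub_le (y - z) (x₀ - z)
      simpa using this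
    have h4 := norm_nonneg (x₀ - z)
    have h5 : 0 ≤ ‖y - x₀‖ - ‖x₀ - z‖ := by nlinarith [sq_nonneg (‖x₀ - z‖)]
    have h6 : (‖y - x₀‖ - ‖x₀ - z‖) ^ 2 ≤ ‖y - z‖ ^ 2 :=
      pow_le_pow_left₀ h5 (by linarith) 2
    set s := ‖y - x₀‖
    set m := ‖x₀ - z‖
    have h7 : s * (2 * c + 2 * m + 2) ≤ s * s :=
      mul_le_mul_of_nonneg_left (by nlinarith [sq_nonneg m]) (norm_nonneg _)
    nlinarith [sq_nonneg m]
  · have : f y = ⊤ := by simpa [dom] using hyd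
    change _ ≤ f y + _
    rw [this, EReal.top_add_coe]
    exact le_top

lemma prox_le (hf : ProperClosedConvex f) (z y : Vec d) :
    f (prox f z) + ((1 / 2 * ‖prox f z - z‖ ^ 2 : ℝ) : EReal)
      ≤ f y + ((1 / 2 * ‖y - z‖ ^ 2 : ℝ) : EReal) :=
  Classical.epsilon_spec (hf.exists_prox z) y

lemma prox_mem_dom (hf : ProperClosedConvex f) (z : Vec d) : prox f z ∈ dom f := by
  obtain ⟨x₀, hx₀⟩ := hf.dom_nonempty
  intro h
  have := hf.prox_le z x₀
  rw [h, EReal.top_add_coe, ← hf.coe_toReal hx₀, ← EReal.coe_add] at this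
  exact EReal.coe_ne_top _ (top_le_iff.mp this)

/-- The first-order optimality condition that characterizes the proximal point. -/
lemma prox_subgradient (hf : ProperClosedConvex f) (z : Vec d) {y : Vec d} (hy : y ∈ dom f) :
    (f (prox f z)).toReal + ⟪z - prox f z, y - prox f z⟫ ≤ (f y).toReal := by
  set x := prox f z
  have hx : x ∈ dom f := hf.prox_mem_dom z
  -- Minimality against the point `(1-s)x + sy`, divided by `s`, gives the claim up to an error that
  -- vanishes with `s`.
  have key : ∀ s : ℝ, 0 < s → s ≤ 1 →
      (f x).toReal + ⟪z - x, y - x⟫ - s / 2 * ‖y - x‖ ^ 2 ≤ (f y).toReal := by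
    intro s hs hs1
    have hd := hf.convex_dom hx hy (a := 1 - s) (b := s) (by linarith) hs.le (by ring)
    have hc := (And.right hf.convexOn_toReal :) hx hy (a := 1 - s) (b := s) (by linarith) hs.le (by ring)
    have hp := hf.prox_le z ((1 - s) • x + s • y)
    rw [← hf.coe_toReal hd] at hp
    change f x + ((1 / 2 * ‖x - z‖ ^ 2 : ℝ) : EReal) ≤ _ at hp
    rw [← hf.coe_toReal hx, ← EReal.coe_add, ← EReal.coe_add, EReal.coe_le_coe_iff] at hp
    have e1 : (1 - s) • x + s • y - z = s • (y - x) - (z - x) := by module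
    have e2 : x - z = -(z - x) := by abel
    rw [e1, e2, norm_neg, norm_sub_sq_real (s • (y - x)) (z - x), norm_smul, inner_smul_left, mul_pow,
      Real.norm_of_nonneg hs.le, real_inner_comm] at hp
    simp only [smul_eq_mul, conj_trivial] at hp hc
    have h8 : s * ((f x).toReal + ⟪z - x, y - x⟫ - s / 2 * ‖y - x‖ ^ 2) ≤ s * (f y).toReal := by
      nlinarith
    exact le_of_mul_le_mul_left h8 hs
  by_contra hcon
  push Not at hcon
  set δ := (f x).toReal + ⟪z - x, y - x⟫ - (f y).toReal with hδ
  have hδ0 : 0 < δ := by linarith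
  set N := ‖y - x‖ ^ 2
  have hN : 0 ≤ N := by positivity
  -- Instead of a limit, an explicit `s` with `s N ≤ δ`: the error is then at most `δ/2`, less than
  -- the supposed gap `δ`.
  have h1 := key (min 1 (δ / (N + 1))) (by positivity) (min_le_left _ _)
  have h2 : min 1 (δ / (N + 1)) * N ≤ δ := by
    calc min 1 (δ / (N + 1)) * N ≤ δ / (N + 1) * (N + 1) := by
          gcongr
          · exact min_le_right _ _
          · linarith
      _ = δ := by field_simp
  nlinarith

/-- Add the two optimality conditions, each tested at the other proximal point: the values of `f`
cancel, and Cauchy–Schwarz concludes. -/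
lemma norm_prox_sub_prox_le (hf : ProperClosedConvex f) (z w : Vec d) :
    ‖prox f z - prox f w‖ ≤ ‖z - w‖ := by
  have h1 := hf.prox_subgradient z (hf.prox_mem_dom w)
  have h2 := hf.prox_subgradient w (hf.prox_mem_dom z)
  set x := prox f z
  set y := prox f w
  have h3 : ⟪z - x, y - x⟫ + ⟪w - y, x - y⟫ = ‖x - y‖ ^ 2 - ⟪z - w, x - y⟫ := by
    rw [← real_inner_self_eq_norm_sq]
    have e : y - x = -(x - y) := by abel
    rw [e, inner_neg_right, ← sub_eq_neg_add, ← inner_sub_left, ← inner_sub_left]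
    congr 1; abel
  have h4 : ‖x - y‖ ^ 2 ≤ ‖z - w‖ * ‖x - y‖ := by
    have := real_inner_le_norm (z - w) (x - y); linarith
  by_contra hcon
  push Not at hcon
  nlinarith [norm_nonneg (z - w), norm_nonneg (x - y)]

lemma continuous_prox (hf : ProperClosedConvex f) : Continuous (prox f) :=
  (LipschitzWith.of_dist_le_mul (K := 1) fun z w => by
    simpa [dist_eq_norm] using hf.norm_prox_sub_prox_le z w).continuous

lemma const_mul (hf : ProperClosedConvex f) {η : ℝ} (hη : 0 < η) :
    ProperClosedConvex fun x => (η : EReal) * f x := by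
  have hne : ∀ x, (η : EReal) * f x ≠ ⊥ := by
    intro x h
    induction hx : f x with
    | bot => exact hf.ne_bot x hx
    | top => rw [hx, EReal.coe_mul_top_of_pos hη] at h; exact top_ne_bot h
    | coe r => rw [hx, ← EReal.coe_mul] at h; exact EReal.coe_ne_bot _ h
  refine ⟨hne, ?_, ?_, ?_⟩
  · obtain ⟨x₀, hx₀⟩ := hf.dom_nonempty
    refine ⟨x₀, ?_⟩
    change (η : EReal) * f x₀ ≠ ⊤
    rw [← hf.coe_toReal hx₀, ← EReal.coe_mul]
    exact EReal.coe_ne_top _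
  · refine Continuous.comp_lowerSemicontinuous (g := fun y : EReal => (η : EReal) * y)
      ?_ hf.closed ?_
    · refine continuous_iff_continuousAt.mpr fun y => ?_
      exact (EReal.continuousAt_mul (p := ((η : EReal), y)) (by simp [hη.ne']) (by simp [hη.ne'])
        (by simp) (by simp)).comp (f := fun y : EReal => ((η : EReal), y)) (by fun_prop)
    · intro a b hab
      exact mul_le_mul_of_nonneg_left hab (by exact_mod_cast hη.le)
  -- The epigraph of `η f` is the preimage of that of `f` under the linear map `(x, r) ↦ (x, r/η)`.
  · have : {z : Vec d × ℝ | (η : EReal) * f z.1 ≤ (z.2 : EReal)}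
        = (LinearMap.prodMap (LinearMap.id : Vec d →ₗ[ℝ] Vec d) (η⁻¹ • (LinearMap.id : ℝ →ₗ[ℝ] ℝ))) ⁻¹'
          {z : Vec d × ℝ | f z.1 ≤ (z.2 : EReal)} := by
      ext ⟨x, r⟩
      simp only [Set.mem_ofPred_eq, Set.mem_preimage, LinearMap.prodMap_apply, LinearMap.id_apply,
        LinearMap.smul_apply, smul_eq_mul]
      induction hx : f x with
      | bot => exact absurd hx (hf.ne_bot x)
      | top =>
        rw [EReal.coe_mul_top_of_pos hη, top_le_iff, top_le_iff]
        exact iff_of_false (EReal.coe_ne_top _) (EReal.coe_ne_top _)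
      | coe s =>
        rw [← EReal.coe_mul, EReal.coe_le_coe_iff, EReal.coe_le_coe_iff, inv_mul_eq_div,
          le_div_iff₀ hη, mul_comm]
    rw [ExtConvex, this]
    exact hf.convex.linear_preimage _

lemma dom_const_mul (hf : ProperClosedConvex f) {η : ℝ} (hη : 0 < η) :
    dom (fun x => (η : EReal) * f x) = dom f := by
  ext x
  simp only [dom, Set.mem_ofPred_eq]
  induction hx : f x with
  | bot => exact absurd hx (hf.ne_bot x)
  | top => simp [EReal.coe_mul_top_of_pos hη]
  | coe s => simp [← EReal.coe_mul, EReal.coe_ne_top]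

/-- Removing the modulus of strong convexity leaves a proper closed convex function. -/
lemma sub_sq (hf : ProperClosedConvex f) {m : ℝ} (hm : ExtStronglyConvex m f) :
    ProperClosedConvex fun y => f y - ((m / 2 * ‖y‖ ^ 2 : ℝ) : EReal) := by
  have e : (fun y => f y - ((m / 2 * ‖y‖ ^ 2 : ℝ) : EReal))
      = fun y => f y + ((-(m / 2 * ‖y‖ ^ 2) : ℝ) : EReal) := by
    funext y; rw [sub_eq_add_neg, ← EReal.coe_neg]
  refine ⟨?_, ?_, ?_, hm⟩
  · intro x h
    induction hx : f x with
    | bot => exact hf.ne_bot x hx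
    | top => rw [hx, EReal.top_sub_coe] at h; exact top_ne_bot h
    | coe r => rw [hx, ← EReal.coe_sub] at h; exact EReal.coe_ne_bot _ h
  · obtain ⟨x₀, hx₀⟩ := hf.dom_nonempty
    refine ⟨x₀, ?_⟩
    change f x₀ - _ ≠ ⊤
    rw [← hf.coe_toReal hx₀, ← EReal.coe_sub]
    exact EReal.coe_ne_top _
  · rw [e]
    refine LowerSemicontinuous.add' hf.closed ?_ ?_
    · refine Continuous.lowerSemicontinuous ?_
      exact continuous_coe_real_ereal.comp (by fun_prop)
    · intro x
      refine EReal.continuousAt_add ?_ ?_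
      · right; exact EReal.coe_ne_bot _
      · right; exact EReal.coe_ne_top _

end ProperClosedConvex

/-! ### The inner maximization: regularity of `y*₀` and `φ₀` -/

namespace Problem

variable {p n q : ℕ} {Ξ : Type*} [MeasurableSpace Ξ] {M : Problem p n q Ξ}

/-- The maximizer `y*₀(u)` is a proximal point of `ψ - ½‖·‖²`. -/
lemma yStar_eq_prox (hψ : ProperClosedConvex M.ψ) (u : Vec q) :
    M.yStar u = prox (fun y => M.ψ y - ((1 / 2 * ‖y‖ ^ 2 : ℝ) : EReal))
      (ContinuousLinearMap.adjoint M.K u) := by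
  unfold yStar prox argmax argmin
  congr 1
  funext x
  -- Both sides are `epsilon` terms, so equivalent predicates suffice and uniqueness is not needed.
  -- Completing the square with `w = Kᵀu` changes the objective only by its sign and the constant
  -- `½‖w‖²`.
  refine propext (forall_congr' fun z => ?_)
  set w := ContinuousLinearMap.adjoint M.K u with hw
  have hin : ∀ y, ⟪u, M.K y⟫ = ⟪w, y⟫ := fun y => by
    rw [hw, ContinuousLinearMap.adjoint_inner_left]
  have hsq : ∀ y : Vec n, ‖y - w‖ ^ 2 = ‖y‖ ^ 2 - 2 * ⟪w, y⟫ + ‖w‖ ^ 2 := fun y => by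
    rw [norm_sub_sq_real, real_inner_comm]
  beta_reduce
  rw [hin, hin]
  induction hx : M.ψ x with
  | bot => exact absurd hx (hψ.ne_bot x)
  | top =>
    rw [EReal.top_sub_coe, EReal.top_add_coe, EReal.sub_top, le_bot_iff, top_le_iff]
    induction hz : M.ψ z with
    | bot => exact absurd hz (hψ.ne_bot z)
    | top => simp only [EReal.top_sub_coe, EReal.top_add_coe, EReal.sub_top]
    | coe s =>
      rw [← EReal.coe_sub, ← EReal.coe_sub, ← EReal.coe_add]
      exact iff_of_false (EReal.coe_ne_bot _) (EReal.coe_ne_top _)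
  | coe r =>
    induction hz : M.ψ z with
    | bot => exact absurd hz (hψ.ne_bot z)
    | top =>
      rw [EReal.top_sub_coe, EReal.top_add_coe, EReal.sub_top]
      exact iff_of_true bot_le le_top
    | coe s =>
      rw [← EReal.coe_sub, ← EReal.coe_sub, ← EReal.coe_sub, ← EReal.coe_sub, ← EReal.coe_add,
        ← EReal.coe_add, EReal.coe_le_coe_iff, EReal.coe_le_coe_iff, hsq, hsq]
      constructor <;> intro h <;> linarith

lemma sub_half_sq (hψ : ProperClosedConvex M.ψ) (hψ1 : ExtStronglyConvex 1 M.ψ) :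
    ProperClosedConvex fun y => M.ψ y - ((1 / 2 * ‖y‖ ^ 2 : ℝ) : EReal) :=
  hψ.sub_sq hψ1

lemma dom_sub_half_sq (hψ : ProperClosedConvex M.ψ) :
    dom (fun y => M.ψ y - ((1 / 2 * ‖y‖ ^ 2 : ℝ) : EReal)) = dom M.ψ := by
  ext x
  simp only [dom, Set.mem_ofPred_eq]
  induction hx : M.ψ x with
  | bot => exact absurd hx (hψ.ne_bot x)
  | top => simp only [EReal.top_sub_coe]
  | coe s =>
    rw [← EReal.coe_sub]
    exact iff_of_true (EReal.coe_ne_top _) (EReal.coe_ne_top _)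

lemma yStar_mem_dom (hψ : ProperClosedConvex M.ψ) (hψ1 : ExtStronglyConvex 1 M.ψ) (u : Vec q) :
    M.yStar u ∈ dom M.ψ := by
  rw [yStar_eq_prox hψ, ← dom_sub_half_sq hψ]
  exact (sub_half_sq hψ hψ1).prox_mem_dom _

/-- Quadratic growth of the inner problem at its maximizer. -/
lemma yStar_growth (hψ : ProperClosedConvex M.ψ) (hψ1 : ExtStronglyConvex 1 M.ψ) (u : Vec q)
    {y : Vec n} (hy : y ∈ dom M.ψ) :
    ⟪u, M.K y⟫ - (M.ψ y).toReal + 1 / 2 * ‖y - M.yStar u‖ ^ 2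
      ≤ ⟪u, M.K (M.yStar u)⟫ - (M.ψ (M.yStar u)).toReal := by
  have hs := yStar_mem_dom hψ hψ1 u
  have h := (sub_half_sq hψ hψ1).prox_subgradient (ContinuousLinearMap.adjoint M.K u) (y := y)
    (by rw [dom_sub_half_sq hψ]; exact hy)
  rw [← yStar_eq_prox hψ] at h
  rw [← hψ.coe_toReal hy, ← hψ.coe_toReal hs, ← EReal.coe_sub, ← EReal.coe_sub,
    EReal.toReal_coe, EReal.toReal_coe, inner_sub_left, ContinuousLinearMap.adjoint_inner_left,
    inner_sub_right, map_sub, inner_sub_right, real_inner_self_eq_norm_sq] at h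
  rw [norm_sub_sq_real, real_inner_comm (M.yStar u) y]
  linarith

lemma norm_yStar_sub_le (hψ : ProperClosedConvex M.ψ) (hψ1 : ExtStronglyConvex 1 M.ψ)
    (u v : Vec q) : ‖M.yStar u - M.yStar v‖ ≤ ‖M.K‖ * ‖u - v‖ := by
  rw [yStar_eq_prox hψ, yStar_eq_prox hψ]
  refine ((sub_half_sq hψ hψ1).norm_prox_sub_prox_le _ _).trans ?_
  rw [← map_sub]
  refine (ContinuousLinearMap.le_opNorm _ _).trans_eq ?_
  rw [LinearIsometryEquiv.norm_map]

lemma continuous_yStar (hψ : ProperClosedConvex M.ψ) (hψ1 : ExtStronglyConvex 1 M.ψ) :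
    Continuous M.yStar :=
  (LipschitzWith.of_dist_le_mul (K := ‖M.K‖₊) fun z w => by
    simpa [dist_eq_norm] using norm_yStar_sub_le hψ hψ1 z w).continuous

lemma φ₀_eq (hψ : ProperClosedConvex M.ψ) (hψ1 : ExtStronglyConvex 1 M.ψ) (u : Vec q) :
    M.φ₀ u = ((⟪u, M.K (M.yStar u)⟫ - (M.ψ (M.yStar u)).toReal : ℝ) : EReal) := by
  apply le_antisymm
  · refine iSup_le fun y => ?_
    by_cases hy : y ∈ dom M.ψ
    · rw [← hψ.coe_toReal hy, ← EReal.coe_sub, EReal.coe_le_coe_iff]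
      have := yStar_growth hψ hψ1 u hy
      linarith [sq_nonneg ‖y - M.yStar u‖]
    · have : M.ψ y = ⊤ := by simpa [dom] using hy
      rw [this, EReal.sub_top]
      exact bot_le
  · refine le_trans (le_of_eq ?_) (le_iSup _ (M.yStar u))
    rw [← hψ.coe_toReal (yStar_mem_dom hψ hψ1 u), ← EReal.coe_sub, EReal.toReal_coe]

lemma φ₀_toReal (hψ : ProperClosedConvex M.ψ) (hψ1 : ExtStronglyConvex 1 M.ψ) (u : Vec q) :
    (M.φ₀ u).toReal = ⟪u, M.K (M.yStar u)⟫ - (M.ψ (M.yStar u)).toReal := by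
  rw [φ₀_eq hψ hψ1, EReal.toReal_coe]

lemma φ₀_toReal_ge (hψ : ProperClosedConvex M.ψ) (hψ1 : ExtStronglyConvex 1 M.ψ) (u v : Vec q) :
    (M.φ₀ u).toReal + ⟪M.K (M.yStar u), v - u⟫ ≤ (M.φ₀ v).toReal := by
  rw [φ₀_toReal hψ hψ1, φ₀_toReal hψ hψ1]
  have := yStar_growth hψ hψ1 v (yStar_mem_dom hψ hψ1 u)
  rw [inner_sub_right, real_inner_comm v, real_inner_comm u]
  linarith [sq_nonneg ‖M.yStar u - M.yStar v‖]

/-- Strong convexity becomes smoothness of the conjugate: the growth `½‖z - y‖²` between the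
maximizers `y` at `u` and `z` at `v` absorbs, by Young's inequality, the cross term `⟪v - u, K(z -
y)⟫`. -/
lemma φ₀_toReal_le (hψ : ProperClosedConvex M.ψ) (hψ1 : ExtStronglyConvex 1 M.ψ) (u v : Vec q) :
    (M.φ₀ v).toReal
      ≤ (M.φ₀ u).toReal + ⟪M.K (M.yStar u), v - u⟫ + 1 / 2 * ‖M.K‖ ^ 2 * ‖v - u‖ ^ 2 := by
  rw [φ₀_toReal hψ hψ1, φ₀_toReal hψ hψ1]
  have h1 := yStar_growth hψ hψ1 u (yStar_mem_dom hψ hψ1 v)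
  set y := M.yStar u
  set z := M.yStar v
  have h2 : ⟪v - u, M.K (z - y)⟫ ≤ ‖v - u‖ * (‖M.K‖ * ‖z - y‖) :=
    (real_inner_le_norm _ _).trans (by gcongr; exact M.K.le_opNorm _)
  have h3 : ⟪v - u, M.K (z - y)⟫ = ⟪v, M.K z⟫ - ⟪u, M.K z⟫ - ⟪M.K y, v - u⟫ := by
    rw [map_sub, inner_sub_right, inner_sub_left, real_inner_comm (v - u)]
  nlinarith [sq_nonneg (‖M.K‖ * ‖v - u‖ - ‖z - y‖)]

/-- The remainder lies between `0` and a multiple of `‖v - u‖²`. -/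
lemma hasGradientAt_φ₀ (hψ : ProperClosedConvex M.ψ) (hψ1 : ExtStronglyConvex 1 M.ψ)
    (u : Vec q) : HasGradientAt (fun v => (M.φ₀ v).toReal) (M.K (M.yStar u)) u := by
  rw [hasGradientAt_iff_isLittleO]
  have hb : (fun v => (M.φ₀ v).toReal - (M.φ₀ u).toReal - ⟪M.K (M.yStar u), v - u⟫)
      =O[nhds u] fun v => ‖v - u‖ ^ 2 := by
    refine Asymptotics.IsBigO.of_bound (1 / 2 * ‖M.K‖ ^ 2) (Filter.Eventually.of_forall fun v => ?_)
    have h1 := φ₀_toReal_ge hψ hψ1 u v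
    have h2 := φ₀_toReal_le hψ hψ1 u v
    rw [Real.norm_of_nonneg (by linarith), Real.norm_of_nonneg (by positivity)]
    linarith
  refine hb.trans_isLittleO ?_
  have h3 : (fun v : Vec q => ‖v - u‖ ^ 2) =o[nhds u] fun v => ‖v - u‖ ^ 1 := by
    refine (Asymptotics.isLittleO_pow_pow (𝕜 := ℝ) (m := 1) (n := 2) (by norm_num)).comp_tendsto
      (k := fun v : Vec q => ‖v - u‖) ?_
    have : Continuous fun v : Vec q => ‖v - u‖ := by fun_prop
    simpa using this.tendsto u
  simp only [pow_one] at h3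
  exact h3.of_norm_right

lemma coe_toReal_Φ₀ (hψ : ProperClosedConvex M.ψ) (hψ1 : ExtStronglyConvex 1 M.ψ) (x : Vec p) :
    (((M.Φ₀ x).toReal : ℝ) : EReal) = M.Φ₀ x := by
  rw [Φ₀, φ₀_eq hψ hψ1, EReal.toReal_coe]

/-- `φ₀` is real-valued everywhere, so only `R` restricts the domain. This is the source of the
convexity of `dom M.Ψ₀`. -/
lemma dom_Ψ₀ (hψ : ProperClosedConvex M.ψ) (hψ1 : ExtStronglyConvex 1 M.ψ)
    (hR : ProperClosedConvex M.R) : dom M.Ψ₀ = dom M.R := by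
  ext x
  simp only [dom, Set.mem_ofPred_eq, Ψ₀]
  rw [← coe_toReal_Φ₀ hψ hψ1]
  induction hx : M.R x with
  | bot => exact absurd hx (hR.ne_bot x)
  | top => simp only [EReal.coe_add_top]
  | coe s =>
    rw [← EReal.coe_add]
    exact iff_of_true (EReal.coe_ne_top _) (EReal.coe_ne_top _)

lemma Ψ₀_eq (hψ : ProperClosedConvex M.ψ) (hψ1 : ExtStronglyConvex 1 M.ψ)
    (hR : ProperClosedConvex M.R) {x : Vec p} (hx : x ∈ dom M.R) :
    M.Ψ₀ x = (((M.Φ₀ x).toReal + (M.R x).toReal : ℝ) : EReal) := by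
  rw [Ψ₀, EReal.coe_add, coe_toReal_Φ₀ hψ hψ1, hR.coe_toReal hx]

/-- The proximal-gradient optimality condition for `R`. -/
lemma proxR_subgradient (hR : ProperClosedConvex M.R) {η : ℝ} (hη : 0 < η) (z : Vec p)
    {y : Vec p} (hy : y ∈ dom M.R) :
    (M.R (M.proxR η z)).toReal + 1 / η * ⟪z - M.proxR η z, y - M.proxR η z⟫ ≤ (M.R y).toReal := by
  have h := (hR.const_mul hη).prox_subgradient z (y := y) (by rw [hR.dom_const_mul hη]; exact hy)
  simp only [EReal.toReal_mul, EReal.toReal_coe] at h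
  change η * (M.R (M.proxR η z)).toReal + ⟪z - M.proxR η z, y - M.proxR η z⟫ ≤ _ at h
  have : η * ((M.R (M.proxR η z)).toReal + 1 / η * ⟪z - M.proxR η z, y - M.proxR η z⟫)
      ≤ η * (M.R y).toReal := by
    rw [mul_add, ← mul_assoc, mul_one_div_cancel hη.ne', one_mul]; exact h
  exact le_of_mul_le_mul_left this hη

lemma proxR_mem_dom (hR : ProperClosedConvex M.R) {η : ℝ} (hη : 0 < η) (z : Vec p) :
    M.proxR η z ∈ dom M.R := by
  rw [← hR.dom_const_mul hη]
  exact (hR.const_mul hη).prox_mem_dom z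

lemma norm_proxR_sub_le (hR : ProperClosedConvex M.R) {η : ℝ} (hη : 0 < η) (z w : Vec p) :
    ‖M.proxR η z - M.proxR η w‖ ≤ ‖z - w‖ :=
  (hR.const_mul hη).norm_prox_sub_prox_le z w

lemma continuous_proxR (hR : ProperClosedConvex M.R) {η : ℝ} (hη : 0 < η) :
    Continuous (M.proxR η) :=
  (hR.const_mul hη).continuous_prox

end Problem

/-! ### The Frobenius norm as a Hilbert norm -/

section Columns

variable {p q : ℕ}

/-- The columns of a linear map, as a Euclidean vector: its norm is the Frobenius norm. -/
noncomputable def cols : (Vec p →L[ℝ] Vec q) →L[ℝ] PiLp 2 (fun _ : Fin p => Vec q) :=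
  ((PiLp.continuousLinearEquiv 2 ℝ fun _ : Fin p => Vec q).symm :
      (Fin p → Vec q) →L[ℝ] PiLp 2 fun _ : Fin p => Vec q) ∘L
    ContinuousLinearMap.pi fun j => ContinuousLinearMap.apply ℝ (Vec q) (EuclideanSpace.single j 1)

lemma cols_apply (A : Vec p →L[ℝ] Vec q) (j : Fin p) :
    cols A j = A (EuclideanSpace.single j 1) := rfl

lemma norm_cols_sq (A : Vec p →L[ℝ] Vec q) : ‖cols A‖ ^ 2 = frobSq A := by
  rw [PiLp.norm_sq_eq_of_L2]; rfl

lemma ofReal_frobSq (A : Vec p →L[ℝ] Vec q) : ENNReal.ofReal (frobSq A) = ‖cols A‖ₑ ^ 2 := by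
  rw [← norm_cols_sq, ENNReal.ofReal_pow (norm_nonneg _), ofReal_norm]

lemma apply_eq_sum_cols (A : Vec p →L[ℝ] Vec q) (v : Vec p) : A v = ∑ j, v j • cols A j := by
  conv_lhs => rw [← (EuclideanSpace.basisFun (Fin p) ℝ).sum_repr v]
  simp [map_sum, cols_apply]

/-- Cauchy–Schwarz over the columns. It lets the Frobenius assumptions bound operator norms. -/
lemma norm_apply_le_cols (A : Vec p →L[ℝ] Vec q) (v : Vec p) : ‖A v‖ ≤ ‖cols A‖ * ‖v‖ := by
  rw [apply_eq_sum_cols]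
  refine (norm_sum_le _ _).trans ?_
  simp only [norm_smul]
  refine (Real.sum_mul_le_sqrt_mul_sqrt _ _ _).trans_eq ?_
  rw [mul_comm, ← EuclideanSpace.norm_eq, ← PiLp.norm_sq_eq_of_L2, Real.sqrt_sq (norm_nonneg _)]

lemma norm_le_norm_cols (A : Vec p →L[ℝ] Vec q) : ‖A‖ ≤ ‖cols A‖ :=
  A.opNorm_le_bound (norm_nonneg _) (norm_apply_le_cols A)

/-- A linear map is a finite sum of rank-one maps built continuously from its columns, so pointwise
measurability suffices. -/
lemma measurable_clm_iff {α : Type*} [MeasurableSpace α] {f : α → Vec p →L[ℝ] Vec q}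
    (hf : ∀ v, Measurable fun a => f a v) : Measurable f := by
  have : f = fun a => ∑ j : Fin p,
      ContinuousLinearMap.smulRightL ℝ (Vec p) (Vec q) (EuclideanSpace.proj j)
        (f a (EuclideanSpace.single j 1)) := by
    funext a
    ext1 v
    rw [apply_eq_sum_cols]
    simp [cols_apply]
  rw [this]
  refine Finset.measurable_sum _ fun j _ => ?_
  exact (ContinuousLinearMap.continuous _).measurable.comp (hf _)

end Columns

/-! ### Second moments as integrals in `[0, ∞]` -/

section Integrals

variable {α : Type*} [MeasurableSpace α] {ν : Measure α}

lemma ofReal_norm_sq {E : Type*} [SeminormedAddCommGroup E] (v : E) :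
    ENNReal.ofReal (‖v‖ ^ 2) = ‖v‖ₑ ^ 2 := by
  rw [ENNReal.ofReal_pow (norm_nonneg _), ofReal_norm]

lemma lintegral_sq_le_lintegral_sq [IsProbabilityMeasure ν] {f : α → ENNReal}
    (hf : AEMeasurable f ν) : (∫⁻ a, f a ∂ν) ^ 2 ≤ ∫⁻ a, f a ^ 2 ∂ν := by
  have h := ENNReal.lintegral_mul_le_Lp_mul_Lq ν (p := 2) (q := 2)
    (Real.HolderConjugate.two_two) hf (aemeasurable_const (b := (1 : ENNReal)))
  simp only [Pi.mul_apply, mul_one, ENNReal.one_rpow, lintegral_const, measure_univ] at h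
  calc (∫⁻ a, f a ∂ν) ^ 2 ≤ ((∫⁻ a, f a ^ (2 : ℝ) ∂ν) ^ (1 / 2 : ℝ)) ^ 2 := by gcongr
    _ = ∫⁻ a, f a ^ (2 : ℝ) ∂ν := by
      rw [← ENNReal.rpow_natCast, ← ENNReal.rpow_mul]; norm_num
    _ = ∫⁻ a, f a ^ 2 ∂ν := by norm_cast

lemma lintegral_enorm_le_of_sq [IsProbabilityMeasure ν] {E : Type*} [NormedAddCommGroup E]
    {f : α → E} (hf : AEStronglyMeasurable f ν) {c : ℝ} (hc : 0 ≤ c)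
    (h : ∫⁻ a, ‖f a‖ₑ ^ 2 ∂ν ≤ ENNReal.ofReal (c ^ 2)) : ∫⁻ a, ‖f a‖ₑ ∂ν ≤ ENNReal.ofReal c := by
  have h1 := (lintegral_sq_le_lintegral_sq hf.enorm).trans h
  rw [ENNReal.ofReal_pow hc] at h1
  exact (ENNReal.pow_le_pow_left_iff two_ne_zero).mp h1

lemma memLp_two_of_lintegral {E : Type*} [NormedAddCommGroup E] {f : α → E}
    (hf : AEStronglyMeasurable f ν) {c : ℝ} (h : ∫⁻ a, ‖f a‖ₑ ^ 2 ∂ν ≤ ENNReal.ofReal c) :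
    MemLp f 2 ν := by
  rw [memLp_two_iff_integrable_sq_norm hf]
  refine ⟨by fun_prop, ?_⟩
  rw [hasFiniteIntegral_iff_enorm]
  simp only [enorm_pow, enorm_norm]
  exact h.trans_lt ENNReal.ofReal_lt_top

lemma integral_norm_sq_le_of_lintegral {E : Type*} [NormedAddCommGroup E] {f : α → E}
    {c : ℝ} (hc : 0 ≤ c) (hf : AEStronglyMeasurable f ν)
    (h : ∫⁻ a, ‖f a‖ₑ ^ 2 ∂ν ≤ ENNReal.ofReal c) :
    ∫ a, ‖f a‖ ^ 2 ∂ν ≤ c := by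
  rw [integral_eq_lintegral_of_nonneg_ae (Filter.Eventually.of_forall fun a => by positivity)
    (by fun_prop)]
  refine ENNReal.toReal_le_of_le_ofReal hc ?_
  simpa only [ofReal_norm_sq] using h

/-- The increment of a differentiable function is bounded by the integral of its speed, which may be
infinite. -/
lemma enorm_sub_le_lintegral_deriv {E : Type*} [NormedAddCommGroup E] [NormedSpace ℝ E]
    [FiniteDimensional ℝ E] {f f' : ℝ → E} (hf : ∀ s, HasDerivAt f (f' s) s) :
    ‖f 1 - f 0‖ₑ ≤ ∫⁻ s in Set.Ioc (0 : ℝ) 1, ‖f' s‖ₑ := by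
  borelize E
  have := FiniteDimensional.complete ℝ E
  have := FiniteDimensional.proper ℝ E
  by_cases h : ∫⁻ s in Set.Ioc (0 : ℝ) 1, ‖f' s‖ₑ = ⊤
  · rw [h]; exact le_top
  -- Measurability comes for free from `deriv`. Once the speed has finite integral, the fundamental
  -- theorem of calculus applies without continuity of `f'`.
  have hd : f' = deriv f := funext fun s => (hf s).deriv.symm
  have hm : Measurable f' := hd ▸ measurable_deriv f
  have hi : IntervalIntegrable f' volume 0 1 := by
    rw [intervalIntegrable_iff_integrableOn_Ioc_of_le zero_le_one]
    exact ⟨hm.aestronglyMeasurable, lt_top_iff_ne_top.mpr h⟩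
  rw [← intervalIntegral.integral_eq_sub_of_hasDerivAt (fun s _ => hf s) hi,
    intervalIntegral.integral_of_le zero_le_one]
  exact enorm_integral_le_lintegral_enorm _

end Integrals

/-! ### Regularity of the mean `F` and of `Φ₀` on the domain -/

namespace Problem

variable {p n q : ℕ} {Ξ : Type*} [MeasurableSpace Ξ] {M : Problem p n q Ξ} {LF MF σF σJ : ℝ}

lemma SmoothStochastic.hasFDerivAt (hF : M.SmoothStochastic LF MF σF σJ) (x : Vec p) (ξ : Ξ) :
    HasFDerivAt (fun z => M.F z ξ) (M.jac x ξ) x :=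
  (hF.differentiable ξ x).hasFDerivAt

lemma SmoothStochastic.measurable_F (hF : M.SmoothStochastic LF MF σF σJ) :
    Measurable fun z : Vec p × Ξ => M.F z.1 z.2 :=
  measurable_uncurry_of_continuous_of_measurable (u := M.F)
    (fun ξ => (hF.differentiable ξ).continuous) hF.measurable

/-- `F` is jointly measurable, being continuous in `x` and measurable in `ξ`; the Jacobian applied
to a vector is a limit of difference quotients of step `1/k`. -/
lemma SmoothStochastic.measurable_jac (hF : M.SmoothStochastic LF MF σF σJ) :
    Measurable fun z : Vec p × Ξ => M.jac z.1 z.2 := by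
  refine measurable_clm_iff fun v => ?_
  refine measurable_of_tendsto_metrizable
    (f := fun (k : ℕ) (z : Vec p × Ξ) => (k : ℝ) • (M.F (z.1 + (k : ℝ)⁻¹ • v) z.2 - M.F z.1 z.2))
    (fun k => ?_) ?_
  · have h1 : Measurable fun z : Vec p × Ξ => M.F (z.1 + (k : ℝ)⁻¹ • v) z.2 :=
      hF.measurable_F.comp ((measurable_fst.add_const _).prodMk measurable_snd)
    exact (h1.sub hF.measurable_F).const_smul (k : ℝ)
  · rw [tendsto_pi_nhds]
    intro z
    refine (hF.hasFDerivAt z.1 z.2).lim v (c := fun k : ℕ => (k : ℝ)) ?_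
    simpa using tendsto_natCast_atTop_atTop

lemma SmoothStochastic.measurable_jac_right (hF : M.SmoothStochastic LF MF σF σJ) (x : Vec p) :
    Measurable (M.jac x) :=
  hF.measurable_jac.comp measurable_prodMk_left

lemma SmoothStochastic.measurable_cols_jac_right (hF : M.SmoothStochastic LF MF σF σJ)
    (x : Vec p) : Measurable fun ξ => cols (M.jac x ξ) :=
  cols.continuous.measurable.comp (hF.measurable_jac_right x)

lemma SmoothStochastic.memLp_cols_jac (hF : M.SmoothStochastic LF MF σF σJ) {x : Vec p}
    (hx : x ∈ dom M.Ψ₀) : MemLp (fun ξ => cols (M.jac x ξ)) 2 M.law := by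
  have h := hF.lipschitz x hx
  simp only [ofReal_frobSq] at h
  exact memLp_two_of_lintegral (hF.measurable_cols_jac_right x).aestronglyMeasurable h

lemma segment_hasDerivAt (hF : M.SmoothStochastic LF MF σF σJ) (x y : Vec p) (ξ : Ξ) (s : ℝ) :
    HasDerivAt (fun s : ℝ => M.F (x + s • (y - x)) ξ) (M.jac (x + s • (y - x)) ξ (y - x)) s := by
  have h1 : HasDerivAt (fun s : ℝ => x + s • (y - x)) (y - x) s := by
    simpa using ((hasDerivAt_id s).smul_const (y - x)).const_add x
  exact (hF.hasFDerivAt (x + s • (y - x)) ξ).comp_hasDerivAt s h1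

lemma measurable_jac_segment (hF : M.SmoothStochastic LF MF σF σJ) (x y : Vec p) :
    Measurable fun z : Ξ × ℝ => M.jac (x + z.2 • (y - x)) z.1 :=
  hF.measurable_jac.comp (g := fun z : Vec p × Ξ => M.jac z.1 z.2)
    (f := fun z : Ξ × ℝ => (x + z.2 • (y - x), z.1)) (by fun_prop)

lemma segment_mem {D : Set (Vec p)} (hD : Convex ℝ D) {x y : Vec p} (hx : x ∈ D) (hy : y ∈ D)
    {s : ℝ} (hs : s ∈ Set.Ioc (0 : ℝ) 1) : x + s • (y - x) ∈ D :=
  hD.add_smul_sub_mem hx hy ⟨hs.1.le, hs.2⟩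

variable [IsProbabilityMeasure M.law]

lemma SmoothStochastic.measurable_meanF (hF : M.SmoothStochastic LF MF σF σJ) :
    Measurable M.meanF :=
  (hF.measurable_F.stronglyMeasurable.integral_prod_right (ν := M.law)).measurable

lemma SmoothStochastic.measurable_meanJac (hF : M.SmoothStochastic LF MF σF σJ) :
    Measurable M.meanJac :=
  (hF.measurable_jac.stronglyMeasurable.integral_prod_right (ν := M.law)).measurable

/-- The Bochner integral `meanF` defaults to `0` without integrability. This does no harm: a finite
second moment about any constant vector puts `F` in `L²`, so `meanF` is a genuine mean. -/
lemma SmoothStochastic.memLp_F (hF : M.SmoothStochastic LF MF σF σJ) {x : Vec p}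
    (hx : x ∈ dom M.Ψ₀) : MemLp (M.F x) 2 M.law := by
  have h := hF.variance_F x hx
  simp only [ofReal_norm_sq] at h
  have h1 := (memLp_two_of_lintegral
    ((hF.measurable x).sub_const _).aestronglyMeasurable h).add (memLp_const (M.meanF x))
  refine h1.congr_norm (hF.measurable x).aestronglyMeasurable (Filter.Eventually.of_forall fun ξ => ?_)
  simp

lemma SmoothStochastic.integrable_F (hF : M.SmoothStochastic LF MF σF σJ) {x : Vec p}
    (hx : x ∈ dom M.Ψ₀) : Integrable (M.F x) M.law :=
  (hF.memLp_F hx).integrable one_le_two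

lemma SmoothStochastic.integrable_jac (hF : M.SmoothStochastic LF MF σF σJ) {x : Vec p}
    (hx : x ∈ dom M.Ψ₀) : Integrable (M.jac x) M.law :=
  ((hF.memLp_cols_jac hx).integrable one_le_two).mono
    (hF.measurable_jac_right x).aestronglyMeasurable
    (Filter.Eventually.of_forall fun _ => norm_le_norm_cols _)

lemma SmoothStochastic.cols_meanJac (hF : M.SmoothStochastic LF MF σF σJ) {x : Vec p}
    (hx : x ∈ dom M.Ψ₀) : cols (M.meanJac x) = ∫ ξ, cols (M.jac x ξ) ∂M.law :=
  (cols.integral_comp_comm (hF.integrable_jac hx)).symm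

lemma SmoothStochastic.norm_meanJac_le (hF : M.SmoothStochastic LF MF σF σJ) (hMF : 0 < MF)
    {x : Vec p} (hx : x ∈ dom M.Ψ₀) : ‖M.meanJac x‖ ≤ MF := by
  refine (norm_le_norm_cols _).trans ?_
  rw [hF.cols_meanJac hx, ← ENNReal.ofReal_le_ofReal_iff hMF.le, ofReal_norm]
  refine (enorm_integral_le_lintegral_enorm _).trans ?_
  refine lintegral_enorm_le_of_sq (hF.measurable_cols_jac_right x).aestronglyMeasurable hMF.le ?_
  simpa only [ofReal_frobSq] using hF.lipschitz x hx

/-- `𝐅` is Lipschitz in the mean-square sense along the domain. -/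
lemma SmoothStochastic.lintegral_F_sub_le (hF : M.SmoothStochastic LF MF σF σJ)
    (hD : Convex ℝ (dom M.Ψ₀)) {x y : Vec p} (hx : x ∈ dom M.Ψ₀) (hy : y ∈ dom M.Ψ₀) :
    ∫⁻ ξ, ‖M.F y ξ - M.F x ξ‖ₑ ^ 2 ∂M.law ≤ ENNReal.ofReal (MF ^ 2 * ‖y - x‖ ^ 2) := by
  have : IsProbabilityMeasure (volume.restrict (Set.Ioc (0 : ℝ) 1)) := ⟨by simp⟩
  have hm : Measurable fun z : Ξ × ℝ => ‖cols (M.jac (x + z.2 • (y - x)) z.1)‖ₑ ^ 2 :=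
    ((cols.continuous.measurable.comp (measurable_jac_segment hF x y)).enorm).pow_const 2
  have h1 : ∀ ξ, ‖M.F y ξ - M.F x ξ‖ₑ ^ 2
      ≤ ∫⁻ s in Set.Ioc (0 : ℝ) 1, ‖cols (M.jac (x + s • (y - x)) ξ)‖ₑ ^ 2 * ‖y - x‖ₑ ^ 2 := by
    intro ξ
    have h := enorm_sub_le_lintegral_deriv (segment_hasDerivAt hF x y ξ)
    simp only [one_smul, zero_smul, add_zero, add_sub_cancel] at h
    have hm' : Measurable fun s : ℝ => M.jac (x + s • (y - x)) ξ (y - x) :=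
      (ContinuousLinearMap.measurable_apply (y - x)).comp
        ((measurable_jac_segment hF x y).comp measurable_prodMk_left)
    calc ‖M.F y ξ - M.F x ξ‖ₑ ^ 2
        ≤ (∫⁻ s in Set.Ioc (0 : ℝ) 1, ‖M.jac (x + s • (y - x)) ξ (y - x)‖ₑ) ^ 2 := by gcongr
      _ ≤ ∫⁻ s in Set.Ioc (0 : ℝ) 1, ‖M.jac (x + s • (y - x)) ξ (y - x)‖ₑ ^ 2 :=
          lintegral_sq_le_lintegral_sq hm'.enorm.aemeasurable
      _ ≤ _ := by
          refine lintegral_mono fun s => ?_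
          rw [← mul_pow]
          gcongr
          rw [← ofReal_norm, ← ofReal_norm, ← ofReal_norm, ← ENNReal.ofReal_mul (norm_nonneg _)]
          exact ENNReal.ofReal_le_ofReal (norm_apply_le_cols _ _)
  refine (lintegral_mono h1).trans ?_
  -- By Tonelli the expectation is taken at each point of the segment separately; convexity keeps
  -- that point in the domain, where the moment bound holds.
  rw [lintegral_lintegral_swap (hm.mul_const _).aemeasurable]
  have h2 : ∀ s ∈ Set.Ioc (0 : ℝ) 1,
      ∫⁻ ξ, ‖cols (M.jac (x + s • (y - x)) ξ)‖ₑ ^ 2 * ‖y - x‖ₑ ^ 2 ∂M.law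
        ≤ ENNReal.ofReal (MF ^ 2 * ‖y - x‖ ^ 2) := by
    intro s hs
    rw [lintegral_mul_const' _ _ (by finiteness), ENNReal.ofReal_mul (sq_nonneg _), ofReal_norm_sq]
    gcongr
    simpa only [ofReal_frobSq] using hF.lipschitz _ (segment_mem hD hx hy hs)
  refine (setLIntegral_mono' measurableSet_Ioc h2).trans ?_
  simp

/-- The linearization error of the mean `F` is quadratic along the domain. -/
lemma SmoothStochastic.norm_meanF_sub_sub_le (hF : M.SmoothStochastic LF MF σF σJ) (hLF : 0 < LF)
    (hD : Convex ℝ (dom M.Ψ₀)) {x y : Vec p} (hx : x ∈ dom M.Ψ₀) (hy : y ∈ dom M.Ψ₀) :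
    ‖M.meanF y - M.meanF x - M.meanJac x (y - x)‖ ≤ LF / 2 * ‖y - x‖ ^ 2 := by
  have e : M.meanF y - M.meanF x - M.meanJac x (y - x)
      = ∫ ξ, (M.F y ξ - M.F x ξ - M.jac x ξ (y - x)) ∂M.law := by
    have hj : Integrable (fun ξ => M.jac x ξ (y - x)) M.law :=
      (hF.integrable_jac hx).apply_continuousLinearMap _
    rw [integral_sub (f := fun ξ => M.F y ξ - M.F x ξ)
        ((hF.integrable_F hy).sub (hF.integrable_F hx)) hj,
      integral_sub (hF.integrable_F hy) (hF.integrable_F hx),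
      ← ContinuousLinearMap.integral_apply (hF.integrable_jac hx)]
    rfl
  have hm : Measurable fun z : Ξ × ℝ =>
      cols (M.jac (x + z.2 • (y - x)) z.1 - M.jac x z.1) :=
    cols.continuous.measurable.comp ((measurable_jac_segment hF x y).sub
      ((hF.measurable_jac_right x).comp measurable_fst))
  have h1 : ∀ ξ, ‖M.F y ξ - M.F x ξ - M.jac x ξ (y - x)‖ₑ
      ≤ ∫⁻ s in Set.Ioc (0 : ℝ) 1,
        ‖cols (M.jac (x + s • (y - x)) ξ - M.jac x ξ)‖ₑ * ‖y - x‖ₑ := by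
    intro ξ
    -- With the linear part subtracted, the speed is a difference of Jacobians, of mean at most `LF
    -- s ‖y - x‖`. The factor `½` is the integral of `s` over `(0, 1]`.
    have h := enorm_sub_le_lintegral_deriv (f := fun s : ℝ =>
        M.F (x + s • (y - x)) ξ - s • M.jac x ξ (y - x))
      (f' := fun s => M.jac (x + s • (y - x)) ξ (y - x) - (1 : ℝ) • M.jac x ξ (y - x))
      (fun s => (segment_hasDerivAt hF x y ξ s).sub
        ((hasDerivAt_id s).smul_const (M.jac x ξ (y - x))))
    simp only [one_smul, zero_smul, add_zero, add_sub_cancel, sub_zero] at h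
    have e2 : M.F y ξ - M.F x ξ - M.jac x ξ (y - x)
        = M.F y ξ - M.jac x ξ (y - x) - M.F x ξ := by abel
    rw [e2]
    refine h.trans (lintegral_mono fun s => ?_)
    rw [← ofReal_norm, ← ofReal_norm, ← ofReal_norm, ← ENNReal.ofReal_mul (norm_nonneg _)]
    exact ENNReal.ofReal_le_ofReal (norm_apply_le_cols (M.jac (x + s • (y - x)) ξ - M.jac x ξ) _)
  rw [e, ← ENNReal.ofReal_le_ofReal_iff (by positivity), ofReal_norm]
  refine (enorm_integral_le_lintegral_enorm _).trans ((lintegral_mono h1).trans ?_)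
  rw [lintegral_lintegral_swap (hm.enorm.mul_const _).aemeasurable]
  have h2 : ∀ s ∈ Set.Ioc (0 : ℝ) 1,
      ∫⁻ ξ, ‖cols (M.jac (x + s • (y - x)) ξ - M.jac x ξ)‖ₑ * ‖y - x‖ₑ ∂M.law
        ≤ ENNReal.ofReal (s * (LF * ‖y - x‖ ^ 2)) := by
    intro s hs
    rw [lintegral_mul_const' _ _ enorm_ne_top]
    have h3 : ∫⁻ ξ, ‖cols (M.jac (x + s • (y - x)) ξ - M.jac x ξ)‖ₑ ∂M.law
        ≤ ENNReal.ofReal (LF * s * ‖y - x‖) := by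
      have hs0 := hs.1
      refine lintegral_enorm_le_of_sq (hm.comp measurable_prodMk_right).aestronglyMeasurable
        (by positivity) ?_
      have h := hF.smooth _ (segment_mem hD hx hy hs) _ hx
      simp only [ofReal_frobSq, add_sub_cancel_left, norm_smul, Real.norm_of_nonneg hs0.le] at h
      refine h.trans_eq ?_
      congr 1; ring
    calc _ ≤ ENNReal.ofReal (LF * s * ‖y - x‖) * ‖y - x‖ₑ := by gcongr
      _ = _ := by
        have hs0 := hs.1
        rw [← ofReal_norm, ← ENNReal.ofReal_mul (by positivity)]
        congr 1; ring
  refine (setLIntegral_mono' measurableSet_Ioc h2).trans ?_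
  have hint : IntegrableOn (fun s : ℝ => s * (LF * ‖y - x‖ ^ 2)) (Set.Ioc 0 1) := by
    have : IntervalIntegrable (fun s : ℝ => s * (LF * ‖y - x‖ ^ 2)) volume 0 1 :=
      (by fun_prop : Continuous fun s : ℝ => s * (LF * ‖y - x‖ ^ 2)).intervalIntegrable _ _
    rwa [intervalIntegrable_iff_integrableOn_Ioc_of_le zero_le_one] at this
  rw [← ofReal_integral_eq_lintegral_ofReal hint ?_]
  · rw [← intervalIntegral.integral_of_le zero_le_one, intervalIntegral.integral_mul_const,
      integral_id]
    refine le_of_eq ?_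
    congr 1; ring
  · refine (ae_restrict_iff' measurableSet_Ioc).mpr (Filter.Eventually.of_forall fun s hs => ?_)
    have := hs.1
    positivity

lemma SmoothStochastic.norm_meanF_sub_le (hF : M.SmoothStochastic LF MF σF σJ) (hMF : 0 < MF)
    (hD : Convex ℝ (dom M.Ψ₀)) {x y : Vec p} (hx : x ∈ dom M.Ψ₀) (hy : y ∈ dom M.Ψ₀) :
    ‖M.meanF y - M.meanF x‖ ≤ MF * ‖y - x‖ := by
  have e : M.meanF y - M.meanF x = ∫ ξ, (M.F y ξ - M.F x ξ) ∂M.law := by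
    rw [integral_sub (hF.integrable_F hy) (hF.integrable_F hx)]; rfl
  rw [e, ← ENNReal.ofReal_le_ofReal_iff (by positivity), ofReal_norm]
  refine (enorm_integral_le_lintegral_enorm _).trans ?_
  refine lintegral_enorm_le_of_sq ((hF.measurable y).sub (hF.measurable x)).aestronglyMeasurable
    (by positivity) ?_
  rw [mul_pow]
  exact hF.lintegral_F_sub_le hD hx hy

/-- The linearization error is quadratic. The derivative is taken within the domain, as outside it
nothing ensures that the expectations exist. -/
lemma SmoothStochastic.hasFDerivWithinAt_meanF (hF : M.SmoothStochastic LF MF σF σJ) (hLF : 0 < LF)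
    (hD : Convex ℝ (dom M.Ψ₀)) {x : Vec p} (hx : x ∈ dom M.Ψ₀) :
    HasFDerivWithinAt M.meanF (M.meanJac x) (dom M.Ψ₀) x := by
  rw [hasFDerivWithinAt_iff_isLittleO]
  have hb : (fun y => M.meanF y - M.meanF x - M.meanJac x (y - x))
      =O[nhdsWithin x (dom M.Ψ₀)] fun y => ‖y - x‖ ^ 2 := by
    refine Asymptotics.IsBigO.of_bound (LF / 2) ?_
    filter_upwards [self_mem_nhdsWithin] with y hy
    rw [Real.norm_of_nonneg (by positivity)]
    exact hF.norm_meanF_sub_sub_le hLF hD hx hy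
  refine hb.trans_isLittleO ?_
  have h3 : (fun y : Vec p => ‖y - x‖ ^ 2) =o[nhdsWithin x (dom M.Ψ₀)] fun y => ‖y - x‖ ^ 1 := by
    refine (Asymptotics.isLittleO_pow_pow (𝕜 := ℝ) (m := 1) (n := 2) (by norm_num)).comp_tendsto
      (k := fun y : Vec p => ‖y - x‖) ?_
    have : Continuous fun y : Vec p => ‖y - x‖ := by fun_prop
    simpa using (this.tendsto x).mono_left nhdsWithin_le_nhds
  simp only [pow_one] at h3
  exact h3.of_norm_right

lemma SmoothStochastic.hasGradientWithinAt_Φ₀ (hF : M.SmoothStochastic LF MF σF σJ) (hLF : 0 < LF)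
    (hψ : ProperClosedConvex M.ψ) (hψ1 : ExtStronglyConvex 1 M.ψ)
    (hD : Convex ℝ (dom M.Ψ₀)) {x : Vec p} (hx : x ∈ dom M.Ψ₀) :
    HasGradientWithinAt (fun z => (M.Φ₀ z).toReal) (M.gradΦ₀ x) (dom M.Ψ₀) x := by
  rw [hasGradientWithinAt_iff_hasFDerivWithinAt]
  have h := (hasGradientAt_φ₀ hψ hψ1 (M.meanF x)).hasFDerivAt.comp_hasFDerivWithinAt x
    (hF.hasFDerivWithinAt_meanF hLF hD hx)
  refine h.congr_fderiv ?_
  ext v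
  simp [gradΦ₀, ContinuousLinearMap.adjoint_inner_left]

/-- The descent lemma for `Φ₀` along the domain. -/
lemma SmoothStochastic.Φ₀_descent (hF : M.SmoothStochastic LF MF σF σJ) (hLF : 0 < LF)
    (hMF : 0 < MF) {Mψ : ℝ} (hψ : ProperClosedConvex M.ψ) (hψdom : ∀ y ∈ dom M.ψ, ‖y‖ ≤ Mψ)
    (hψ1 : ExtStronglyConvex 1 M.ψ)
    (hD : Convex ℝ (dom M.Ψ₀)) {x y : Vec p} (hx : x ∈ dom M.Ψ₀) (hy : y ∈ dom M.Ψ₀) :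
    (M.Φ₀ y).toReal ≤ (M.Φ₀ x).toReal + ⟪M.gradΦ₀ x, y - x⟫
      + constL ‖M.K‖ LF MF Mψ / 2 * ‖y - x‖ ^ 2 := by
  have h1 := φ₀_toReal_le hψ hψ1 (M.meanF x) (M.meanF y)
  have h2 := hF.norm_meanF_sub_sub_le hLF hD hx hy
  have h3 := hF.norm_meanF_sub_le hMF hD hx hy
  have h4 : ‖M.K (M.yStar (M.meanF x))‖ ≤ ‖M.K‖ * Mψ :=
    (M.K.le_opNorm _).trans (by gcongr; exact hψdom _ (yStar_mem_dom hψ hψ1 _))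
  -- The linear term of `φ₀` costs `‖K‖ Mψ` times the linearization error of `F`, and its quadratic
  -- term costs `½‖K‖²` times the squared Lipschitz bound of `F`. These are the two summands of
  -- `constL`.
  have h5 : ⟪M.K (M.yStar (M.meanF x)), M.meanF y - M.meanF x⟫
      ≤ ⟪M.gradΦ₀ x, y - x⟫ + ‖M.K‖ * Mψ * (LF / 2 * ‖y - x‖ ^ 2) := by
    have e : M.meanF y - M.meanF x
        = M.meanJac x (y - x) + (M.meanF y - M.meanF x - M.meanJac x (y - x)) := by abel
    rw [e, inner_add_right, gradΦ₀, ContinuousLinearMap.adjoint_inner_left]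
    gcongr
    refine (real_inner_le_norm _ _).trans ?_
    exact mul_le_mul h4 h2 (norm_nonneg _) ((norm_nonneg _).trans h4)
  have h6 : ‖M.meanF y - M.meanF x‖ ^ 2 ≤ (MF * ‖y - x‖) ^ 2 := by gcongr
  have h7 := mul_le_mul_of_nonneg_left h6 (sq_nonneg ‖M.K‖)
  simp only [Φ₀, constL] at *
  nlinarith

end Problem

/-! ### Second moments of mini-batch averages -/

section SecondMoments

variable {Ω : Type*} [MeasurableSpace Ω] {μ : Measure Ω}
  {H : Type*} [NormedAddCommGroup H] [InnerProductSpace ℝ H]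

lemma _root_.MeasureTheory.MemLp.integrable_inner_real {f g : Ω → H} (hf : MemLp f 2 μ)
    (hg : MemLp g 2 μ) : Integrable (fun ω => ⟪f ω, g ω⟫) μ := by
  refine (hf.norm.integrable_mul hg.norm).mono (hf.1.inner hg.1)
    (Filter.Eventually.of_forall fun ω => ?_)
  simpa using norm_inner_le_norm (𝕜 := ℝ) (f ω) (g ω)

lemma _root_.MeasureTheory.MemLp.integrable_norm_sq' {f : Ω → H} (hf : MemLp f 2 μ) :
    Integrable (fun ω => ‖f ω‖ ^ 2) μ :=
  (memLp_two_iff_integrable_sq_norm hf.1).mp hf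

variable [IsProbabilityMeasure μ] [CompleteSpace H]

/-- A constant is orthogonal to a centred random vector. -/
lemma integral_norm_const_add_sq {f : Ω → H} (hf : MemLp f 2 μ) (h0 : ∫ ω, f ω ∂μ = 0) (u : H) :
    ∫ ω, ‖u + f ω‖ ^ 2 ∂μ = ‖u‖ ^ 2 + ∫ ω, ‖f ω‖ ^ 2 ∂μ := by
  have h1 : Integrable (fun ω => ⟪u, f ω⟫) μ := (hf.integrable one_le_two).const_inner u
  have h2 : ∫ ω, ⟪u, f ω⟫ ∂μ = 0 := by
    rw [integral_inner (hf.integrable one_le_two), h0, inner_zero_right]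
  simp only [norm_add_sq_real]
  rw [integral_add (by fun_prop) hf.integrable_norm_sq',
    integral_add (integrable_const _) (h1.const_mul 2), integral_const_mul, h2]
  simp

lemma integral_norm_sub_integral_sq_le {f : Ω → H} (hf : MemLp f 2 μ) :
    ∫ ω, ‖f ω - ∫ ω', f ω' ∂μ‖ ^ 2 ∂μ ≤ ∫ ω, ‖f ω‖ ^ 2 ∂μ := by
  set m := ∫ ω', f ω' ∂μ with hm
  have h0 : ∫ ω, (f ω - m) ∂μ = 0 := by
    rw [integral_sub (hf.integrable one_le_two) (integrable_const _)]; simp [hm]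
  have h := integral_norm_const_add_sq (hf.sub (memLp_const m)) h0 m
  simp only [Pi.sub_apply, add_sub_cancel] at h
  rw [h]
  linarith [sq_nonneg ‖m‖]

/-- The origin of `κ`: the parallelogram law costs a factor 2, orthogonality costs nothing. -/
lemma integral_norm_add_sq_le {f g : Ω → H} (hf : MemLp f 2 μ) (hg : MemLp g 2 μ) {κ : ℝ}
    (hκ : κ = 2 ∨ κ = 1 ∧ ∫ ω, ⟪f ω, g ω⟫ ∂μ = 0) :
    ∫ ω, ‖f ω + g ω‖ ^ 2 ∂μ ≤ κ * (∫ ω, ‖f ω‖ ^ 2 ∂μ + ∫ ω, ‖g ω‖ ^ 2 ∂μ) := by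
  have hf2 := hf.integrable_norm_sq'
  have hg2 := hg.integrable_norm_sq'
  have hfg := hf.integrable_inner_real hg
  rcases hκ with rfl | ⟨rfl, h0⟩
  · rw [← integral_add hf2 hg2, ← integral_const_mul]
    refine integral_mono (hf.add hg).integrable_norm_sq' ((hf2.add hg2).const_mul 2) fun ω => ?_
    have h := parallelogram_law_with_norm ℝ (f ω) (g ω)
    nlinarith [sq_nonneg ‖f ω - g ω‖]
  · simp only [norm_add_sq_real]
    rw [integral_add (by fun_prop) hg2, integral_add hf2 (by fun_prop), integral_const_mul, h0]
    linarith

variable [MeasurableSpace H] [BorelSpace H] [SecondCountableTopology H]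

lemma _root_.ProbabilityTheory.IndepFun.integral_inner_eq {f g : Ω → H} (h : IndepFun f g μ)
    (hf : MemLp f 2 μ) (hg : MemLp g 2 μ) :
    ∫ ω, ⟪f ω, g ω⟫ ∂μ = ⟪∫ ω, f ω ∂μ, ∫ ω, g ω ∂μ⟫ := by
  have := h.integral_bilin (hf.integrable one_le_two) (hg.integrable one_le_two) (innerSL ℝ)
  exact this

variable {Ξ : Type*} [MeasurableSpace Ξ] {law : Measure Ξ} {m : ℕ} {B : Fin m → Ω → Ξ}

lemma IsBatch.measurePreserving (hB : IsBatch μ law B) (i : Fin m) :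
    MeasurePreserving (B i) μ law :=
  ⟨hB.measurable i, hB.map_eq i⟩

lemma IsBatch.memLp (hB : IsBatch μ law B) {h : Ξ → H} (hh : MemLp h 2 law) (c : ℝ) :
    MemLp (fun ω => c • ∑ i, h (B i ω)) 2 μ :=
  (memLp_finsetSum (f := fun i ω => h (B i ω)) _
    fun i _ => hh.comp_measurePreserving (hB.measurePreserving i)).const_smul c

lemma IsBatch.integral_eq_zero (hB : IsBatch μ law B) {h : Ξ → H} (hh : MemLp h 2 law)
    (h0 : ∫ ξ, h ξ ∂law = 0) (c : ℝ) : ∫ ω, c • ∑ i, h (B i ω) ∂μ = 0 := by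
  have hi : ∀ i, ∫ ω, h (B i ω) ∂μ = 0 := fun i => by
    rw [← h0, ← hB.map_eq i, integral_map (hB.measurable i).aemeasurable]
    rw [hB.map_eq i]; exact hh.1
  rw [integral_smul, integral_finsetSum]
  · simp [hi]
  · intro i _
    have : IsProbabilityMeasure law := hB.map_eq i ▸ Measure.isProbabilityMeasure_map
      (hB.measurable i).aemeasurable
    exact (hh.comp_measurePreserving (hB.measurePreserving i)).integrable one_le_two

/-- The variance of the average over a mini-batch. -/
lemma IsBatch.integral_norm_sq_eq (hB : IsBatch μ law B) (hm : 0 < m) {h : Ξ → H}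
    (hmeas : Measurable h) (hh : MemLp h 2 law) (h0 : ∫ ξ, h ξ ∂law = 0) (c : ℝ) :
    ∫ ω, ‖(c / (m : ℝ)) • ∑ i, h (B i ω)‖ ^ 2 ∂μ = c ^ 2 * (∫ ξ, ‖h ξ‖ ^ 2 ∂law) / m := by
  have hL : ∀ i, MemLp (fun ω => h (B i ω)) 2 μ :=
    fun i => hh.comp_measurePreserving (hB.measurePreserving i)
  have hi : ∀ i, ∫ ω, h (B i ω) ∂μ = 0 := fun i => by
    rw [← h0, ← hB.map_eq i, integral_map (hB.measurable i).aemeasurable]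
    rw [hB.map_eq i]; exact hh.1
  have hii : ∀ i, ∫ ω, ⟪h (B i ω), h (B i ω)⟫ ∂μ = ∫ ξ, ‖h ξ‖ ^ 2 ∂law := fun i => by
    simp only [real_inner_self_eq_norm_sq]
    rw [← hB.map_eq i, integral_map (hB.measurable i).aemeasurable]
    exact (hmeas.norm.pow_const 2).aestronglyMeasurable
  have hij : ∀ i j, i ≠ j → ∫ ω, ⟪h (B i ω), h (B j ω)⟫ ∂μ = 0 := fun i j hne => by
    have hind : IndepFun (fun ω => h (B i ω)) (fun ω => h (B j ω)) μ :=
      (hB.indep.indepFun hne).comp hmeas hmeas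
    rw [hind.integral_inner_eq (hL i) (hL j), hi, inner_zero_left]
  have hsum : ∫ ω, ‖∑ i, h (B i ω)‖ ^ 2 ∂μ = m * ∫ ξ, ‖h ξ‖ ^ 2 ∂law := by
    simp only [← real_inner_self_eq_norm_sq (∑ i, h (B i _)), sum_inner, inner_sum]
    rw [integral_finsetSum _ fun i _ => integrable_finsetSum _ fun j _ =>
      (hL j).integrable_inner_real (hL i)]
    have : ∀ i : Fin m, ∫ ω, ∑ j, ⟪h (B j ω), h (B i ω)⟫ ∂μ = ∫ ξ, ‖h ξ‖ ^ 2 ∂law := by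
      intro i
      rw [integral_finsetSum _ fun j _ => (hL j).integrable_inner_real (hL i),
        Finset.sum_eq_single i (fun j _ hj => hij j i hj) (by simp), hii]
    simp [this]
  simp only [norm_smul, mul_pow]
  rw [integral_const_mul, hsum, Real.norm_eq_abs, sq_abs, div_pow]
  have : (m : ℝ) ≠ 0 := by positivity
  field_simp

end SecondMoments

/-! ### The mean-square recursion of the hybrid estimator -/

section Freezing

variable {Ω : Type*} {mΩ : MeasurableSpace Ω} {μ : Measure Ω} [IsProbabilityMeasure μ]

/-- A variable independent of `Z` can be frozen while one integrates over `Z`. -/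
lemma lintegral_freeze {𝓧 𝓩 : Type*} [MeasurableSpace 𝓧] [MeasurableSpace 𝓩] {X : Ω → 𝓧}
    {Z : Ω → 𝓩} (h : IndepFun X Z μ) (hX : Measurable X) (hZ : Measurable Z)
    {f : 𝓧 × 𝓩 → ENNReal} (hf : Measurable f) :
    ∫⁻ ω, f (X ω, Z ω) ∂μ = ∫⁻ ω, ∫⁻ ω', f (X ω, Z ω') ∂μ ∂μ := by
  have hmap := (indepFun_iff_map_prod_eq_prod_map_map hX.aemeasurable hZ.aemeasurable).mp h
  rw [← lintegral_map hf (hX.prodMk hZ), hmap, lintegral_prod _ hf.aemeasurable]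
  rw [lintegral_map hf.lintegral_prod_right' hX]
  refine lintegral_congr fun ω => ?_
  exact lintegral_map (hf.comp measurable_prodMk_left) hZ

end Freezing

section Recursion

variable {p : ℕ} {Ω Ξ : Type*} {𝓕 𝓖 : MeasurableSpace Ω} [mΩ : MeasurableSpace Ω] [mΞ : MeasurableSpace Ξ] {μ : Measure Ω}
  [IsProbabilityMeasure μ] {law : Measure Ξ} [IsProbabilityMeasure law]
  {H : Type*} [NormedAddCommGroup H] [InnerProductSpace ℝ H] [CompleteSpace H]
  [MeasurableSpace H] [BorelSpace H] [SecondCountableTopology H]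

/-- A stochastic map that is, on `D`, mean-square Lipschitz with constant `C` and of variance at most
`σ²`. -/
structure MeanSquareLipschitz (law : Measure Ξ) (D : Set (Vec p)) (g : Vec p → Ξ → H) (C σ : ℝ) :
    Prop where
  measurable : Measurable fun z : Vec p × Ξ => g z.1 z.2
  memLp : ∀ x ∈ D, MemLp (g x) 2 law
  lipschitz : ∀ x ∈ D, ∀ y ∈ D, ∫ ξ, ‖g x ξ - g y ξ‖ ^ 2 ∂law ≤ C ^ 2 * ‖x - y‖ ^ 2
  variance : ∀ x ∈ D, ∫ ξ, ‖g x ξ - ∫ ξ', g x ξ' ∂law‖ ^ 2 ∂law ≤ σ ^ 2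

namespace MeanSquareLipschitz

variable {D : Set (Vec p)} {g : Vec p → Ξ → H} {C σ : ℝ}

lemma measurable_right (hg : MeanSquareLipschitz law D g C σ) (x : Vec p) : Measurable (g x) :=
  hg.measurable.comp measurable_prodMk_left

lemma measurable_mean (hg : MeanSquareLipschitz law D g C σ) :
    Measurable fun x => ∫ ξ, g x ξ ∂law :=
  (hg.measurable.stronglyMeasurable.integral_prod_right (ν := law)).measurable

lemma memLp_centred (hg : MeanSquareLipschitz law D g C σ) {x : Vec p} (hx : x ∈ D) :
    MemLp (fun ξ => g x ξ - ∫ ξ', g x ξ' ∂law) 2 law :=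
  (hg.memLp x hx).sub (memLp_const _)

lemma integral_centred (hg : MeanSquareLipschitz law D g C σ) {x : Vec p} (hx : x ∈ D) :
    ∫ ξ, (g x ξ - ∫ ξ', g x ξ' ∂law) ∂law = 0 := by
  rw [integral_sub ((hg.memLp x hx).integrable one_le_two) (integrable_const _)]
  simp

/-- The variance of the initial estimator. -/
lemma integral_initial_le (hg : MeanSquareLipschitz law D g C σ) {m : ℕ} (hm : 0 < m)
    {B : Fin m → Ω → Ξ} (hB : IsBatch μ law B) {x : Vec p} (hx : x ∈ D) :
    Integrable (fun ω => ‖(1 / (m : ℝ)) • ∑ i, g x (B i ω) - ∫ ξ, g x ξ ∂law‖ ^ 2) μ ∧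
      ∫ ω, ‖(1 / (m : ℝ)) • ∑ i, g x (B i ω) - ∫ ξ, g x ξ ∂law‖ ^ 2 ∂μ ≤ σ ^ 2 / m := by
  have hm' : (m : ℝ) ≠ 0 := by positivity
  have e : ∀ ω, (1 / (m : ℝ)) • ∑ i, g x (B i ω) - ∫ ξ, g x ξ ∂law
      = (1 / (m : ℝ)) • ∑ i, (g x (B i ω) - ∫ ξ, g x ξ ∂law) := by
    intro ω
    rw [Finset.sum_sub_distrib, smul_sub]
    congr 1
    rw [Finset.sum_const, Finset.card_univ, Fintype.card_fin, ← Nat.cast_smul_eq_nsmul ℝ,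
      smul_smul, one_div_mul_cancel hm', one_smul]
  simp only [e]
  refine ⟨(hB.memLp (hg.memLp_centred hx) (1 / (m : ℝ))).integrable_norm_sq', ?_⟩
  rw [hB.integral_norm_sq_eq hm ((hg.measurable_right x).sub_const _)
    (hg.memLp_centred hx) (hg.integral_centred hx) 1, one_pow, one_mul]
  gcongr
  exact hg.variance x hx

/-- One step of the estimator from frozen data. -/
lemma integral_step_le (hg : MeanSquareLipschitz law D g C σ) {m₁ m₂ : ℕ} (hm₁ : 0 < m₁)
    (hm₂ : 0 < m₂) {B₁ : Fin m₁ → Ω → Ξ} {B₂ : Fin m₂ → Ω → Ξ} (hB₁ : IsBatch μ law B₁)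
    (hB₂ : IsBatch μ law B₂) {κ : ℝ}
    (hκ : κ = 2 ∨ κ = 1 ∧ Indep (batchSigma B₁) (batchSigma B₂) μ)
    {x x' : Vec p} (hx : x ∈ D) (hx' : x' ∈ D) (β : ℝ) (u : H) :
    ∫⁻ ω, ‖β • u + ((β / (m₁ : ℝ)) •
        ∑ i, (g x' (B₁ i ω) - g x (B₁ i ω) - ∫ ξ, (g x' ξ - g x ξ) ∂law)
        + ((1 - β) / (m₂ : ℝ)) • ∑ i, (g x' (B₂ i ω) - ∫ ξ, g x' ξ ∂law))‖ₑ ^ 2 ∂μ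
      ≤ ENNReal.ofReal (β ^ 2 * ‖u‖ ^ 2
        + κ * (β ^ 2 * C ^ 2 / m₁ * ‖x' - x‖ ^ 2 + (1 - β) ^ 2 * σ ^ 2 / m₂)) := by
  have hd : MemLp (fun ξ => g x' ξ - g x ξ) 2 law := (hg.memLp x' hx').sub (hg.memLp x hx)
  set h₁ : Ξ → H := fun ξ => g x' ξ - g x ξ - ∫ ξ, (g x' ξ - g x ξ) ∂law with hh₁
  set h₂ : Ξ → H := fun ξ => g x' ξ - ∫ ξ, g x' ξ ∂law with hh₂
  have hm1 : Measurable h₁ := ((hg.measurable_right x').sub (hg.measurable_right x)).sub_const _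
  have hm2 : Measurable h₂ := (hg.measurable_right x').sub_const _
  have hL1 : MemLp h₁ 2 law := hd.sub (memLp_const _)
  have hL2 : MemLp h₂ 2 law := hg.memLp_centred hx'
  have h01 : ∫ ξ, h₁ ξ ∂law = 0 := by
    simp only [hh₁]
    rw [integral_sub (hd.integrable one_le_two) (integrable_const _)]; simp
  have h02 : ∫ ξ, h₂ ξ ∂law = 0 := hg.integral_centred hx'
  set f₁ : Ω → H := fun ω => (β / (m₁ : ℝ)) • ∑ i, h₁ (B₁ i ω) with hf₁
  set f₂ : Ω → H := fun ω => ((1 - β) / (m₂ : ℝ)) • ∑ i, h₂ (B₂ i ω) with hf₂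
  have hF1 : MemLp f₁ 2 μ := hB₁.memLp hL1 _
  have hF2 : MemLp f₂ 2 μ := hB₂.memLp hL2 _
  have hi1 : ∫ ω, f₁ ω ∂μ = 0 := hB₁.integral_eq_zero hL1 h01 _
  have hi2 : ∫ ω, f₂ ω ∂μ = 0 := hB₂.integral_eq_zero hL2 h02 _
  have hF12 : MemLp (fun ω => f₁ ω + f₂ ω) 2 μ := hF1.add hF2
  have hi12 : ∫ ω, (f₁ ω + f₂ ω) ∂μ = 0 := by
    rw [integral_add (hF1.integrable one_le_two) (hF2.integrable one_le_two), hi1, hi2, add_zero]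
  have hκ' : κ = 2 ∨ κ = 1 ∧ ∫ ω, ⟪f₁ ω, f₂ ω⟫ ∂μ = 0 := by
    refine hκ.imp_right fun ⟨h1, hI⟩ => ⟨h1, ?_⟩
    have hb : ∀ {m : ℕ} (B : Fin m → Ω → Ξ) (h : Ξ → H) (c : ℝ), Measurable h →
        Measurable[batchSigma B] fun ω => c • ∑ i, h (B i ω) := by
      intro m B h c hh
      refine Measurable.const_smul (Finset.measurable_fun_sum _ fun i _ => ?_) c
      refine hh.comp ?_
      exact (comap_measurable (B i)).mono (le_iSup (fun i => MeasurableSpace.comap (B i) mΞ) i) le_rfl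
    -- Each average is measurable for its own batch, so independence passes to the averages; being
    -- centred, they are orthogonal.
    have hind : IndepFun f₁ f₂ μ :=
      indep_of_indep_of_le hI (hb B₁ h₁ _ hm1).comap_le (hb B₂ h₂ _ hm2).comap_le
    rw [hind.integral_inner_eq hF1 hF2, hi1, inner_zero_left]
  have hsq1 : ∫ ω, ‖f₁ ω‖ ^ 2 ∂μ ≤ β ^ 2 * C ^ 2 / m₁ * ‖x' - x‖ ^ 2 := by
    rw [hf₁, hB₁.integral_norm_sq_eq hm₁ hm1 hL1 h01]
    have h1 : ∫ ξ, ‖h₁ ξ‖ ^ 2 ∂law ≤ C ^ 2 * ‖x' - x‖ ^ 2 :=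
      (integral_norm_sub_integral_sq_le hd).trans (hg.lipschitz x' hx' x hx)
    calc β ^ 2 * (∫ ξ, ‖h₁ ξ‖ ^ 2 ∂law) / m₁ ≤ β ^ 2 * (C ^ 2 * ‖x' - x‖ ^ 2) / m₁ := by gcongr
      _ = _ := by ring
  have hsq2 : ∫ ω, ‖f₂ ω‖ ^ 2 ∂μ ≤ (1 - β) ^ 2 * σ ^ 2 / m₂ := by
    rw [hf₂, hB₂.integral_norm_sq_eq hm₂ hm2 hL2 h02]
    gcongr
    exact hg.variance x' hx'
  have hκ0 : 0 ≤ κ := by rcases hκ with rfl | ⟨rfl, _⟩ <;> norm_num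
  have hmain : ∫ ω, ‖β • u + (f₁ ω + f₂ ω)‖ ^ 2 ∂μ ≤ β ^ 2 * ‖u‖ ^ 2
        + κ * (β ^ 2 * C ^ 2 / m₁ * ‖x' - x‖ ^ 2 + (1 - β) ^ 2 * σ ^ 2 / m₂) := by
    -- The frozen old error is a constant, orthogonal to the centred noise. Hence the factor is `β²`
    -- and no constant larger than 1 multiplies it.
    rw [integral_norm_const_add_sq hF12 hi12, norm_smul, mul_pow, Real.norm_eq_abs, sq_abs]
    have := integral_norm_add_sq_le hF1 hF2 hκ'
    have h3 : κ * (∫ ω, ‖f₁ ω‖ ^ 2 ∂μ + ∫ ω, ‖f₂ ω‖ ^ 2 ∂μ)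
      ≤ κ * (β ^ 2 * C ^ 2 / m₁ * ‖x' - x‖ ^ 2 + (1 - β) ^ 2 * σ ^ 2 / m₂) := by gcongr
    linarith
  refine le_trans (le_of_eq ?_) (ENNReal.ofReal_le_ofReal hmain)
  have hF3 : MemLp (fun ω => β • u + (f₁ ω + f₂ ω)) 2 μ := (memLp_const (β • u)).add hF12
  rw [ofReal_integral_eq_lintegral_ofReal hF3.integrable_norm_sq'
    (Filter.Eventually.of_forall fun ω => by positivity)]
  simp only [ofReal_norm_sq]
  rfl

/-- The mean-square error of the hybrid estimator contracts. -/
lemma integral_recursion_le (hg : MeanSquareLipschitz law D g C σ) {m₁ m₂ : ℕ} (hm₁ : 0 < m₁)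
    (hm₂ : 0 < m₂) {B₁ : Fin m₁ → Ω → Ξ} {B₂ : Fin m₂ → Ω → Ξ} (hB₁ : IsBatch μ law B₁)
    (hB₂ : IsBatch μ law B₂) {κ : ℝ}
    (hκ : κ = 2 ∨ κ = 1 ∧ Indep (batchSigma B₁) (batchSigma B₂) μ)
    (h𝓕 : 𝓕 ≤ mΩ) (hIndep : Indep 𝓖 𝓕 μ)
    (hle₁ : batchSigma B₁ ≤ 𝓖) (hle₂ : batchSigma B₂ ≤ 𝓖)
    {x x' : Ω → Vec p} {G : Ω → H} (hx : Measurable[𝓕] x) (hx' : Measurable[𝓕] x')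
    (hG : Measurable[𝓕] G) (hxD : ∀ ω, x ω ∈ D) (hxD' : ∀ ω, x' ω ∈ D) {β : ℝ}
    {G' : Ω → H}
    (hG' : ∀ ω, G' ω = β • G ω + (β / (m₁ : ℝ)) • ∑ i, (g (x' ω) (B₁ i ω) - g (x ω) (B₁ i ω))
      + ((1 - β) / (m₂ : ℝ)) • ∑ i, g (x' ω) (B₂ i ω))
    (hi : Integrable (fun ω => ‖G ω - ∫ ξ, g (x ω) ξ ∂law‖ ^ 2) μ)
    (hid : Integrable (fun ω => ‖x' ω - x ω‖ ^ 2) μ) :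
    Integrable (fun ω => ‖G' ω - ∫ ξ, g (x' ω) ξ ∂law‖ ^ 2) μ ∧
      ∫ ω, ‖G' ω - ∫ ξ, g (x' ω) ξ ∂law‖ ^ 2 ∂μ
        ≤ β ^ 2 * ∫ ω, ‖G ω - ∫ ξ, g (x ω) ξ ∂law‖ ^ 2 ∂μ
          + κ * (β ^ 2 * C ^ 2 / m₁ * ∫ ω, ‖x' ω - x ω‖ ^ 2 ∂μ
            + (1 - β) ^ 2 * σ ^ 2 / m₂) := by
  have hm₁' : (m₁ : ℝ) ≠ 0 := by positivity
  have hm₂' : (m₂ : ℝ) ≠ 0 := by positivity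
  have hκ0 : 0 ≤ κ := by rcases hκ with rfl | ⟨rfl, _⟩ <;> norm_num
  set gm : Vec p → H := fun x => ∫ ξ, g x ξ ∂law with hgm
  have hmean : Measurable gm := hg.measurable_mean
  have hdiff : ∀ y ∈ D, ∀ y' ∈ D, ∫ ξ, (g y' ξ - g y ξ) ∂law = gm y' - gm y := fun y hy y' hy' =>
    integral_sub ((hg.memLp y' hy').integrable one_le_two) ((hg.memLp y hy).integrable one_le_two)
  -- `X` collects what the past determines, the next iterate included, and `Z` the fresh samples.
  -- The new squared error is a measurable function of these two independent variables.
  set X : Ω → H × Vec p × Vec p := fun ω => (G ω - gm (x ω), x ω, x' ω) with hX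
  set Z : Ω → (Fin m₁ → Ξ) × (Fin m₂ → Ξ) := fun ω => (fun i => B₁ i ω, fun i => B₂ i ω) with hZ
  set f : (H × Vec p × Vec p) × ((Fin m₁ → Ξ) × (Fin m₂ → Ξ)) → ENNReal := fun z =>
    ‖β • z.1.1 + ((β / (m₁ : ℝ)) •
        ∑ i, (g z.1.2.2 (z.2.1 i) - g z.1.2.1 (z.2.1 i) - (gm z.1.2.2 - gm z.1.2.1))
        + ((1 - β) / (m₂ : ℝ)) • ∑ i, (g z.1.2.2 (z.2.2 i) - gm z.1.2.2))‖ₑ ^ 2 with hf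
  have hXm : Measurable[𝓕] X := (hG.sub (hmean.comp hx)).prodMk (hx.prodMk hx')
  have hb : ∀ {m : ℕ} (B : Fin m → Ω → Ξ) (i), Measurable[batchSigma B] (B i) := fun B i =>
    (comap_measurable (B i)).mono (le_iSup (fun i => MeasurableSpace.comap (B i) mΞ) i) le_rfl
  have hZm : Measurable[𝓖] Z :=
    Measurable.prodMk (m := 𝓖)
      (@measurable_pi_lambda Ω _ _ 𝓖 _ _ fun i => (hb B₁ i).mono hle₁ le_rfl)
      (@measurable_pi_lambda Ω _ _ 𝓖 _ _ fun i => (hb B₂ i).mono hle₂ le_rfl)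
  have hZm' : Measurable[mΩ] Z :=
    (measurable_pi_iff.mpr hB₁.measurable).prodMk (measurable_pi_iff.mpr hB₂.measurable)
  have hind : IndepFun X Z μ := indep_of_indep_of_le hIndep.symm hXm.comap_le hZm.comap_le
  have hcomp : ∀ {γ : Type _} [MeasurableSpace γ] {a : γ → Vec p} {c : γ → Ξ}, Measurable a →
      Measurable c → Measurable fun z => g (a z) (c z) := fun ha hc =>
    hg.measurable.comp (ha.prodMk hc)
  have hfm : Measurable f := by
    refine (Measurable.enorm ?_).pow_const 2
    refine (measurable_fst.fst.const_smul β).add (Measurable.add ?_ ?_)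
    · refine Measurable.const_smul (Finset.measurable_fun_sum _ fun i _ => ?_) (β / (m₁ : ℝ))
      have hc : Measurable fun z : (H × Vec p × Vec p) × ((Fin m₁ → Ξ) × (Fin m₂ → Ξ)) =>
          z.2.1 i := (measurable_pi_apply i).comp measurable_snd.fst
      have h1 : Measurable fun z : (H × Vec p × Vec p) × ((Fin m₁ → Ξ) × (Fin m₂ → Ξ)) =>
          z.1.2.2 := measurable_fst.snd.snd
      have h2 : Measurable fun z : (H × Vec p × Vec p) × ((Fin m₁ → Ξ) × (Fin m₂ → Ξ)) =>
          z.1.2.1 := measurable_fst.snd.fst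
      exact ((hcomp h1 hc).sub (hcomp h2 hc)).sub ((hmean.comp h1).sub (hmean.comp h2))
    · refine Measurable.const_smul (Finset.measurable_fun_sum _ fun i _ => ?_) ((1 - β) / (m₂ : ℝ))
      have hc : Measurable fun z : (H × Vec p × Vec p) × ((Fin m₁ → Ξ) × (Fin m₂ → Ξ)) =>
          z.2.2 i := (measurable_pi_apply i).comp measurable_snd.snd
      have h1 : Measurable fun z : (H × Vec p × Vec p) × ((Fin m₁ → Ξ) × (Fin m₂ → Ξ)) =>
          z.1.2.2 := measurable_fst.snd.snd
      exact (hcomp h1 hc).sub (hmean.comp h1)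
  have havg : ∀ {m : ℕ} (c : ℝ) (v : H), (m : ℝ) ≠ 0 → (c / (m : ℝ)) • ∑ _i : Fin m, v = c • v := by
    intro m c v hm
    rw [Finset.sum_const, Finset.card_univ, Fintype.card_fin, ← Nat.cast_smul_eq_nsmul ℝ,
      smul_smul, div_mul_cancel₀ _ hm]
  -- The mean at `x'` is split as `β gm(x) + β (gm(x') - gm(x)) + (1-β) gm(x')`, so that each part
  -- of the update is compared with its own mean.
  have hfeq : ∀ ω, ‖G' ω - gm (x' ω)‖ₑ ^ 2 = f (X ω, Z ω) := by
    intro ω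
    simp only [hf, hX, hZ]
    congr 2
    rw [hG', Finset.sum_sub_distrib (s := Finset.univ) (f := fun i =>
        g (x' ω) (B₁ i ω) - g (x ω) (B₁ i ω)) (g := fun _ => gm (x' ω) - gm (x ω)),
      Finset.sum_sub_distrib (s := Finset.univ) (f := fun i =>
        g (x' ω) (B₂ i ω)) (g := fun _ => gm (x' ω)), smul_sub _ _ (∑ _i, (gm (x' ω) - gm (x ω))),
        smul_sub _ _ (∑ _i, gm (x' ω)), havg _ _ hm₁', havg _ _ hm₂']
    module
  set bound : Ω → ℝ := fun ω => β ^ 2 * ‖G ω - gm (x ω)‖ ^ 2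
        + κ * (β ^ 2 * C ^ 2 / m₁ * ‖x' ω - x ω‖ ^ 2 + (1 - β) ^ 2 * σ ^ 2 / m₂) with hbound
  have hbint : Integrable bound μ :=
    (hi.const_mul _).add (((hid.const_mul _).add (integrable_const _)).const_mul _)
  have hb0 : ∀ ω, 0 ≤ bound ω := fun ω => by positivity
  have hL : ∫⁻ ω, ‖G' ω - gm (x' ω)‖ₑ ^ 2 ∂μ ≤ ENNReal.ofReal (∫ ω, bound ω ∂μ) := by
    simp only [hfeq]
    rw [lintegral_freeze hind (hXm.mono h𝓕 le_rfl) hZm' hfm,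
      ofReal_integral_eq_lintegral_ofReal hbint (Filter.Eventually.of_forall hb0)]
    refine lintegral_mono fun ω => ?_
    have h := hg.integral_step_le hm₁ hm₂ hB₁ hB₂ hκ (hxD ω) (hxD' ω) β (G ω - gm (x ω))
    rw [hdiff _ (hxD ω) _ (hxD' ω)] at h
    exact h
  -- `G'` carries no measurability hypothesis; that of its error is read off from `f`, `X` and `Z`.
  have hmeas' : AEStronglyMeasurable[mΩ] (fun ω => ‖G' ω - gm (x' ω)‖ ^ 2) μ := by
    have : (fun ω => ‖G' ω - gm (x' ω)‖ ^ 2) = fun ω => (f (X ω, Z ω)).toReal := by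
      funext ω
      rw [← hfeq, ENNReal.toReal_pow, toReal_enorm]
    rw [this]
    exact (hfm.comp ((hXm.mono h𝓕 le_rfl).prodMk hZm')).ennreal_toReal.aestronglyMeasurable
  refine ⟨⟨hmeas', ?_⟩, ?_⟩
  · rw [hasFiniteIntegral_iff_enorm]
    simp only [enorm_pow, enorm_norm]
    exact hL.trans_lt ENNReal.ofReal_lt_top
  · have h1 : ∫ ω, ‖G' ω - gm (x' ω)‖ ^ 2 ∂μ ≤ ∫ ω, bound ω ∂μ := by
      rw [integral_eq_lintegral_of_nonneg_ae (Filter.Eventually.of_forall fun ω => by positivity)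
        hmeas']
      refine ENNReal.toReal_le_of_le_ofReal (integral_nonneg hb0) ?_
      simpa only [ofReal_norm_sq] using hL
    refine h1.trans_eq ?_
    simp only [hbound]
    have hi3 : Integrable (fun ω => κ * (β ^ 2 * C ^ 2 / m₁ * ‖x' ω - x ω‖ ^ 2
        + (1 - β) ^ 2 * σ ^ 2 / m₂)) μ :=
      ((hid.const_mul _).add (integrable_const _)).const_mul _
    rw [integral_add (hi.const_mul _) hi3, integral_const_mul, integral_const_mul, integral_add (hid.const_mul _) (integrable_const _),
      integral_const_mul]
    simp

end MeanSquareLipschitz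

end Recursion

lemma measurable_adjoint_apply {α : Type*} [MeasurableSpace α] {p q : ℕ}
    {A : α → Vec p →L[ℝ] Vec q} {w : α → Vec q} (hA : Measurable A) (hw : Measurable w) :
    Measurable fun a => ContinuousLinearMap.adjoint (A a) (w a) := by
  have e : (fun a => ContinuousLinearMap.adjoint (A a) (w a)) = fun a => ∑ j : Fin p,
      ⟪A a (EuclideanSpace.single j 1), w a⟫ • (EuclideanSpace.single j 1 : Vec p) := by
    funext a
    conv_lhs =>
      rw [← (EuclideanSpace.basisFun (Fin p) ℝ).sum_repr' (ContinuousLinearMap.adjoint (A a) (w a))]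
    simp only [ContinuousLinearMap.adjoint_inner_right, EuclideanSpace.basisFun_apply]
  rw [e]
  refine Finset.measurable_fun_sum _ fun j _ => ?_
  have h1 : Measurable fun a => A a (EuclideanSpace.single j 1) :=
    (ContinuousLinearMap.measurable_apply _).comp hA
  exact (h1.inner hw).smul_const _

/-! ### Descent of an inexact proximal-gradient step -/

namespace Problem

variable {p n q : ℕ} {Ξ : Type*} [mΞ : MeasurableSpace Ξ] {M : Problem p n q Ξ}
  [IsProbabilityMeasure M.law] {LF MF σF σJ Mψ : ℝ}

lemma SmoothStochastic.meanSquareLipschitz_F (hF : M.SmoothStochastic LF MF σF σJ)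
    (hD : Convex ℝ (dom M.Ψ₀)) : MeanSquareLipschitz M.law (dom M.Ψ₀) M.F MF σF where
  measurable := hF.measurable_F
  memLp _ hx := hF.memLp_F hx
  lipschitz x hx y hy :=
    integral_norm_sq_le_of_lintegral (by positivity)
      ((hF.measurable x).sub (hF.measurable y)).aestronglyMeasurable
      (hF.lintegral_F_sub_le hD hy hx)
  variance x hx :=
    integral_norm_sq_le_of_lintegral (by positivity)
      ((hF.measurable x).sub_const _).aestronglyMeasurable
      (by
        have h := hF.variance_F x hx
        simp only [ofReal_norm_sq] at h
        exact h)

lemma SmoothStochastic.meanSquareLipschitz_jac (hF : M.SmoothStochastic LF MF σF σJ) :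
    MeanSquareLipschitz M.law (dom M.Ψ₀) (fun x ξ => cols (M.jac x ξ)) LF σJ where
  measurable := cols.continuous.measurable.comp hF.measurable_jac
  memLp _ hx := hF.memLp_cols_jac hx
  lipschitz x hx y hy :=
    integral_norm_sq_le_of_lintegral (by positivity)
      ((hF.measurable_cols_jac_right x).sub (hF.measurable_cols_jac_right y)).aestronglyMeasurable
      (by simpa only [ofReal_frobSq, map_sub] using hF.smooth x hx y hy)
  variance x hx :=
    integral_norm_sq_le_of_lintegral (by positivity)
      ((hF.measurable_cols_jac_right x).sub_const _).aestronglyMeasurable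
      (by
        rw [← hF.cols_meanJac hx]
        simpa only [ofReal_frobSq, map_sub] using hF.variance_jac x hx)

lemma SmoothStochastic.measurable_gradΦ₀ (hF : M.SmoothStochastic LF MF σF σJ)
    (hψ : ProperClosedConvex M.ψ) (hψ1 : ExtStronglyConvex 1 M.ψ) : Measurable M.gradΦ₀ := by
  have hc : Continuous fun u : Vec q => M.K (M.yStar u) :=
    M.K.continuous.comp (continuous_yStar hψ hψ1)
  exact measurable_adjoint_apply hF.measurable_meanJac (hc.measurable.comp hF.measurable_meanF)

lemma SmoothStochastic.measurable_gradMap (hF : M.SmoothStochastic LF MF σF σJ)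
    (hR : ProperClosedConvex M.R) (hψ : ProperClosedConvex M.ψ) (hψ1 : ExtStronglyConvex 1 M.ψ)
    {η : ℝ} (hη : 0 < η) : Measurable (M.gradMap η) :=
  (measurable_id.sub ((continuous_proxR hR hη).measurable.comp
    (measurable_id.sub ((hF.measurable_gradΦ₀ hψ hψ1).const_smul η)))).const_smul (1 / η)

/-- The choice of `η` gives `ηL = 2/(3+θ)`, which lies in `[1/2, 2/3]` for `0 < θ ≤ 1`. The lower
end yields the constant `1/16`, and both ends together yield `2/9`. -/
lemma gradMap_sq_bound {L θ η g r δ : ℝ} (hL : 0 < L) (hθ : 0 < θ) (hθ1 : θ ≤ 1)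
    (hη : η = 2 / (L * (3 + θ))) (hg : 0 ≤ g) (h : η * g ≤ r + η * δ) :
    1 / (16 * L) * g ^ 2 ≤ L / 2 * r ^ 2 + 2 / (9 * L) * δ ^ 2 := by
  have hη0 : 0 < η := by rw [hη]; positivity
  have h6 : (η * g) ^ 2 ≤ 2 * (r ^ 2 + (η * δ) ^ 2) :=
    (pow_le_pow_left₀ (by positivity) h 2).trans add_sq_le
  have hηL : η * L = 2 / (3 + θ) := by rw [hη]; field_simp
  have hηL1 : 1 / 2 ≤ η * L := by
    rw [hηL, div_le_div_iff₀ (by norm_num) (by positivity)]; linarith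
  have hηL2 : η * L ≤ 2 / 3 := by
    rw [hηL, div_le_div_iff₀ (by positivity) (by norm_num)]; linarith
  have hηL3 : (1 / 2) ^ 2 ≤ (η * L) ^ 2 := pow_le_pow_left₀ (by norm_num) hηL1 2
  have hηL4 : (η * L) ^ 2 ≤ (2 / 3) ^ 2 := pow_le_pow_left₀ (by positivity) hηL2 2
  have a1 := mul_le_mul_of_nonneg_right hηL3 (sq_nonneg g)
  have a2 := mul_le_mul_of_nonneg_right hηL4 (sq_nonneg δ)
  have a3 := mul_le_mul_of_nonneg_left h6 (sq_nonneg L)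
  have a4 : g ^ 2 ≤ 8 * (L ^ 2 * r ^ 2) + 32 / 9 * δ ^ 2 := by
    have b1 : L ^ 2 * (η * g) ^ 2 = (η * L) ^ 2 * g ^ 2 := by ring
    have b2 : L ^ 2 * (2 * (r ^ 2 + (η * δ) ^ 2))
      = 2 * (L ^ 2 * r ^ 2) + 2 * ((η * L) ^ 2 * δ ^ 2) := by ring
    rw [b1, b2] at a3
    linarith
  have a5 := mul_le_mul_of_nonneg_left a4 (by positivity : 0 ≤ 1 / (16 * L))
  refine a5.trans_eq ?_
  field_simp
  ring

/-- One proximal-gradient step along an inexact gradient `v`. -/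
lemma SmoothStochastic.prox_step_descent (hF : M.SmoothStochastic LF MF σF σJ) (hLF : 0 < LF)
    (hMF : 0 < MF) (hR : ProperClosedConvex M.R) (hψ : ProperClosedConvex M.ψ)
    (hψdom : ∀ y ∈ dom M.ψ, ‖y‖ ≤ Mψ) (hψ1 : ExtStronglyConvex 1 M.ψ) {L θ η : ℝ}
    (hL : L = constL ‖M.K‖ LF MF Mψ) (hL0 : 0 < L) (hθ : 0 < θ) (hθ1 : θ ≤ 1)
    (hη : η = 2 / (L * (3 + θ))) {x : Vec p} (hx : x ∈ dom M.R) (v : Vec p) :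
    (M.Φ₀ ((1 - θ) • x + θ • M.proxR η (x - η • v))).toReal
        + (M.R ((1 - θ) • x + θ • M.proxR η (x - η • v))).toReal
        + θ / (16 * L) * ‖M.gradMap η x‖ ^ 2
        + θ * L / 2 * ‖M.proxR η (x - η • v) - x‖ ^ 2
      ≤ (M.Φ₀ x).toReal + (M.R x).toReal + 13 * θ / (18 * L) * ‖M.gradΦ₀ x - v‖ ^ 2 := by
  have hη0 : 0 < η := by rw [hη]; positivity
  have hηinv : 1 / η = L * (3 + θ) / 2 := by rw [hη, one_div_div]
  have hdom := dom_Ψ₀ hψ hψ1 hR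
  have hD : Convex ℝ (dom M.Ψ₀) := hdom ▸ hR.convex_dom
  set z := M.proxR η (x - η • v) with hz
  have hzD : z ∈ dom M.R := proxR_mem_dom hR hη0 _
  have hx' : (1 - θ) • x + θ • z ∈ dom M.R :=
    hR.convex_dom hx hzD (by linarith) hθ.le (by ring)
  have h1 := hF.Φ₀_descent hLF hMF hψ hψdom hψ1 hD (hdom ▸ hx) (hdom ▸ hx')
  have e1 : (1 - θ) • x + θ • z - x = θ • (z - x) := by module
  rw [e1, inner_smul_right, norm_smul, Real.norm_of_nonneg hθ.le, ← hL] at h1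
  have h2 := (And.right hR.convexOn_toReal :) hx hzD (a := 1 - θ) (b := θ) (by linarith) hθ.le (by ring)
  simp only [smul_eq_mul] at h2
  have h3 := proxR_subgradient hR hη0 (x - η • v) hx
  rw [← hz] at h3
  have e2 : x - η • v - z = -(z - x) - η • v := by module
  have e3 : x - z = -(z - x) := by abel
  rw [e2, e3, inner_neg_right, inner_sub_left, inner_neg_left, real_inner_self_eq_norm_sq,
    inner_smul_left, conj_trivial] at h3
  -- As `1/η = L(3+θ)/2`, the part with `θ` cancels the quadratic term `Lθ²/2 ‖z - x‖²` of the
  -- descent lemma and leaves a decrease of `(3/2)θL ‖z - x‖²`.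
  have h3' : 1 / η * -(-‖z - x‖ ^ 2 - η * ⟪v, z - x⟫)
      = L * (3 + θ) / 2 * ‖z - x‖ ^ 2 + ⟪v, z - x⟫ := by
    have : 1 / η * -(-‖z - x‖ ^ 2 - η * ⟪v, z - x⟫)
      = 1 / η * ‖z - x‖ ^ 2 + (1 / η * η) * ⟪v, z - x⟫ := by ring
    rw [this, one_div_mul_cancel hη0.ne', hηinv, one_mul]
  rw [h3'] at h3
  have h4 : ⟪M.gradΦ₀ x - v, z - x⟫
      ≤ 1 / (2 * L) * ‖M.gradΦ₀ x - v‖ ^ 2 + L / 2 * ‖z - x‖ ^ 2 := by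
    refine (real_inner_le_norm _ _).trans ?_
    have h := sq_nonneg (‖M.gradΦ₀ x - v‖ - L * ‖z - x‖)
    have e : 1 / (2 * L) * ‖M.gradΦ₀ x - v‖ ^ 2 + L / 2 * ‖z - x‖ ^ 2
        - ‖M.gradΦ₀ x - v‖ * ‖z - x‖ = 1 / (2 * L) * (‖M.gradΦ₀ x - v‖ - L * ‖z - x‖) ^ 2 := by
      field_simp; ring
    have : 0 ≤ 1 / (2 * L) * (‖M.gradΦ₀ x - v‖ - L * ‖z - x‖) ^ 2 := by positivity
    linarith
  rw [inner_sub_left] at h4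
  -- the gradient mapping against the inexact step
  have h5 : (η * ‖M.gradMap η x‖) ≤ ‖z - x‖ + η * ‖M.gradΦ₀ x - v‖ := by
    have e : η * ‖M.gradMap η x‖ = ‖x - M.proxR η (x - η • M.gradΦ₀ x)‖ := by
      rw [gradMap, norm_smul, Real.norm_of_nonneg (by positivity), ← mul_assoc,
        mul_one_div_cancel hη0.ne', one_mul]
    rw [e]
    have e' : x - M.proxR η (x - η • M.gradΦ₀ x)
        = -(z - x) + (z - M.proxR η (x - η • M.gradΦ₀ x)) := by abel
    rw [e']
    refine (norm_add_le _ _).trans ?_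
    rw [norm_neg]
    gcongr
    refine (norm_proxR_sub_le hR hη0 _ _).trans_eq ?_
    have e'' : x - η • v - (x - η • M.gradΦ₀ x) = η • (M.gradΦ₀ x - v) := by module
    rw [e'', norm_smul, Real.norm_of_nonneg hη0.le]
  set g := ‖M.gradMap η x‖
  set r := ‖z - x‖
  set δ := ‖M.gradΦ₀ x - v‖
  have hr : 0 ≤ r := norm_nonneg _
  have hδ : 0 ≤ δ := norm_nonneg _
  have hg : 0 ≤ g := norm_nonneg _
  -- Of the decrease `(3/2)θL r²`, one third pays for Young's inequality, one third for the gradient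
  -- mapping, and one third is kept. The errors add up to `1/2 + 2/9 = 13/18`.
  have h7 : 1 / (16 * L) * g ^ 2 ≤ L / 2 * r ^ 2 + 2 / (9 * L) * δ ^ 2 :=
    gradMap_sq_bound hL0 hθ hθ1 hη hg h5
  have h8 := mul_le_mul_of_nonneg_left h7 hθ.le
  have h9 := mul_le_mul_of_nonneg_left h4 hθ.le
  have h10 := mul_le_mul_of_nonneg_left h3 hθ.le
  have e4 : θ * (1 / (16 * L) * g ^ 2) = θ / (16 * L) * g ^ 2 := by ring
  have e5 : θ * (L / 2 * r ^ 2 + 2 / (9 * L) * δ ^ 2)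
      = θ * L / 2 * r ^ 2 + 4 * (θ / (18 * L)) * δ ^ 2 := by field_simp; ring
  have e6 : θ * (1 / (2 * L) * δ ^ 2 + L / 2 * r ^ 2)
      = 9 * (θ / (18 * L)) * δ ^ 2 + θ * L / 2 * r ^ 2 := by field_simp; ring
  have e7 : 13 * θ / (18 * L) * δ ^ 2 = 13 * (θ / (18 * L)) * δ ^ 2 := by ring
  rw [e4, e5] at h8
  rw [e6] at h9
  rw [e7]
  linarith

/-- The error of the gradient estimator in terms of those of the two hybrid estimators. -/
lemma SmoothStochastic.norm_gradΦ₀_sub_dir_sq_le (hF : M.SmoothStochastic LF MF σF σJ)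
    (hMF : 0 < MF) (hψ : ProperClosedConvex M.ψ) (hψdom : ∀ y ∈ dom M.ψ, ‖y‖ ≤ Mψ)
    (hψ1 : ExtStronglyConvex 1 M.ψ) (s : State p q) (hx : s.x ∈ dom M.Ψ₀) :
    ‖M.gradΦ₀ s.x - M.dir s‖ ^ 2
      ≤ 2 * (‖M.K‖ ^ 2 * Mψ ^ 2 * ‖cols s.Jt - cols (M.meanJac s.x)‖ ^ 2
        + MF ^ 2 * ‖M.K‖ ^ 4 * ‖s.Ft - M.meanF s.x‖ ^ 2) := by
  -- The error splits into the Jacobian error applied to a vector of norm at most `‖K‖ Mψ`, and the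
  -- true Jacobian applied to the displacement of the maximizer, which is `‖K‖`-Lipschitz in `F̃`.
  have e : M.gradΦ₀ s.x - M.dir s
      = -ContinuousLinearMap.adjoint (s.Jt - M.meanJac s.x) (M.K (M.yStar s.Ft))
        + -ContinuousLinearMap.adjoint (M.meanJac s.x)
          (M.K (M.yStar s.Ft - M.yStar (M.meanF s.x))) := by
    rw [gradΦ₀, dir, map_sub, map_sub, map_sub, sub_apply]
    abel
  have h1 : ‖ContinuousLinearMap.adjoint (s.Jt - M.meanJac s.x) (M.K (M.yStar s.Ft))‖
      ≤ ‖cols s.Jt - cols (M.meanJac s.x)‖ * (‖M.K‖ * Mψ) := by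
    refine (ContinuousLinearMap.le_opNorm _ _).trans ?_
    rw [LinearIsometryEquiv.norm_map]
    refine mul_le_mul ?_ ?_ (norm_nonneg _) (norm_nonneg _)
    · rw [← map_sub]; exact norm_le_norm_cols _
    · exact (M.K.le_opNorm _).trans (by gcongr; exact hψdom _ (yStar_mem_dom hψ hψ1 _))
  have h2 : ‖ContinuousLinearMap.adjoint (M.meanJac s.x)
      (M.K (M.yStar s.Ft - M.yStar (M.meanF s.x)))‖
      ≤ MF * (‖M.K‖ * (‖M.K‖ * ‖s.Ft - M.meanF s.x‖)) := by
    refine (ContinuousLinearMap.le_opNorm _ _).trans ?_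
    rw [LinearIsometryEquiv.norm_map]
    refine mul_le_mul (hF.norm_meanJac_le hMF hx) ?_ (norm_nonneg _) hMF.le
    exact (M.K.le_opNorm _).trans (by gcongr; exact norm_yStar_sub_le hψ hψ1 _ _)
  have h3 : ‖M.gradΦ₀ s.x - M.dir s‖ ≤ ‖cols s.Jt - cols (M.meanJac s.x)‖ * (‖M.K‖ * Mψ)
      + MF * (‖M.K‖ * (‖M.K‖ * ‖s.Ft - M.meanF s.x‖)) := by
    rw [e]
    refine (norm_add_le _ _).trans ?_
    rw [norm_neg, norm_neg]
    exact add_le_add h1 h2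
  have h4 := pow_le_pow_left₀ (norm_nonneg _) h3 2
  refine h4.trans ((add_sq_le).trans_eq ?_)
  ring

/-- The weighted estimation error of a state. -/
noncomputable def errorSq (M : Problem p n q Ξ) (MF Mψ : ℝ) (s : State p q) : ℝ :=
  13 / 9 * (‖M.K‖ ^ 2 * Mψ ^ 2 * ‖cols s.Jt - cols (M.meanJac s.x)‖ ^ 2
    + MF ^ 2 * ‖M.K‖ ^ 4 * ‖s.Ft - M.meanF s.x‖ ^ 2)

lemma errorSq_nonneg (MF Mψ : ℝ) (s : State p q) : 0 ≤ M.errorSq MF Mψ s := by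
  unfold errorSq; positivity

/-- One iteration of the algorithm decreases the objective up to the estimation error. -/
lemma SmoothStochastic.next_descent (hF : M.SmoothStochastic LF MF σF σJ) (hLF : 0 < LF)
    (hMF : 0 < MF) (hR : ProperClosedConvex M.R) (hψ : ProperClosedConvex M.ψ)
    (hψdom : ∀ y ∈ dom M.ψ, ‖y‖ ≤ Mψ) (hψ1 : ExtStronglyConvex 1 M.ψ) {L θ η : ℝ}
    (hL : L = constL ‖M.K‖ LF MF Mψ) (hL0 : 0 < L) (hθ : 0 < θ) (hθ1 : θ ≤ 1)
    (hη : η = 2 / (L * (3 + θ))) (s : State p q) (hx : s.x ∈ dom M.R) :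
    (M.Ψ₀ (M.next θ η s)).toReal + (θ / (16 * L) * ‖M.gradMap η s.x‖ ^ 2
        + L / (2 * θ) * ‖M.next θ η s - s.x‖ ^ 2)
      ≤ (M.Ψ₀ s.x).toReal + θ / L * M.errorSq MF Mψ s := by
  have hη0 : 0 < η := by rw [hη]; positivity
  have hnext : M.next θ η s ∈ dom M.R :=
    hR.convex_dom hx (proxR_mem_dom hR hη0 _) (by linarith) hθ.le (by ring)
  have h1 := hF.prox_step_descent hLF hMF hR hψ hψdom hψ1 hL hL0 hθ hθ1 hη hx (M.dir s)
  have h2 := hF.norm_gradΦ₀_sub_dir_sq_le hMF hψ hψdom hψ1 s (dom_Ψ₀ hψ hψ1 hR ▸ hx)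
  have h3 := mul_le_mul_of_nonneg_left h2 (by positivity : 0 ≤ 13 * θ / (18 * L))
  rw [Ψ₀_eq hψ hψ1 hR hx, Ψ₀_eq hψ hψ1 hR hnext, EReal.toReal_coe, EReal.toReal_coe]
  have e1 : M.next θ η s - s.x = θ • (M.proxR η (s.x - η • M.dir s) - s.x) := by
    rw [next]; module
  have e2 : L / (2 * θ) * ‖M.next θ η s - s.x‖ ^ 2
      = θ * L / 2 * ‖M.proxR η (s.x - η • M.dir s) - s.x‖ ^ 2 := by
    rw [e1, norm_smul, Real.norm_of_nonneg hθ.le, mul_pow]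
    field_simp
  -- The weight `13/9` is `13/18` times the factor 2 of the bound on the gradient error.
  have e3 : θ / L * M.errorSq MF Mψ s = 13 * θ / (18 * L)
      * (2 * (‖M.K‖ ^ 2 * Mψ ^ 2 * ‖cols s.Jt - cols (M.meanJac s.x)‖ ^ 2
        + MF ^ 2 * ‖M.K‖ ^ 4 * ‖s.Ft - M.meanF s.x‖ ^ 2)) := by
    rw [errorSq]; field_simp
    ring
  rw [e2, e3]
  simp only [next] at *
  linarith

end Problem

/-! ### The filtration of the mini-batches -/

section Sigma

variable {Ω Ξ : Type*} [mΞ : MeasurableSpace Ξ] {sz : Sizes} (S : Samples sz Ω Ξ)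

lemma measurable_batchSigma {m : ℕ} (B : Fin m → Ω → Ξ) (i : Fin m) :
    Measurable[batchSigma B] (B i) :=
  (comap_measurable (B i)).mono (le_iSup (fun i => MeasurableSpace.comap (B i) mΞ) i) le_rfl

lemma Samples.sigma_mono {s t : ℕ} (h : s ≤ t) : S.sigma s ≤ S.sigma t :=
  sup_le_sup_left (biSup_mono fun _ hr => Finset.Icc_subset_Icc_right h hr) _

lemma Samples.newSigma_le_sigma {t : ℕ} (ht : 1 ≤ t) : S.newSigma t ≤ S.sigma t :=
  le_sup_of_le_right (le_biSup (fun s => S.newSigma s) (Finset.mem_Icc.mpr ⟨ht, le_rfl⟩))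

variable {S}

lemma batchSigma_le [mΩ : MeasurableSpace Ω] {m : ℕ} {B : Fin m → Ω → Ξ}
    (hB : ∀ i, Measurable (B i)) : batchSigma B ≤ mΩ :=
  iSup_le fun i => (hB i).comap_le

lemma Samples.Valid.sigma_le [mΩ : MeasurableSpace Ω] {μ : Measure Ω} {law : Measure Ξ} {T : ℕ}
    (hS : S.Valid μ law T) {t : ℕ} (ht : t ≤ T) : S.sigma t ≤ mΩ := by
  refine sup_le (sup_le (batchSigma_le hS.B₀.measurable) (batchSigma_le hS.Bh₀.measurable)) ?_
  refine iSup₂_le fun s hs => ?_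
  have hs' : s ∈ Finset.Icc 1 T := Finset.Icc_subset_Icc_right ht hs
  exact sup_le (sup_le (sup_le (batchSigma_le (hS.B₁ s hs').measurable)
    (batchSigma_le (hS.Bh₁ s hs').measurable)) (batchSigma_le (hS.B₂ s hs').measurable))
    (batchSigma_le (hS.Bh₂ s hs').measurable)

lemma Samples.Valid.indep_past_succ [mΩ : MeasurableSpace Ω] {μ : Measure Ω} {law : Measure Ξ}
    {T : ℕ} (hS : S.Valid μ law T) {t : ℕ} (ht : t < T) :
    Indep (S.newSigma (t + 1)) (S.sigma t) μ := by
  have h := hS.indep_past (t + 1) (Finset.mem_Icc.mpr ⟨by omega, ht⟩)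
  rwa [Nat.add_sub_cancel] at h

lemma Samples.kappa_cases [MeasurableSpace Ω] (S : Samples sz Ω Ξ) (μ : Measure Ω) (T : ℕ) :
    S.kappa μ T = 2 ∨ S.kappa μ T = 1 ∧
      ∀ t ∈ Finset.Icc 1 T, Indep (batchSigma (S.B₁ t)) (batchSigma (S.B₂ t)) μ := by
  unfold kappa
  split_ifs with h
  · exact Or.inr ⟨rfl, h⟩
  · exact Or.inl rfl

lemma Samples.kappaHat_cases [MeasurableSpace Ω] (S : Samples sz Ω Ξ) (μ : Measure Ω) (T : ℕ) :
    S.kappaHat μ T = 2 ∨ S.kappaHat μ T = 1 ∧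
      ∀ t ∈ Finset.Icc 1 T, Indep (batchSigma (S.Bh₁ t)) (batchSigma (S.Bh₂ t)) μ := by
  unfold kappaHat
  split_ifs with h
  · exact Or.inr ⟨rfl, h⟩
  · exact Or.inl rfl

/-- The initial variances carry no `κ`; this bound lets `Q` cover them too. -/
lemma Samples.one_le_kappa [MeasurableSpace Ω] (S : Samples sz Ω Ξ) (μ : Measure Ω) (T : ℕ) :
    1 ≤ S.kappa μ T := by
  rcases S.kappa_cases μ T with h | ⟨h, _⟩ <;> rw [h]; norm_num

lemma Samples.one_le_kappaHat [MeasurableSpace Ω] (S : Samples sz Ω Ξ) (μ : Measure Ω) (T : ℕ) :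
    1 ≤ S.kappaHat μ T := by
  rcases S.kappaHat_cases μ T with h | ⟨h, _⟩ <;> rw [h]; norm_num

end Sigma

lemma measurable_hybrid {p : ℕ} {α Ξ E : Type*} [MeasurableSpace α] [MeasurableSpace Ξ]
    [NormedAddCommGroup E] [NormedSpace ℝ E] [MeasurableSpace E] [BorelSpace E]
    [SecondCountableTopology E] {g : Vec p → Ξ → E} (hg : Measurable fun z : Vec p × Ξ => g z.1 z.2)
    {x x' : α → Vec p} (hx : Measurable x) (hx' : Measurable x') {G : α → E} (hG : Measurable G)
    {m₁ m₂ : ℕ} {B₁ : Fin m₁ → α → Ξ} {B₂ : Fin m₂ → α → Ξ} (hB₁ : ∀ i, Measurable (B₁ i))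
    (hB₂ : ∀ i, Measurable (B₂ i)) (a b c : ℝ) :
    Measurable fun ω => a • G ω + b • ∑ i, (g (x' ω) (B₁ i ω) - g (x ω) (B₁ i ω))
      + c • ∑ i, g (x' ω) (B₂ i ω) := by
  have hcomp : ∀ {y : α → Vec p} {ξ : α → Ξ}, Measurable y → Measurable ξ →
      Measurable fun ω => g (y ω) (ξ ω) := fun hy hξ => hg.comp (hy.prodMk hξ)
  exact ((hG.const_smul a).add ((Finset.measurable_fun_sum _ fun i _ =>
    (hcomp hx' (hB₁ i)).sub (hcomp hx (hB₁ i))).const_smul b)).add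
    ((Finset.measurable_fun_sum _ fun i _ => hcomp hx' (hB₂ i)).const_smul c)

/-- Constant parameters, with the same weight for both estimators. -/
def constParams (β θ η : ℝ) : Params :=
  { β := fun _ => β, βh := fun _ => β, θ := fun _ => θ, η := fun _ => η }

/-! ### The trajectory: measurability and error recursions -/

namespace Problem

/-- The standing assumptions on the problem and on the step-sizes. -/
structure Standing {p n q : ℕ} {Ξ : Type*} [MeasurableSpace Ξ] (M : Problem p n q Ξ)
    (LF MF σF σJ Mψ L θ η : ℝ) : Prop where
  LF_pos : 0 < LF
  MF_pos : 0 < MF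
  smooth : M.SmoothStochastic LF MF σF σJ
  pcc_R : ProperClosedConvex M.R
  pcc_ψ : ProperClosedConvex M.ψ
  bounded_dom : ∀ y ∈ dom M.ψ, ‖y‖ ≤ Mψ
  strong : ExtStronglyConvex 1 M.ψ
  L_eq : L = constL ‖M.K‖ LF MF Mψ
  L_pos : 0 < L
  θ_pos : 0 < θ
  θ_le_one : θ ≤ 1
  η_eq : η = 2 / (L * (3 + θ))

variable {p n q : ℕ} {Ω Ξ : Type*} [mΞ : MeasurableSpace Ξ] {M : Problem p n q Ξ}
  [IsProbabilityMeasure M.law] {LF MF σF σJ Mψ L θ η : ℝ} {sz : Sizes}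
  {S : Samples sz Ω Ξ} {x₀ : Vec p} {β : ℝ}

namespace Standing

lemma η_pos (h : M.Standing LF MF σF σJ Mψ L θ η) : 0 < η := by
  have := h.L_pos
  have := h.θ_pos
  rw [h.η_eq]; positivity

lemma dom_eq (h : M.Standing LF MF σF σJ Mψ L θ η) : dom M.Ψ₀ = dom M.R :=
  dom_Ψ₀ h.pcc_ψ h.strong h.pcc_R

lemma convex_dom (h : M.Standing LF MF σF σJ Mψ L θ η) : Convex ℝ (dom M.Ψ₀) :=
  h.dom_eq ▸ h.pcc_R.convex_dom

lemma measurable_next (h : M.Standing LF MF σF σJ Mψ L θ η) {α : Type*} [MeasurableSpace α]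
    {s : α → State p q} (hx : Measurable fun a => (s a).x) (hF : Measurable fun a => (s a).Ft)
    (hJ : Measurable fun a => (s a).Jt) : Measurable fun a => M.next θ η (s a) := by
  have hc : Continuous fun u : Vec q => M.K (M.yStar u) :=
    M.K.continuous.comp (continuous_yStar h.pcc_ψ h.strong)
  have hdir : Measurable fun a => M.dir (s a) :=
    measurable_adjoint_apply hJ (hc.measurable.comp hF)
  exact (hx.const_smul (1 - θ)).add (((continuous_proxR h.pcc_R h.η_pos).measurable.comp
    (hx.sub (hdir.const_smul η))).const_smul θ)

lemma run_x_mem (h : M.Standing LF MF σF σJ Mψ L θ η) (hx₀ : x₀ ∈ dom M.R) (ω : Ω) (t : ℕ) :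
    (M.run (constParams β θ η) S x₀ ω t).x ∈ dom M.R := by
  induction t with
  | zero => exact hx₀
  | succ t ih =>
    exact h.pcc_R.convex_dom ih (proxR_mem_dom h.pcc_R h.η_pos _)
      (sub_nonneg.mpr h.θ_le_one)
      h.θ_pos.le (by ring)

lemma run_x_mem_Ψ₀ (h : M.Standing LF MF σF σJ Mψ L θ η) (hx₀ : x₀ ∈ dom M.R) (ω : Ω) (t : ℕ) :
    (M.run (constParams β θ η) S x₀ ω t).x ∈ dom M.Ψ₀ :=
  h.dom_eq ▸ h.run_x_mem hx₀ ω t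

lemma measurable_run (h : M.Standing LF MF σF σJ Mψ L θ η) (t : ℕ) :
    Measurable[S.sigma t] (fun ω => (M.run (constParams β θ η) S x₀ ω t).x) ∧
    Measurable[S.sigma t] (fun ω => (M.run (constParams β θ η) S x₀ ω t).Ft) ∧
    Measurable[S.sigma t] (fun ω => (M.run (constParams β θ η) S x₀ ω t).Jt) := by
  induction t with
  | zero =>
    -- The filtration is made the ambient σ-field, so that the general measurability lemmas apply
    -- relative to it.
    let _ : MeasurableSpace Ω := S.sigma 0
    have h1 : ∀ i, Measurable (S.B₀ i) := fun i =>
      (measurable_batchSigma S.B₀ i).mono (le_sup_of_le_left le_sup_left) le_rfl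
    have h2 : ∀ i, Measurable (S.Bh₀ i) := fun i =>
      (measurable_batchSigma S.Bh₀ i).mono (le_sup_of_le_left le_sup_right) le_rfl
    refine ⟨measurable_const, ?_, ?_⟩
    · exact (Finset.measurable_fun_sum _ fun i _ =>
        (h.smooth.measurable x₀).comp (h1 i)).const_smul (1 / (sz.b₀ : ℝ))
    · exact (Finset.measurable_fun_sum _ fun i _ =>
        (h.smooth.measurable_jac_right x₀).comp (h2 i)).const_smul (1 / (sz.bh₀ : ℝ))
  | succ t ih =>
    obtain ⟨hx, hF, hJ⟩ := ih
    let _ : MeasurableSpace Ω := S.sigma (t + 1)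
    have hle : S.sigma t ≤ S.sigma (t + 1) := S.sigma_mono t.le_succ
    have hnew : S.newSigma (t + 1) ≤ S.sigma (t + 1) := S.newSigma_le_sigma (by omega)
    have hx := hx.mono hle le_rfl
    have hF := hF.mono hle le_rfl
    have hJ := hJ.mono hle le_rfl
    have hx' := h.measurable_next hx hF hJ
    have h1 : ∀ i, Measurable (S.B₁ (t + 1) i) := fun i => (measurable_batchSigma _ i).mono
      (le_trans (le_sup_of_le_left (le_sup_of_le_left le_sup_left)) hnew) le_rfl
    have hh1 : ∀ i, Measurable (S.Bh₁ (t + 1) i) := fun i => (measurable_batchSigma _ i).mono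
      (le_trans (le_sup_of_le_left (le_sup_of_le_left le_sup_right)) hnew) le_rfl
    have h2 : ∀ i, Measurable (S.B₂ (t + 1) i) := fun i => (measurable_batchSigma _ i).mono
      (le_trans (le_sup_of_le_left le_sup_right) hnew) le_rfl
    have hh2 : ∀ i, Measurable (S.Bh₂ (t + 1) i) := fun i => (measurable_batchSigma _ i).mono
      (le_trans le_sup_right hnew) le_rfl
    refine ⟨hx', ?_, ?_⟩
    · exact measurable_hybrid h.smooth.measurable_F hx hx' hF h1 h2 _ _ _
    · exact measurable_hybrid h.smooth.measurable_jac hx hx' hJ hh1 hh2 _ _ _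

/-- Predictability: `x_{t+1}` uses only the samples up to time `t`, hence is independent of the
batches at which it is then evaluated. -/
lemma measurable_run_succ_x (h : M.Standing LF MF σF σJ Mψ L θ η) (t : ℕ) :
    Measurable[S.sigma t] (fun ω => (M.run (constParams β θ η) S x₀ ω (t + 1)).x) := by
  let _ : MeasurableSpace Ω := S.sigma t
  obtain ⟨hx, hF, hJ⟩ := h.measurable_run (S := S) (x₀ := x₀) (β := β) t
  exact h.measurable_next hx hF hJ

variable [mΩ : MeasurableSpace Ω] {μ : Measure Ω} [IsProbabilityMeasure μ] {T : ℕ}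

lemma errorF_zero (h : M.Standing LF MF σF σJ Mψ L θ η) (hx₀ : x₀ ∈ dom M.R)
    (hS : S.Valid μ M.law T) (hb : 0 < sz.b₀) :
    Integrable (fun ω => ‖(M.run (constParams β θ η) S x₀ ω 0).Ft
      - M.meanF (M.run (constParams β θ η) S x₀ ω 0).x‖ ^ 2) μ ∧
    ∫ ω, ‖(M.run (constParams β θ η) S x₀ ω 0).Ft
      - M.meanF (M.run (constParams β θ η) S x₀ ω 0).x‖ ^ 2 ∂μ ≤ σF ^ 2 / sz.b₀ :=
  (h.smooth.meanSquareLipschitz_F h.convex_dom).integral_initial_le hb hS.B₀ (h.dom_eq ▸ hx₀)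

lemma errorJ_zero (h : M.Standing LF MF σF σJ Mψ L θ η) (hx₀ : x₀ ∈ dom M.R)
    (hS : S.Valid μ M.law T) (hb : 0 < sz.bh₀) :
    Integrable (fun ω => ‖cols (M.run (constParams β θ η) S x₀ ω 0).Jt
      - cols (M.meanJac (M.run (constParams β θ η) S x₀ ω 0).x)‖ ^ 2) μ ∧
    ∫ ω, ‖cols (M.run (constParams β θ η) S x₀ ω 0).Jt
      - cols (M.meanJac (M.run (constParams β θ η) S x₀ ω 0).x)‖ ^ 2 ∂μ ≤ σJ ^ 2 / sz.bh₀ := by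
  have h1 := h.smooth.meanSquareLipschitz_jac.integral_initial_le hb hS.Bh₀ (h.dom_eq ▸ hx₀)
  rw [← h.smooth.cols_meanJac (h.dom_eq ▸ hx₀)] at h1
  simpa only [run, map_smul, map_sum] using h1

lemma errorF_succ (h : M.Standing LF MF σF σJ Mψ L θ η) (hx₀ : x₀ ∈ dom M.R)
    (hS : S.Valid μ M.law T) (hb₁ : 0 < sz.b₁) (hb₂ : 0 < sz.b₂) {t : ℕ} (ht : t < T)
    (hi : Integrable (fun ω => ‖(M.run (constParams β θ η) S x₀ ω t).Ft
      - M.meanF (M.run (constParams β θ η) S x₀ ω t).x‖ ^ 2) μ)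
    (hid : Integrable (fun ω => ‖(M.run (constParams β θ η) S x₀ ω (t + 1)).x
      - (M.run (constParams β θ η) S x₀ ω t).x‖ ^ 2) μ) :
    Integrable (fun ω => ‖(M.run (constParams β θ η) S x₀ ω (t + 1)).Ft
      - M.meanF (M.run (constParams β θ η) S x₀ ω (t + 1)).x‖ ^ 2) μ ∧
    ∫ ω, ‖(M.run (constParams β θ η) S x₀ ω (t + 1)).Ft
      - M.meanF (M.run (constParams β θ η) S x₀ ω (t + 1)).x‖ ^ 2 ∂μ
      ≤ β ^ 2 * ∫ ω, ‖(M.run (constParams β θ η) S x₀ ω t).Ft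
          - M.meanF (M.run (constParams β θ η) S x₀ ω t).x‖ ^ 2 ∂μ
        + S.kappa μ T * (β ^ 2 * MF ^ 2 / sz.b₁
            * ∫ ω, ‖(M.run (constParams β θ η) S x₀ ω (t + 1)).x
              - (M.run (constParams β θ η) S x₀ ω t).x‖ ^ 2 ∂μ
          + (1 - β) ^ 2 * σF ^ 2 / sz.b₂) := by
  have ht' : t + 1 ∈ Finset.Icc 1 T := Finset.mem_Icc.mpr ⟨by omega, ht⟩
  have hind : Indep (S.newSigma (t + 1)) (S.sigma t) μ := hS.indep_past_succ ht
  obtain ⟨hx, hF, _⟩ := h.measurable_run (S := S) (x₀ := x₀) (β := β) t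
  exact (h.smooth.meanSquareLipschitz_F h.convex_dom).integral_recursion_le
    (𝓕 := S.sigma t) (𝓖 := S.newSigma (t + 1)) hb₁ hb₂
    (hS.B₁ _ ht') (hS.B₂ _ ht') ((S.kappa_cases μ T).imp_right fun hk => ⟨hk.1, hk.2 _ ht'⟩)
    (hS.sigma_le ht.le) hind
    (le_sup_of_le_left (le_sup_of_le_left le_sup_left)) (le_sup_of_le_left le_sup_right)
    hx (h.measurable_run_succ_x t) hF (h.run_x_mem_Ψ₀ hx₀ · t) (h.run_x_mem_Ψ₀ hx₀ · (t + 1))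
    (fun ω => rfl) hi hid

/-- `cols` is linear, so it carries the Jacobian update to the same recursion in a Hilbert space
whose norm is the Frobenius norm. -/
lemma errorJ_succ (h : M.Standing LF MF σF σJ Mψ L θ η) (hx₀ : x₀ ∈ dom M.R)
    (hS : S.Valid μ M.law T) (hb₁ : 0 < sz.bh₁) (hb₂ : 0 < sz.bh₂) {t : ℕ} (ht : t < T)
    (hi : Integrable (fun ω => ‖cols (M.run (constParams β θ η) S x₀ ω t).Jt
      - cols (M.meanJac (M.run (constParams β θ η) S x₀ ω t).x)‖ ^ 2) μ)
    (hid : Integrable (fun ω => ‖(M.run (constParams β θ η) S x₀ ω (t + 1)).x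
      - (M.run (constParams β θ η) S x₀ ω t).x‖ ^ 2) μ) :
    Integrable (fun ω => ‖cols (M.run (constParams β θ η) S x₀ ω (t + 1)).Jt
      - cols (M.meanJac (M.run (constParams β θ η) S x₀ ω (t + 1)).x)‖ ^ 2) μ ∧
    ∫ ω, ‖cols (M.run (constParams β θ η) S x₀ ω (t + 1)).Jt
      - cols (M.meanJac (M.run (constParams β θ η) S x₀ ω (t + 1)).x)‖ ^ 2 ∂μ
      ≤ β ^ 2 * ∫ ω, ‖cols (M.run (constParams β θ η) S x₀ ω t).Jt
          - cols (M.meanJac (M.run (constParams β θ η) S x₀ ω t).x)‖ ^ 2 ∂μ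
        + S.kappaHat μ T * (β ^ 2 * LF ^ 2 / sz.bh₁
            * ∫ ω, ‖(M.run (constParams β θ η) S x₀ ω (t + 1)).x
              - (M.run (constParams β θ η) S x₀ ω t).x‖ ^ 2 ∂μ
          + (1 - β) ^ 2 * σJ ^ 2 / sz.bh₂) := by
  have ht' : t + 1 ∈ Finset.Icc 1 T := Finset.mem_Icc.mpr ⟨by omega, ht⟩
  have hind : Indep (S.newSigma (t + 1)) (S.sigma t) μ := hS.indep_past_succ ht
  obtain ⟨hx, _, hJ⟩ := h.measurable_run (S := S) (x₀ := x₀) (β := β) t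
  have hmean : ∀ (r : ℕ) (ω : Ω), cols (M.meanJac (M.run (constParams β θ η) S x₀ ω r).x)
      = ∫ ξ, cols (M.jac (M.run (constParams β θ η) S x₀ ω r).x ξ) ∂M.law := fun r ω =>
    h.smooth.cols_meanJac (h.run_x_mem_Ψ₀ hx₀ ω r)
  simp only [hmean] at hi ⊢
  refine h.smooth.meanSquareLipschitz_jac.integral_recursion_le
    (𝓕 := S.sigma t) (𝓖 := S.newSigma (t + 1)) hb₁ hb₂
    (hS.Bh₁ _ ht') (hS.Bh₂ _ ht') ((S.kappaHat_cases μ T).imp_right fun hk => ⟨hk.1, hk.2 _ ht'⟩)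
    (hS.sigma_le ht.le) hind
    (le_sup_of_le_left (le_sup_of_le_left le_sup_right)) le_sup_right
    hx (h.measurable_run_succ_x t) (cols.continuous.measurable.comp hJ)
    (h.run_x_mem_Ψ₀ hx₀ · t) (h.run_x_mem_Ψ₀ hx₀ · (t + 1))
    (fun ω => ?_) hi hid
  simp only [run, map_add, map_smul, map_sum, map_sub, constParams, Function.comp_apply]

end Standing

end Problem

/-! ### Summation along the trajectory -/

lemma constP_sq {k LF MF Mψ c₀ κ κh : ℝ} (hc₀ : 0 < c₀) (hκ : 0 ≤ κ) (hκh : 0 ≤ κh) :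
    constP k LF MF Mψ c₀ κ κh ^ 2
      = 26 * k ^ 2 / (9 * c₀) * (κ * MF ^ 4 * k ^ 2 + c₀ * κh * LF ^ 2 * Mψ ^ 2) := by
  rw [constP, mul_pow, div_pow, mul_pow, mul_pow, Real.sq_sqrt (by norm_num), Real.sq_sqrt hc₀.le,
    Real.sq_sqrt (by positivity)]
  ring

lemma constP_pos {k LF MF Mψ c₀ κ κh : ℝ} (hk : 0 < k) (hMF : 0 < MF) (hc₀ : 0 < c₀) (hκ : 0 < κ)
    (hκh : 0 ≤ κh) : 0 < constP k LF MF Mψ c₀ κ κh := by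
  unfold constP
  positivity

/-- Summing a contracting recursion against a telescoping descent inequality. -/
lemma sum_le_of_recursion {w a γ : ℕ → ℝ} {T : ℕ} {ρ A B w₀ Δ τ c d : ℝ}
    (hw : ∀ t, 0 ≤ w t) (ha : ∀ t, 0 ≤ a t) (hρ0 : 0 ≤ ρ) (hρ : ρ < 1) (hA : 0 ≤ A) (hτ : 0 ≤ τ)
    (h0 : w 0 ≤ w₀) (hrec : ∀ t < T, w (t + 1) ≤ ρ * w t + A * a t + B)
    (hdesc : ∑ t ∈ Finset.range (T + 1), (c * γ t + d * a t)
      ≤ Δ + τ * ∑ t ∈ Finset.range (T + 1), w t)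
    (hd : τ * A / (1 - ρ) ≤ d) :
    c * ∑ t ∈ Finset.range (T + 1), γ t ≤ Δ + τ * ((w₀ + T * B) / (1 - ρ)) := by
  have hρ' : 0 < 1 - ρ := by linarith
  have h1 : ∑ t ∈ Finset.range (T + 1), w t ≤ w₀ + (ρ * ∑ t ∈ Finset.range (T + 1), w t
      + A * ∑ t ∈ Finset.range (T + 1), a t + T * B) := by
    conv_lhs => rw [Finset.sum_range_succ']
    have h2 : ∑ t ∈ Finset.range T, w (t + 1)
        ≤ ∑ t ∈ Finset.range T, (ρ * w t + A * a t + B) :=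
      Finset.sum_le_sum fun t ht => hrec t (Finset.mem_range.mp ht)
    rw [Finset.sum_add_distrib, Finset.sum_add_distrib, ← Finset.mul_sum, ← Finset.mul_sum,
      Finset.sum_const, Finset.card_range, nsmul_eq_mul] at h2
    -- The shifted recursion reaches only index `T - 1` on its right-hand side; nonnegative terms at
    -- `T` are added to obtain the same sum on both sides.
    have h3 : ρ * ∑ t ∈ Finset.range T, w t ≤ ρ * ∑ t ∈ Finset.range (T + 1), w t := by
      rw [Finset.sum_range_succ]
      exact mul_le_mul_of_nonneg_left (by linarith [hw T]) hρ0
    have h4 : A * ∑ t ∈ Finset.range T, a t ≤ A * ∑ t ∈ Finset.range (T + 1), a t := by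
      rw [Finset.sum_range_succ]
      exact mul_le_mul_of_nonneg_left (by linarith [ha T]) hA
    linarith
  rw [Finset.sum_add_distrib, ← Finset.mul_sum, ← Finset.mul_sum] at hdesc
  set W := ∑ t ∈ Finset.range (T + 1), w t
  set V := ∑ t ∈ Finset.range (T + 1), a t
  have hV : 0 ≤ V := Finset.sum_nonneg fun t _ => ha t
  have h5 : W ≤ (w₀ + A * V + T * B) / (1 - ρ) := by
    rw [le_div_iff₀ hρ']; linarith
  have h6 := mul_le_mul_of_nonneg_left h5 hτ
  -- By `hd`, what the increments contribute to the error is at most the `d`-term of the descent.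
  have h7 := mul_le_mul_of_nonneg_right hd hV
  have h8 : τ * ((w₀ + A * V + T * B) / (1 - ρ))
      = τ * ((w₀ + T * B) / (1 - ρ)) + τ * A / (1 - ρ) * V := by ring
  linarith

namespace Problem

variable {p n q : ℕ} {Ω Ξ : Type*} [mΞ : MeasurableSpace Ξ] {M : Problem p n q Ξ}
  [IsProbabilityMeasure M.law] {LF MF σF σJ Mψ L θ η : ℝ} {sz : Sizes}
  {S : Samples sz Ω Ξ} {x₀ : Vec p} {β : ℝ}

lemma Ψ₀star_gap (hinf : ⊥ < M.Ψ₀star) {x y : Vec p} (hx : x ∈ dom M.Ψ₀) (hy : y ∈ dom M.Ψ₀) :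
    (M.Ψ₀ x).toReal - (M.Ψ₀ y).toReal ≤ (M.Ψ₀ x - M.Ψ₀star).toReal := by
  have hle : ∀ z, M.Ψ₀star ≤ M.Ψ₀ z := fun z => iInf_le _ z
  have h1 : M.Ψ₀star ≠ ⊤ := ne_top_of_le_ne_top hx (hle x)
  have hne : ∀ z, M.Ψ₀ z ≠ ⊥ := fun z => (hinf.trans_le (hle z)).ne'
  have h2 := EReal.toReal_le_toReal (hle y) hinf.ne' hy
  rw [EReal.toReal_sub hx (hne x) h1 hinf.ne']
  linarith

namespace Standing

/-- Telescoping at a fixed outcome `ω`, with the last value of the objective bounded below by its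
infimum. Being pathwise, it needs no integrability and can serve to prove it. -/
lemma sum_descent (h : M.Standing LF MF σF σJ Mψ L θ η) (hx₀ : x₀ ∈ dom M.R)
    (hinf : ⊥ < M.Ψ₀star) (ω : Ω) (N : ℕ) :
    ∑ t ∈ Finset.range N, (θ / (16 * L) * ‖M.gradMap η (M.run (constParams β θ η) S x₀ ω t).x‖ ^ 2
        + L / (2 * θ) * ‖(M.run (constParams β θ η) S x₀ ω (t + 1)).x
          - (M.run (constParams β θ η) S x₀ ω t).x‖ ^ 2)
      ≤ (M.Ψ₀ x₀ - M.Ψ₀star).toReal + θ / L * ∑ t ∈ Finset.range N,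
          M.errorSq MF Mψ (M.run (constParams β θ η) S x₀ ω t) := by
  have key : ∀ N, (M.Ψ₀ (M.run (constParams β θ η) S x₀ ω N).x).toReal
      + ∑ t ∈ Finset.range N, (θ / (16 * L)
          * ‖M.gradMap η (M.run (constParams β θ η) S x₀ ω t).x‖ ^ 2
        + L / (2 * θ) * ‖(M.run (constParams β θ η) S x₀ ω (t + 1)).x
          - (M.run (constParams β θ η) S x₀ ω t).x‖ ^ 2)
      ≤ (M.Ψ₀ x₀).toReal + θ / L * ∑ t ∈ Finset.range N,
          M.errorSq MF Mψ (M.run (constParams β θ η) S x₀ ω t) := by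
    intro N
    induction N with
    | zero => simp [run]
    | succ N ih =>
      rw [Finset.sum_range_succ, Finset.sum_range_succ, mul_add]
      have hstep := h.smooth.next_descent h.LF_pos h.MF_pos h.pcc_R h.pcc_ψ h.bounded_dom h.strong
        h.L_eq h.L_pos h.θ_pos h.θ_le_one h.η_eq (M.run (constParams β θ η) S x₀ ω N)
        (h.run_x_mem hx₀ ω N)
      have e : (M.run (constParams β θ η) S x₀ ω (N + 1)).x
        = M.next θ η (M.run (constParams β θ η) S x₀ ω N) := rfl
      rw [e]
      linarith
  have h1 := Ψ₀star_gap hinf (h.dom_eq ▸ hx₀) (h.run_x_mem_Ψ₀ (S := S) (β := β) hx₀ ω N)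
  linarith [key N]

lemma measurable_gradMap_run (h : M.Standing LF MF σF σJ Mψ L θ η) (t : ℕ) :
    Measurable[S.sigma t]
      fun ω => ‖M.gradMap η (M.run (constParams β θ η) S x₀ ω t).x‖ ^ 2 := by
  let _ : MeasurableSpace Ω := S.sigma t
  exact (((h.smooth.measurable_gradMap h.pcc_R h.pcc_ψ h.strong h.η_pos).comp
    (h.measurable_run t).1).norm).pow_const 2

variable [mΩ : MeasurableSpace Ω] {μ : Measure Ω} [IsProbabilityMeasure μ] {T : ℕ}

lemma measurable_run_x (h : M.Standing LF MF σF σJ Mψ L θ η) (hS : S.Valid μ M.law T) {t : ℕ}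
    (ht : t ≤ T) : Measurable fun ω => (M.run (constParams β θ η) S x₀ ω t).x :=
  (h.measurable_run t).1.mono (hS.sigma_le ht) le_rfl

lemma measurable_increment (h : M.Standing LF MF σF σJ Mψ L θ η) (hS : S.Valid μ M.law T) {t : ℕ}
    (ht : t ≤ T) : Measurable fun ω => ‖(M.run (constParams β θ η) S x₀ ω (t + 1)).x
      - (M.run (constParams β θ η) S x₀ ω t).x‖ ^ 2 :=
  ((((h.measurable_run_succ_x t).mono (hS.sigma_le ht) le_rfl).sub
    (h.measurable_run_x hS ht)).norm).pow_const 2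

lemma integrable_errorSq {s : Ω → State p q}
    (hF : Integrable (fun ω => ‖(s ω).Ft - M.meanF (s ω).x‖ ^ 2) μ)
    (hJ : Integrable (fun ω => ‖cols (s ω).Jt - cols (M.meanJac (s ω).x)‖ ^ 2) μ) :
    Integrable (fun ω => M.errorSq MF Mψ (s ω)) μ :=
  ((hJ.const_mul _).add (hF.const_mul _)).const_mul _

lemma integral_errorSq {s : Ω → State p q}
    (hF : Integrable (fun ω => ‖(s ω).Ft - M.meanF (s ω).x‖ ^ 2) μ)
    (hJ : Integrable (fun ω => ‖cols (s ω).Jt - cols (M.meanJac (s ω).x)‖ ^ 2) μ) :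
    ∫ ω, M.errorSq MF Mψ (s ω) ∂μ
      = 13 / 9 * (‖M.K‖ ^ 2 * Mψ ^ 2 * ∫ ω, ‖cols (s ω).Jt - cols (M.meanJac (s ω).x)‖ ^ 2 ∂μ
        + MF ^ 2 * ‖M.K‖ ^ 4 * ∫ ω, ‖(s ω).Ft - M.meanF (s ω).x‖ ^ 2 ∂μ) := by
  unfold errorSq
  rw [integral_const_mul, integral_add (hJ.const_mul _) (hF.const_mul _), integral_const_mul,
    integral_const_mul]

/-- No moment of the iterates is assumed. The pathwise descent dominates the step and the gradient
mapping by a constant plus estimation errors already known to be integrable. -/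
lemma integrable_step (h : M.Standing LF MF σF σJ Mψ L θ η) (hx₀ : x₀ ∈ dom M.R)
    (hinf : ⊥ < M.Ψ₀star) (hS : S.Valid μ M.law T) {t : ℕ} (ht : t ≤ T)
    (hi : ∀ s ≤ t, Integrable (fun ω => M.errorSq MF Mψ (M.run (constParams β θ η) S x₀ ω s)) μ) :
    Integrable (fun ω => ‖(M.run (constParams β θ η) S x₀ ω (t + 1)).x
      - (M.run (constParams β θ η) S x₀ ω t).x‖ ^ 2) μ ∧
    Integrable (fun ω => ‖M.gradMap η (M.run (constParams β θ η) S x₀ ω t).x‖ ^ 2) μ := by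
  have hL := h.L_pos
  have hθ := h.θ_pos
  have hbound : Integrable (fun ω => (M.Ψ₀ x₀ - M.Ψ₀star).toReal
      + θ / L * ∑ s ∈ Finset.range (t + 1),
        M.errorSq MF Mψ (M.run (constParams β θ η) S x₀ ω s)) μ :=
    (integrable_const _).add ((integrable_finsetSum _ fun s hs =>
      hi s (Nat.lt_succ_iff.mp (Finset.mem_range.mp hs))).const_mul _)
  have hle : ∀ ω, θ / (16 * L) * ‖M.gradMap η (M.run (constParams β θ η) S x₀ ω t).x‖ ^ 2
        + L / (2 * θ) * ‖(M.run (constParams β θ η) S x₀ ω (t + 1)).x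
          - (M.run (constParams β θ η) S x₀ ω t).x‖ ^ 2
      ≤ (M.Ψ₀ x₀ - M.Ψ₀star).toReal + θ / L * ∑ s ∈ Finset.range (t + 1),
        M.errorSq MF Mψ (M.run (constParams β θ η) S x₀ ω s) := fun ω =>
    (Finset.single_le_sum (f := fun t => θ / (16 * L)
          * ‖M.gradMap η (M.run (constParams β θ η) S x₀ ω t).x‖ ^ 2
        + L / (2 * θ) * ‖(M.run (constParams β θ η) S x₀ ω (t + 1)).x
          - (M.run (constParams β θ η) S x₀ ω t).x‖ ^ 2) (fun s _ => by positivity)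
      (Finset.self_mem_range_succ t)).trans (h.sum_descent hx₀ hinf ω (t + 1))
  have h1 : ∀ ω, 0 ≤ θ / (16 * L) * ‖M.gradMap η (M.run (constParams β θ η) S x₀ ω t).x‖ ^ 2 :=
    fun ω => by positivity
  have h2 : ∀ ω, 0 ≤ L / (2 * θ) * ‖(M.run (constParams β θ η) S x₀ ω (t + 1)).x
          - (M.run (constParams β θ η) S x₀ ω t).x‖ ^ 2 := fun ω => by positivity
  constructor
  · have : Integrable (fun ω => L / (2 * θ) * ‖(M.run (constParams β θ η) S x₀ ω (t + 1)).x
          - (M.run (constParams β θ η) S x₀ ω t).x‖ ^ 2) μ := by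
      refine hbound.mono' ((h.measurable_increment hS ht).const_mul _).aestronglyMeasurable
        (Filter.Eventually.of_forall fun ω => ?_)
      rw [Real.norm_of_nonneg (h2 ω)]
      linarith [hle ω, h1 ω]
    exact (integrable_const_mul_iff (isUnit_iff_ne_zero.mpr (by positivity)) _).mp this
  · have : Integrable (fun ω => θ / (16 * L)
        * ‖M.gradMap η (M.run (constParams β θ η) S x₀ ω t).x‖ ^ 2) μ := by
      refine hbound.mono' ((((h.measurable_gradMap_run t).mono (hS.sigma_le ht)
        le_rfl).const_mul _).aestronglyMeasurable) (Filter.Eventually.of_forall fun ω => ?_)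
      rw [Real.norm_of_nonneg (h1 ω)]
      linarith [hle ω, h2 ω]
    exact (integrable_const_mul_iff (isUnit_iff_ne_zero.mpr (by positivity)) _).mp this

/-- All the second moments along the trajectory are finite. -/
lemma integrable_errors (h : M.Standing LF MF σF σJ Mψ L θ η) (hx₀ : x₀ ∈ dom M.R)
    (hinf : ⊥ < M.Ψ₀star) (hS : S.Valid μ M.law T) (hb₀ : 0 < sz.b₀) (hbh₀ : 0 < sz.bh₀)
    (hb₁ : 0 < sz.b₁) (hb₂ : 0 < sz.b₂) (hbh₁ : 0 < sz.bh₁) (hbh₂ : 0 < sz.bh₂) {t : ℕ}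
    (ht : t ≤ T) : ∀ s ≤ t,
    Integrable (fun ω => ‖(M.run (constParams β θ η) S x₀ ω s).Ft
      - M.meanF (M.run (constParams β θ η) S x₀ ω s).x‖ ^ 2) μ ∧
    Integrable (fun ω => ‖cols (M.run (constParams β θ η) S x₀ ω s).Jt
      - cols (M.meanJac (M.run (constParams β θ η) S x₀ ω s).x)‖ ^ 2) μ := by
  induction t with
  | zero =>
    intro s hs
    obtain rfl : s = 0 := by omega
    exact ⟨(h.errorF_zero hx₀ hS hb₀).1, (h.errorJ_zero hx₀ hS hbh₀).1⟩
  | succ t ih =>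
    have ih' := ih (by omega)
    intro s hs
    rcases Nat.lt_or_ge s (t + 1) with hlt | hge
    · exact ih' s (by omega)
    obtain rfl : s = t + 1 := by omega
    -- The bootstrap: integrable errors up to `t` make the step to `x_{t+1}` square integrable,
    -- which the recursion needs for the errors at `t + 1`.
    have hid := (h.integrable_step (β := β) hx₀ hinf hS (t := t) (by omega) fun s hs =>
      integrable_errorSq (ih' s hs).1 (ih' s hs).2).1
    exact ⟨(h.errorF_succ hx₀ hS hb₁ hb₂ (by omega) (ih' t le_rfl).1 hid).1,
      (h.errorJ_succ hx₀ hS hbh₁ hbh₂ (by omega) (ih' t le_rfl).2 hid).1⟩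

/-- The accumulated squared gradient mappings along the trajectory. -/
theorem sum_integral_gradMap_le (h : M.Standing LF MF σF σJ Mψ L θ η) (hx₀ : x₀ ∈ dom M.R)
    (hinf : ⊥ < M.Ψ₀star) (hS : S.Valid μ M.law T) {b : ℕ} (hb : 0 < b) {c₀ P Q : ℝ}
    (hc₀ : 0 < c₀) (hbh₀ : 0 < sz.bh₀) (hbh₁ : sz.bh₁ = b) (hbh₂ : sz.bh₂ = b)
    (hb₁ : (sz.b₁ : ℝ) = c₀ * b) (hb₂ : (sz.b₂ : ℝ) = c₀ * b) (hb₀ : (sz.b₀ : ℝ) = c₀ * sz.bh₀)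
    (hP : P = constP ‖M.K‖ LF MF Mψ c₀ (S.kappa μ T) (S.kappaHat μ T))
    (hQ : Q = constQ ‖M.K‖ MF Mψ σF σJ c₀ (S.kappa μ T) (S.kappaHat μ T))
    (hβ0 : 0 ≤ β) (hβ1 : β < 1) (hPθ : θ ^ 2 * P ^ 2 ≤ L ^ 2 * b * (1 - β)) :
    (∀ t ≤ T,
      Integrable (fun ω => ‖M.gradMap η (M.run (constParams β θ η) S x₀ ω t).x‖ ^ 2) μ) ∧
    θ / (16 * L) * ∑ t ∈ Finset.range (T + 1),
        ∫ ω, ‖M.gradMap η (M.run (constParams β θ η) S x₀ ω t).x‖ ^ 2 ∂μ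
      ≤ (M.Ψ₀ x₀ - M.Ψ₀star).toReal
        + θ / L * ((Q / (2 * sz.bh₀) + T * ((1 - β) ^ 2 * Q / (2 * b))) / (1 - β ^ 2)) := by
  have hL := h.L_pos
  have hθ := h.θ_pos
  have hbR : (0 : ℝ) < b := by exact_mod_cast hb
  have hbh₀R : (0 : ℝ) < sz.bh₀ := by exact_mod_cast hbh₀
  have pb₀ : 0 < sz.b₀ := by
    have : (0 : ℝ) < sz.b₀ := by rw [hb₀]; positivity
    exact_mod_cast this
  have pb₁ : 0 < sz.b₁ := by
    have : (0 : ℝ) < sz.b₁ := by rw [hb₁]; positivity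
    exact_mod_cast this
  have pb₂ : 0 < sz.b₂ := by
    have : (0 : ℝ) < sz.b₂ := by rw [hb₂]; positivity
    exact_mod_cast this
  have hκ := S.one_le_kappa μ T
  have hκh := S.one_le_kappaHat μ T
  have hP2 := constP_sq (k := ‖M.K‖) (LF := LF) (MF := MF) (Mψ := Mψ) hc₀
    (zero_le_one.trans hκ) (zero_le_one.trans hκh)
  rw [← hP] at hP2
  have hE := h.integrable_errors (β := β) hx₀ hinf hS pb₀ hbh₀ pb₁ pb₂ (hbh₁ ▸ hb) (hbh₂ ▸ hb)
    (le_refl T)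
  have hsq : ∀ s ≤ T,
      Integrable (fun ω => M.errorSq MF Mψ (M.run (constParams β θ η) S x₀ ω s)) μ :=
    fun s hs => integrable_errorSq (hE s hs).1 (hE s hs).2
  have hI := fun t (ht : t ≤ T) => h.integrable_step (β := β) hx₀ hinf hS ht
    fun s hs => hsq s (hs.trans ht)
  refine ⟨fun t ht => (hI t ht).2, ?_⟩
  have hρ : β ^ 2 < 1 := by nlinarith
  -- The value of `A` is the combined coefficient of the increments: the weights of `errorSq`
  -- applied to the two recursions with batch sizes `c₀b` and `b` give `β²P²/(2b)`, which is how `P`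
  -- is defined.
  refine sum_le_of_recursion (ρ := β ^ 2) (A := β ^ 2 * P ^ 2 / (2 * b)) (d := L / (2 * θ))
    (w := fun t => ∫ ω, M.errorSq MF Mψ (M.run (constParams β θ η) S x₀ ω t) ∂μ)
    (a := fun t => ∫ ω, ‖(M.run (constParams β θ η) S x₀ ω (t + 1)).x
          - (M.run (constParams β θ η) S x₀ ω t).x‖ ^ 2 ∂μ)
    (fun t => integral_nonneg fun ω => errorSq_nonneg _ _ _)
    (fun t => integral_nonneg fun ω => by positivity) (sq_nonneg β) hρ
    (by positivity) (by positivity) ?_ ?_ ?_ ?_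
  · rw [integral_errorSq (hE 0 (Nat.zero_le _)).1 (hE 0 (Nat.zero_le _)).2]
    have h1 := (h.errorF_zero (β := β) hx₀ hS pb₀).2
    have h2 := (h.errorJ_zero (β := β) hx₀ hS hbh₀).2
    calc _ ≤ 13 / 9 * (‖M.K‖ ^ 2 * Mψ ^ 2 * (σJ ^ 2 / sz.bh₀)
          + MF ^ 2 * ‖M.K‖ ^ 4 * (σF ^ 2 / sz.b₀)) := by gcongr
      _ ≤ 13 / 9 * (‖M.K‖ ^ 2 * Mψ ^ 2 * (S.kappaHat μ T * (σJ ^ 2 / sz.bh₀))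
          + MF ^ 2 * ‖M.K‖ ^ 4 * (S.kappa μ T * (σF ^ 2 / sz.b₀))) := by
        gcongr
        · exact le_mul_of_one_le_left (by positivity) hκh
        · exact le_mul_of_one_le_left (by positivity) hκ
      _ = Q / (2 * sz.bh₀) := by
        rw [hQ, constQ, hb₀]; field_simp; ring
  · intro t ht
    rw [integral_errorSq (hE t ht.le).1 (hE t ht.le).2,
      integral_errorSq (hE (t + 1) ht).1 (hE (t + 1) ht).2]
    have h1 := (h.errorF_succ hx₀ hS pb₁ pb₂ ht (hE t ht.le).1 (hI t ht.le).1).2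
    have h2 := (h.errorJ_succ hx₀ hS (hbh₁ ▸ hb) (hbh₂ ▸ hb) ht (hE t ht.le).2 (hI t ht.le).1).2
    rw [hb₁, hb₂] at h1
    rw [hbh₁, hbh₂] at h2
    refine (mul_le_mul_of_nonneg_left (add_le_add
      (mul_le_mul_of_nonneg_left h2 (by positivity : 0 ≤ ‖M.K‖ ^ 2 * Mψ ^ 2))
      (mul_le_mul_of_nonneg_left h1 (by positivity : 0 ≤ MF ^ 2 * ‖M.K‖ ^ 4)))
      (by norm_num : (0 : ℝ) ≤ 13 / 9)).trans_eq ?_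
    rw [hP2, hQ, constQ]
    field_simp
    ring
  -- The sum includes the step from `x_T` to `x_{T+1}`; it is legitimate because `x_{T+1}` uses only
  -- batches up to `T`.
  · have hd := integral_mono (μ := μ) ?_ ?_ (h.sum_descent (S := S) (β := β) hx₀ hinf · (T + 1))
    · rw [integral_finsetSum, integral_add (integrable_const _), integral_const_mul,
        integral_finsetSum] at hd
      · simp only [integral_const, probReal_univ, smul_eq_mul, one_mul] at hd
        refine (Finset.sum_le_sum fun t ht => ?_).trans hd
        have ht' : t ≤ T := Nat.lt_succ_iff.mp (Finset.mem_range.mp ht)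
        rw [integral_add ((hI t ht').2.const_mul _) ((hI t ht').1.const_mul _),
          integral_const_mul, integral_const_mul]
      · exact fun t ht => hsq t (Nat.lt_succ_iff.mp (Finset.mem_range.mp ht))
      · exact (integrable_finsetSum _ fun t ht =>
          hsq t (Nat.lt_succ_iff.mp (Finset.mem_range.mp ht))).const_mul _
      · exact fun t ht =>
          ((hI t (Nat.lt_succ_iff.mp (Finset.mem_range.mp ht))).2.const_mul _).add
            ((hI t (Nat.lt_succ_iff.mp (Finset.mem_range.mp ht))).1.const_mul _)
    · exact integrable_finsetSum _ fun t ht =>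
          ((hI t (Nat.lt_succ_iff.mp (Finset.mem_range.mp ht))).2.const_mul _).add
            ((hI t (Nat.lt_succ_iff.mp (Finset.mem_range.mp ht))).1.const_mul _)
    · exact (integrable_const _).add ((integrable_finsetSum _ fun t ht =>
          hsq t (Nat.lt_succ_iff.mp (Finset.mem_range.mp ht))).const_mul _)
  · have h1 : 0 < 1 - β ^ 2 := by linarith
    rw [div_le_div_iff₀ h1 (by positivity)]
    -- The absorption condition `τA/(1-ρ) ≤ d` amounts to this inequality, which follows from `hPθ`
    -- because `β² ≤ 1` and `β² ≤ β`.
    have h2 : β ^ 2 * (θ ^ 2 * P ^ 2) ≤ L ^ 2 * b * (1 - β ^ 2) := by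
      calc β ^ 2 * (θ ^ 2 * P ^ 2) ≤ 1 * (θ ^ 2 * P ^ 2) := by gcongr
        _ ≤ L ^ 2 * b * (1 - β) := by rw [one_mul]; exact hPθ
        _ ≤ L ^ 2 * b * (1 - β ^ 2) := by
          have : 1 - β ≤ 1 - β ^ 2 := by nlinarith
          gcongr
    have h3 : θ / L * (β ^ 2 * P ^ 2 / (2 * b)) * (2 * θ)
        = 1 / (L * b) * (β ^ 2 * (θ ^ 2 * P ^ 2)) := by field_simp
    rw [h3]
    refine (mul_le_mul_of_nonneg_left h2 (by positivity)).trans_eq ?_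
    field_simp

/-- The output index is uniform and independent of the trajectory. -/
lemma integral_output_eq (h : M.Standing LF MF σF σJ Mψ L θ η)
    {idx : Ω → Fin (T + 1)} (hidx : IsOutputIndex S μ (constParams β θ η) L T idx)
    (hi : ∀ t ≤ T,
      Integrable (fun ω => ‖M.gradMap η (M.run (constParams β θ η) S x₀ ω t).x‖ ^ 2) μ) :
    Integrable (fun ω => ‖M.gradMap η (M.run (constParams β θ η) S x₀ ω (idx ω)).x‖ ^ 2) μ ∧
    ∫ ω, ‖M.gradMap η (M.run (constParams β θ η) S x₀ ω (idx ω)).x‖ ^ 2 ∂μ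
      = 1 / (T + 1) * ∑ t ∈ Finset.range (T + 1),
        ∫ ω, ‖M.gradMap η (M.run (constParams β θ η) S x₀ ω t).x‖ ^ 2 ∂μ := by
  set G : ℕ → Ω → ℝ := fun t ω => ‖M.gradMap η (M.run (constParams β θ η) S x₀ ω t).x‖ ^ 2 with hG
  have hle : ∀ t : Fin (T + 1), (t : ℕ) ≤ T := fun t => Nat.lt_succ_iff.mp t.2
  have hms : ∀ t : Fin (T + 1), MeasurableSet (idx ⁻¹' {t}) := fun t =>
    hidx.measurable (measurableSet_singleton t)
  -- The output is written as a sum over the events that the index equals `t`; each indicator is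
  -- independent of the trajectory, so the expectations factor.
  have hsum : (fun ω => G (idx ω) ω)
      = fun ω => ∑ t : Fin (T + 1), (idx ⁻¹' {t}).indicator (fun _ => (1 : ℝ)) ω * G t ω := by
    funext ω
    rw [Finset.sum_eq_single (idx ω)]
    · simp
    · intro t _ ht
      rw [Set.indicator_of_notMem (by simpa using ht.symm), zero_mul]
    · simp
  have hind : ∀ t : Fin (T + 1),
      IndepFun ((idx ⁻¹' {t}).indicator (fun _ => (1 : ℝ))) (G t) μ := by
    intro t
    have h1 : Measurable[MeasurableSpace.comap idx inferInstance]
        ((idx ⁻¹' {t}).indicator (fun _ => (1 : ℝ))) :=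
      measurable_const.indicator ⟨{t}, measurableSet_singleton t, rfl⟩
    have h2 : Measurable[S.sigma T] (G t) :=
      (h.measurable_gradMap_run t).mono (S.sigma_mono (hle t)) le_rfl
    exact indep_of_indep_of_le hidx.indep h1.comap_le h2.comap_le
  have hone : ∀ t : Fin (T + 1), Integrable ((idx ⁻¹' {t}).indicator (fun _ => (1 : ℝ))) μ :=
    fun t => (integrable_const 1).indicator (hms t)
  have hint : ∀ t : Fin (T + 1),
      Integrable (fun ω => (idx ⁻¹' {t}).indicator (fun _ => (1 : ℝ)) ω * G t ω) μ := fun t =>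
    (hind t).integrable_mul (hone t) (hi t (hle t))
  have hprob : ∀ t : Fin (T + 1), μ.real (idx ⁻¹' {t}) = 1 / (T + 1) := by
    intro t
    have hL := h.L_pos
    have hθ := h.θ_pos
    rw [hidx.prob t]
    simp only [constParams, Finset.sum_const, Finset.card_univ, Fintype.card_fin, nsmul_eq_mul]
    push_cast
    field_simp
  change Integrable (fun ω => G (idx ω) ω) μ ∧ ∫ ω, G (idx ω) ω ∂μ = _
  rw [hsum]
  refine ⟨integrable_finsetSum _ fun t _ => hint t, ?_⟩
  rw [integral_finsetSum _ fun t _ => hint t, Finset.sum_range, Finset.mul_sum]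
  refine Finset.sum_congr rfl fun t _ => ?_
  have h1 := (hind t).integral_mul_eq_mul_integral (hone t).aestronglyMeasurable
    (hi t (hle t)).aestronglyMeasurable
  refine h1.trans ?_
  rw [integral_indicator_const _ (hms t), hprob, smul_eq_mul, mul_one]

end Standing

end Problem

/-! ### Rate and complexity -/

/-- The rate in terms of the fourth roots `u = b^{1/4}`, `r = (b̂₀(T+1))^{1/4}` and of
`m = (b(T+1))^{1/3}`. -/
lemma rate_of_sum_le {u r m N c₁ P L θ β Q Δ Γ T b bh : ℝ} (hu : 0 < u) (hr : 0 < r) (hm : 0 < m)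
    (hT : 0 ≤ T) (hP : 0 < P) (hL : 0 < L) (hc₁ : 0 < c₁) (hQ : 0 ≤ Q)
    (hb : b = u ^ 4) (hN : N = bh * (T + 1)) (hNr : N = r ^ 4) (hm3 : b * (T + 1) = m ^ 3)
    (hbh : bh = c₁ ^ 2 * m) (hβ : 1 - β = u ^ 2 / r ^ 2) (hβ0 : 0 ≤ β) (hβ1 : β < 1)
    (hθ : θ = L * u ^ 3 / (P * r))
    (hΓ : θ / (16 * L) * Γ
      ≤ Δ + θ / L * ((Q / (2 * bh) + T * ((1 - β) ^ 2 * Q / (2 * b))) / (1 - β ^ 2))) :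
    1 / (T + 1) * Γ ≤ (16 * P * √c₁ * Δ + 16 * Q / c₁) / m ^ 2 := by
  have hT1 : 0 < T + 1 := by linarith
  have hb0 : 0 < b := by rw [hb]; positivity
  have hbh0 : 0 < bh := by rw [hbh]; positivity
  have hθ0 : 0 < θ := by rw [hθ]; positivity
  -- The only place where the size of `b̂₀` enters: `(ru)⁴ = b̂₀ · b(T+1) = c₁² m · m³`.
  have hru : (r * u) ^ 2 = c₁ * m ^ 2 := by
    have h4 : ((r * u) ^ 2) ^ 2 = (c₁ * m ^ 2) ^ 2 := by
      calc ((r * u) ^ 2) ^ 2 = r ^ 4 * u ^ 4 := by ring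
        _ = bh * (b * (T + 1)) := by rw [← hNr, ← hb, hN]; ring
        _ = (c₁ * m ^ 2) ^ 2 := by rw [hbh, hm3]; ring
    exact (pow_left_inj₀ (by positivity) (by positivity) two_ne_zero).mp h4
  have hsqrt : √c₁ = r * u / m := by
    rw [Real.sqrt_eq_iff_eq_sq hc₁.le (by positivity), div_pow, hru]
    field_simp
  have hw0 : 0 < 1 - β := by linarith
  have hw : 1 - β ≤ 1 - β ^ 2 := by nlinarith
  have hw' : 0 < 1 - β ^ 2 := by linarith
  have h1 : (Q / (2 * bh) + T * ((1 - β) ^ 2 * Q / (2 * b))) / (1 - β ^ 2)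
      ≤ (T + 1) * (Q / (r * u) ^ 2) := by
    have a1 : (Q / (2 * bh) + T * ((1 - β) ^ 2 * Q / (2 * b))) / (1 - β ^ 2)
        ≤ (Q / (2 * bh) + (T + 1) * ((1 - β) ^ 2 * Q / (2 * b))) / (1 - β) := by
      gcongr
      linarith
    refine a1.trans_eq ?_
    -- With `1 - β = u²/r²` the initial and the accumulated noise are now equal, each `(T+1)Q /
    -- (2(ru)²)`; this is the balance behind the choice of `β`.
    have a2 : bh = r ^ 4 / (T + 1) := by rw [← hNr, hN]; field_simp
    rw [hβ, hb, a2]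
    field_simp
    ring
  have h2 : Γ ≤ 16 * L / θ * (Δ + θ / L * ((T + 1) * (Q / (r * u) ^ 2))) := by
    have a1 : θ / (16 * L) * Γ ≤ Δ + θ / L * ((T + 1) * (Q / (r * u) ^ 2)) :=
      hΓ.trans (by gcongr)
    have a2 := mul_le_mul_of_nonneg_left a1 (by positivity : 0 ≤ 16 * L / θ)
    have a3 : 16 * L / θ * (θ / (16 * L) * Γ) = Γ := by field_simp
    rwa [a3] at a2
  refine (mul_le_mul_of_nonneg_left h2 (by positivity : 0 ≤ 1 / (T + 1))).trans_eq ?_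
  have a4 : 1 / (T + 1) * (16 * L / θ * (Δ + θ / L * ((T + 1) * (Q / (r * u) ^ 2))))
      = 16 * L / (θ * (T + 1)) * Δ + 16 * (Q / (r * u) ^ 2) := by field_simp
  have a5 : T + 1 = m ^ 3 / u ^ 4 := by rw [← hm3, hb]; field_simp
  rw [a4, hsqrt, hru, a5, hθ]
  field_simp

lemma rpow_two_thirds_eq {x : ℝ} (hx : 0 ≤ x) : x ^ (2 / 3 : ℝ) = (x ^ (1 / 3 : ℝ)) ^ 2 := by
  rw [← Real.rpow_natCast, ← Real.rpow_mul hx]; norm_num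

lemma rpow_third_cubed {x : ℝ} (hx : 0 ≤ x) : (x ^ (1 / 3 : ℝ)) ^ 3 = x := by
  rw [← Real.rpow_natCast, ← Real.rpow_mul hx]; norm_num

lemma rpow_quarter_pow {x : ℝ} (hx : 0 ≤ x) : (x ^ (1 / 4 : ℝ)) ^ 4 = x := by
  rw [← Real.rpow_natCast, ← Real.rpow_mul hx]; norm_num

lemma rpow_half_eq {x : ℝ} (hx : 0 ≤ x) : x ^ (1 / 2 : ℝ) = (x ^ (1 / 4 : ℝ)) ^ 2 := by
  rw [← Real.rpow_natCast, ← Real.rpow_mul hx]; norm_num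

lemma rpow_three_quarters_eq {x : ℝ} (hx : 0 ≤ x) : x ^ (3 / 4 : ℝ) = (x ^ (1 / 4 : ℝ)) ^ 3 := by
  rw [← Real.rpow_natCast, ← Real.rpow_mul hx]; norm_num

/-- From the rate to the accuracy `ε²`. -/
lemma div_rpow_le_sq {Δ ε x : ℝ} (hΔ : 0 < Δ) (hε : 0 < ε)
    (hx : Δ ^ (3 / 2 : ℝ) / ε ^ 3 ≤ x) : Δ / x ^ (2 / 3 : ℝ) ≤ ε ^ 2 := by
  have h1 : (Δ ^ (3 / 2 : ℝ) / ε ^ 3) ^ (2 / 3 : ℝ) = Δ / ε ^ 2 := by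
    rw [Real.div_rpow (by positivity) (by positivity), ← Real.rpow_mul hΔ.le,
      ← Real.rpow_natCast ε 3, ← Real.rpow_mul hε.le, ← Real.rpow_natCast ε 2]
    norm_num
  have h2 : Δ / ε ^ 2 ≤ x ^ (2 / 3 : ℝ) := by
    rw [← h1]
    exact Real.rpow_le_rpow (by positivity) hx (by norm_num)
  have h3 : 0 < x ^ (2 / 3 : ℝ) := lt_of_lt_of_le (by positivity) h2
  rw [div_le_iff₀ h3]
  rw [div_le_iff₀ (by positivity)] at h2
  linarith

lemma evaluations_run {p n q : ℕ} {Ω Ξ : Type*} [MeasurableSpace Ξ] (M : Problem p n q Ξ)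
    (par : Params) {sz : Sizes} (S : Samples sz Ω Ξ) (x₀ : Vec p) (ω : Ω) (t : ℕ) :
    (M.run par S x₀ ω t).evalF = sz.b₀ + t * (2 * sz.b₁ + sz.b₂) ∧
      (M.run par S x₀ ω t).evalJ = sz.bh₀ + t * (2 * sz.bh₁ + sz.bh₂) := by
  induction t with
  | zero => simp [Problem.run]
  | succ t ih =>
    simp only [Problem.run, ih.1, ih.2]
    constructor <;> ring

end MinimaxSGD

/-! ### The main theorem -/

theorem theorem1 {p n q : ℕ} {Ω Ξ : Type*} [MeasurableSpace Ω] [MeasurableSpace Ξ]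
    -- the problem
    (M : MinimaxSGD.Problem p n q Ξ) [IsProbabilityMeasure M.law] (hK : M.K ≠ 0)
    (LF MF σF σJ Mψ : ℝ) (hLF : 0 < LF) (hMF : 0 < MF) (hσF : 0 < σF) (hσJ : 0 < σJ) (hMψ : 0 < Mψ)
    (hR : MinimaxSGD.ProperClosedConvex M.R) (hinf : ⊥ < M.Ψ₀star)
    (hF : M.SmoothStochastic LF MF σF σJ)
    (hψ : MinimaxSGD.ProperClosedConvex M.ψ) (hψdom : ∀ y ∈ MinimaxSGD.dom M.ψ, ‖y‖ ≤ Mψ)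
    (hψ1 : MinimaxSGD.ExtStronglyConvex 1 M.ψ)
    (x₀ : MinimaxSGD.Vec p) (hx₀ : x₀ ∈ MinimaxSGD.dom M.Ψ₀)
    -- the mini-batches
    (T b : ℕ) (hb : 0 < b) (c₀ c₁ : ℝ) (hc₀ : 0 < c₀) (hc₁ : 0 < c₁)
    (sz : MinimaxSGD.Sizes)
    (hbh₁ : sz.bh₁ = b) (hbh₂ : sz.bh₂ = b)
    (hb₁ : (sz.b₁ : ℝ) = c₀ * b) (hb₂ : (sz.b₂ : ℝ) = c₀ * b)
    (hb₀ : (sz.b₀ : ℝ) = c₀ * sz.bh₀)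
    (hbh₀ : (sz.bh₀ : ℝ) = c₁ ^ 2 * ((b : ℝ) * (T + 1)) ^ (1 / 3 : ℝ))
    (hbT : b ≤ sz.bh₀ * (T + 1))
    (μ : Measure Ω) [IsProbabilityMeasure μ] (S : MinimaxSGD.Samples sz Ω Ξ)
    (hS : S.Valid μ M.law T)
    -- the constants and the parameters of the algorithm
    (L P Q β θ η Δ₀ : ℝ)
    (hL : L = MinimaxSGD.constL ‖M.K‖ LF MF Mψ)
    (hP : P = MinimaxSGD.constP ‖M.K‖ LF MF Mψ c₀ (S.kappa μ T) (S.kappaHat μ T))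
    (hQ : Q = MinimaxSGD.constQ ‖M.K‖ MF Mψ σF σJ c₀ (S.kappa μ T) (S.kappaHat μ T))
    (hcond : L ^ 4 / P ^ 4 < (sz.bh₀ : ℝ) * (T + 1) / (b : ℝ) ^ 3)
    (hβ : β = 1 - (b : ℝ) ^ (1 / 2 : ℝ) / ((sz.bh₀ : ℝ) * (T + 1)) ^ (1 / 2 : ℝ))
    (hθ : θ = L * (b : ℝ) ^ (3 / 4 : ℝ) / (P * ((sz.bh₀ : ℝ) * (T + 1)) ^ (1 / 4 : ℝ)))
    (hη : η = 2 / (L * (3 + θ)))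
    (hΔ : Δ₀ = 16 * P * √c₁ * (M.Ψ₀ x₀ - M.Ψ₀star).toReal + 24 * Q / c₁)
    (par : MinimaxSGD.Params)
    (hpar : par = { β := fun _ => β, βh := fun _ => β, θ := fun _ => θ, η := fun _ => η })
    -- the output
    (idx : Ω → Fin (T + 1)) (hidx : MinimaxSGD.IsOutputIndex S μ par L T idx)
    (xbar : Ω → MinimaxSGD.Vec p) (hxbar : ∀ ω, xbar ω = (M.run par S x₀ ω (idx ω)).x) :
    -- `F'` is the derivative of `F`, and `∇Φ₀` the gradient of `Φ₀`, on the domain of the problem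
    (∀ x ∈ MinimaxSGD.dom M.Ψ₀,
      HasFDerivWithinAt M.meanF (M.meanJac x) (MinimaxSGD.dom M.Ψ₀) x ∧
      HasGradientWithinAt (fun z => (M.Φ₀ z).toReal) (M.gradΦ₀ x) (MinimaxSGD.dom M.Ψ₀) x) ∧
    -- the convergence rate
    Integrable (fun ω => ‖M.gradMap η (xbar ω)‖ ^ 2) μ ∧
    (∫ ω, ‖M.gradMap η (xbar ω)‖ ^ 2 ∂μ ≤ Δ₀ / ((b : ℝ) * (T + 1)) ^ (2 / 3 : ℝ)) ∧
    -- the complexity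
    (∀ ε : ℝ, 0 < ε →
      (T = ⌊Δ₀ ^ (3 / 2 : ℝ) / (b * ε ^ 3)⌋₊ →
        (∫ ω, ‖M.gradMap η (xbar ω)‖ ^ 2 ∂μ ≤ ε ^ 2) ∧
        ∀ ω,
          (M.run par S x₀ ω T).evalF ≤
            ⌊c₀ * c₁ ^ 2 * (Δ₀ ^ (3 / 2 : ℝ) / ε ^ 3 + b) ^ (1 / 3 : ℝ)
              + 3 * c₀ * Δ₀ ^ (3 / 2 : ℝ) / ε ^ 3⌋₊ ∧
          (M.run par S x₀ ω T).evalJ ≤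
            ⌊c₁ ^ 2 * (Δ₀ ^ (3 / 2 : ℝ) / ε ^ 3 + b) ^ (1 / 3 : ℝ)
              + 3 * Δ₀ ^ (3 / 2 : ℝ) / ε ^ 3⌋₊) ∧
      ((T : ℝ) + 1 = Δ₀ ^ (3 / 2 : ℝ) / (b * ε ^ 3) →
        (∫ ω, ‖M.gradMap η (xbar ω)‖ ^ 2 ∂μ ≤ ε ^ 2) ∧
        ∀ ω,
          (M.run par S x₀ ω T).evalF ≤
            ⌊c₀ * c₁ ^ 2 * Δ₀ ^ (1 / 2 : ℝ) / ε + 3 * c₀ * Δ₀ ^ (3 / 2 : ℝ) / ε ^ 3⌋₊ ∧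
          (M.run par S x₀ ω T).evalJ ≤
            ⌊c₁ ^ 2 * Δ₀ ^ (1 / 2 : ℝ) / ε + 3 * Δ₀ ^ (3 / 2 : ℝ) / ε ^ 3⌋₊)) := by
  have hk : 0 < ‖M.K‖ := norm_pos_iff.mpr hK
  have hbR : (0 : ℝ) < b := by exact_mod_cast hb
  have hT0 : (0 : ℝ) ≤ T := Nat.cast_nonneg T
  have hbT0 : (0 : ℝ) < b * (T + 1) := by positivity
  have hbh₀R : (0 : ℝ) < sz.bh₀ := by rw [hbh₀]; positivity
  have pbh₀ : 0 < sz.bh₀ := by exact_mod_cast hbh₀R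
  have hN0 : (0 : ℝ) < (sz.bh₀ : ℝ) * (T + 1) := by positivity
  have hκ := S.one_le_kappa μ T
  have hκh := S.one_le_kappaHat μ T
  have hL0 : 0 < L := by rw [hL, MinimaxSGD.constL]; positivity
  have hP0 : 0 < P := by
    rw [hP]
    exact MinimaxSGD.constP_pos hk hMF hc₀ (zero_lt_one.trans_le hκ) (zero_le_one.trans hκh)
  have hQ0 : 0 < Q := by
    have h1 : 0 < S.kappa μ T := zero_lt_one.trans_le hκ
    have h2 : 0 < S.kappaHat μ T := zero_lt_one.trans_le hκh
    rw [hQ, MinimaxSGD.constQ]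
    positivity
  set u : ℝ := (b : ℝ) ^ (1 / 4 : ℝ) with hu
  set r : ℝ := ((sz.bh₀ : ℝ) * (T + 1)) ^ (1 / 4 : ℝ) with hr
  set m : ℝ := ((b : ℝ) * (T + 1)) ^ (1 / 3 : ℝ) with hm
  have hu0 : 0 < u := by positivity
  have hr0 : 0 < r := by positivity
  have hm0 : 0 < m := by positivity
  have hu4 : u ^ 4 = b := MinimaxSGD.rpow_quarter_pow hbR.le
  have hr4 : r ^ 4 = (sz.bh₀ : ℝ) * (T + 1) := MinimaxSGD.rpow_quarter_pow hN0.le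
  have hm3 : m ^ 3 = (b : ℝ) * (T + 1) := MinimaxSGD.rpow_third_cubed hbT0.le
  have hur : u ≤ r := by
    refine Real.rpow_le_rpow hbR.le ?_ (by norm_num)
    exact_mod_cast hbT
  have hβ' : 1 - β = u ^ 2 / r ^ 2 := by
    rw [hβ, MinimaxSGD.rpow_half_eq hbR.le, MinimaxSGD.rpow_half_eq hN0.le]
    ring
  have hθ' : θ = L * u ^ 3 / (P * r) := by
    rw [hθ, MinimaxSGD.rpow_three_quarters_eq hbR.le]
  have hβ1 : β < 1 := by
    have : 0 < 1 - β := by rw [hβ']; positivity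
    linarith
  have hβ0 : 0 ≤ β := by
    have : 1 - β ≤ 1 := by
      rw [hβ', div_le_one (by positivity)]
      gcongr
    linarith
  have hθ0 : 0 < θ := by rw [hθ']; positivity
  -- The fourth power of `θ ≤ 1`, in its non-strict form, is the condition `hcond`.
  have hθ1 : θ ≤ 1 := by
    rw [hθ', div_le_one (by positivity)]
    have h1 : (L * u ^ 3) ^ 4 ≤ (P * r) ^ 4 := by
      rw [div_lt_div_iff₀ (by positivity) (by positivity), ← hr4, ← hu4] at hcond
      calc (L * u ^ 3) ^ 4 = L ^ 4 * (u ^ 4) ^ 3 := by ring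
        _ ≤ r ^ 4 * P ^ 4 := hcond.le
        _ = (P * r) ^ 4 := by ring
    exact (pow_le_pow_iff_left₀ (by positivity) (by positivity) (by norm_num)).mp h1
  have h : M.Standing LF MF σF σJ Mψ L θ η :=
    ⟨hLF, hMF, hF, hR, hψ, hψdom, hψ1, hL, hL0, hθ0, hθ1, hη⟩
  have hx₀' : x₀ ∈ MinimaxSGD.dom M.R := h.dom_eq ▸ hx₀
  have hpar' : par = MinimaxSGD.constParams β θ η := hpar
  subst hpar'
  have hΔge : 0 ≤ (M.Ψ₀ x₀ - M.Ψ₀star).toReal := by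
    have := MinimaxSGD.Problem.Ψ₀star_gap hinf hx₀ hx₀
    linarith
  have hΔ0 : 0 < Δ₀ := by rw [hΔ]; positivity
  have hPθ : θ ^ 2 * P ^ 2 ≤ L ^ 2 * b * (1 - β) := by
    rw [hβ', hθ', ← hu4]
    refine le_of_eq ?_
    field_simp
  obtain ⟨hint, hsum⟩ := h.sum_integral_gradMap_le hx₀' hinf hS hb hc₀ pbh₀ hbh₁ hbh₂ hb₁ hb₂ hb₀
    hP hQ hβ0 hβ1 hPθ
  obtain ⟨hoi, hoe⟩ := h.integral_output_eq hidx hint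
  have hxe : xbar = fun ω => (M.run (MinimaxSGD.constParams β θ η) S x₀ ω (idx ω)).x :=
    funext hxbar
  have hrate : ∫ ω, ‖M.gradMap η (xbar ω)‖ ^ 2 ∂μ ≤ Δ₀ / ((b : ℝ) * (T + 1)) ^ (2 / 3 : ℝ) := by
    rw [hxe, hoe, MinimaxSGD.rpow_two_thirds_eq hbT0.le]
    refine (MinimaxSGD.rate_of_sum_le hu0 hr0 hm0 hT0 hP0 hL0 hc₁ hQ0.le hu4.symm rfl hr4.symm
      hm3.symm hbh₀ hβ' hβ0 hβ1 hθ' hsum).trans ?_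
    rw [hΔ]
    -- The argument yields `16Q/c₁`, which is below the stated `24Q/c₁`.
    gcongr
    norm_num
  have hevalF : ∀ ω, (((M.run (MinimaxSGD.constParams β θ η) S x₀ ω T).evalF : ℕ) : ℝ)
      = c₀ * c₁ ^ 2 * m + 3 * c₀ * (b * T) := by
    intro ω
    rw [(MinimaxSGD.evaluations_run M _ S x₀ ω T).1]
    push_cast
    rw [hb₀, hb₁, hb₂, hbh₀]
    ring
  have hevalJ : ∀ ω, (((M.run (MinimaxSGD.constParams β θ η) S x₀ ω T).evalJ : ℕ) : ℝ)
      = c₁ ^ 2 * m + 3 * (b * T) := by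
    intro ω
    rw [(MinimaxSGD.evaluations_run M _ S x₀ ω T).2, hbh₁, hbh₂]
    push_cast
    rw [hbh₀]
    ring
  refine ⟨fun x hx => ⟨hF.hasFDerivWithinAt_meanF hLF h.convex_dom hx,
    hF.hasGradientWithinAt_Φ₀ hLF hψ hψ1 h.convex_dom hx⟩, ?_, hrate, fun ε hε => ?_⟩
  · rw [hxe]; exact hoi
  set D : ℝ := Δ₀ ^ (3 / 2 : ℝ) with hD
  have hD0 : 0 < D := by positivity
  refine ⟨fun hT => ?_, fun hT => ?_⟩
  -- The two sides of the floor serve different ends: `T + 1` exceeds the threshold, which gives the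
  -- accuracy, and `T` stays below it, which bounds the evaluations.
  · have h1 : D / (b * ε ^ 3) < T + 1 := by
      rw [hT]; exact Nat.lt_floor_add_one _
    have h2 : (T : ℝ) ≤ D / (b * ε ^ 3) := by
      conv_lhs => rw [hT]
      exact Nat.floor_le (by positivity)
    have h3 : D / ε ^ 3 ≤ b * (T + 1) := by
      rw [div_lt_iff₀ (by positivity)] at h1
      rw [div_le_iff₀ (by positivity)]
      linarith
    have h4 : b * T ≤ D / ε ^ 3 := by
      rw [le_div_iff₀ (by positivity)] at h2
      rw [le_div_iff₀ (by positivity)]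
      linarith
    have h5 : m ≤ (D / ε ^ 3 + b) ^ (1 / 3 : ℝ) :=
      Real.rpow_le_rpow hbT0.le (by linarith) (by norm_num)
    refine ⟨hrate.trans (MinimaxSGD.div_rpow_le_sq hΔ0 hε h3), fun ω => ⟨?_, ?_⟩⟩
    · refine Nat.le_floor ?_
      rw [hevalF]
      calc c₀ * c₁ ^ 2 * m + 3 * c₀ * (b * T)
          ≤ c₀ * c₁ ^ 2 * (D / ε ^ 3 + b) ^ (1 / 3 : ℝ) + 3 * c₀ * (D / ε ^ 3) := by gcongr
        _ = _ := by ring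
    · refine Nat.le_floor ?_
      rw [hevalJ]
      calc c₁ ^ 2 * m + 3 * (b * T)
          ≤ c₁ ^ 2 * (D / ε ^ 3 + b) ^ (1 / 3 : ℝ) + 3 * (D / ε ^ 3) := by gcongr
        _ = _ := by ring
  · have h1 : b * ((T : ℝ) + 1) = D / ε ^ 3 := by rw [hT]; field_simp
    have h4 : b * T ≤ D / ε ^ 3 := by linarith
    -- Here `b(T+1) = D/ε³` exactly, so the cube root that governs the initial batch size is
    -- explicit.
    have h5 : m = Δ₀ ^ (1 / 2 : ℝ) / ε := by
      rw [hm, h1, hD, Real.div_rpow (by positivity) (by positivity), ← Real.rpow_mul hΔ0.le,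
        ← Real.rpow_natCast ε 3, ← Real.rpow_mul hε.le]
      norm_num
    refine ⟨hrate.trans (MinimaxSGD.div_rpow_le_sq hΔ0 hε h1.ge), fun ω => ⟨?_, ?_⟩⟩
    · refine Nat.le_floor ?_
      rw [hevalF, h5]
      calc c₀ * c₁ ^ 2 * (Δ₀ ^ (1 / 2 : ℝ) / ε) + 3 * c₀ * (b * T)
          ≤ c₀ * c₁ ^ 2 * (Δ₀ ^ (1 / 2 : ℝ) / ε) + 3 * c₀ * (D / ε ^ 3) := by gcongr
        _ = _ := by ring
    · refine Nat.le_floor ?_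
      rw [hevalJ, h5]
      calc c₁ ^ 2 * (Δ₀ ^ (1 / 2 : ℝ) / ε) + 3 * (b * T)
          ≤ c₁ ^ 2 * (Δ₀ ^ (1 / 2 : ℝ) / ε) + 3 * (D / ε ^ 3) := by gcongr
        _ = _ := by ring
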